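/- For $s\ge 1$ let $\sigma_s(x)=e^{sx}/(1+e^{sx})$ and, for $m\in\mathbb N$, $$\phi_m(x)=-(2m+1)+\sum_{k=-m}^{m}\Big(\sigma_s\big(x-\tfrac{4k-1}{s}\big)+\sigma_s\big(\tfrac{4k+1}{s}-x\big)\Big).$$ For a probability distribution $D$ on $\mathbb R$ with mean $\mu_D$, reals $a,b$ and $S\subseteq\{1,\dots,n\}$ put $$f_S(x)=a\,\phi_m\Big(\sum_{i\in S}(x_i-\mu_D)\Big)+b\qquad(x\in\mathbb R^n),$$ a function computed by a network with one hidden layer of $2(2m+1)$ sigmoid units of sharpness $s$ and an affine output gate. **Statistical queries.** For $f:\mathbb R^n\to Y$ with $Y\subseteq[-1,1]$ finite, a query is an arbitrary measurable function $h:\mathbb R^n\times Y\to[0,1]$. Put $p=\mathbb E_{x\sim D^n}h(x,f(x))$. A $\mathrm{VSTAT}(t)$ oracle for $f$ over $D^n$ answers $h$ by some value $v$ with $|p-v|\le\max\{1/t,\sqrt{p(1-p)/t}\}$. A randomized SQ algorithm adaptively asks queries, with unrestricted randomized computation in between, and then outputs a measurable hypothesis $g:\mathbb R^n\to\mathbb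 R$; its regression error is $\mathbb E_{x\sim D^n}(g(x)-f(x))^2$. It learns a class of functions over $D^n$ to error less than $\varepsilon$, with probability at least $1/2$, using at most $q$ queries to $\mathrm{VSTAT}(t)$, if for every $f$ in the class and every $\mathrm{VSTAT}(t)$ oracle for $f$, with probability at least $1/2$ it stops after at most $q$ queries with a hypothesis of regression error less than $\varepsilon$. **Corollary.** There are absolute constants $c,C>0$ and $n_0\in\mathbb N$, and for each $\kappa>0$ a constant $\varepsilon_0>0$ depending only on $\kappa$, such that the following holds for all $n\ge n_0$, all $s\ge1$, and every uniformly spaced finite set $Y\subseteq[-1,1]$ with $\max Y-\min Y\ge\kappa$. There are $m,t\in\mathbb N$ and $a,b\in\mathbb R$ with $$2(2m+1)\le C\,s\sqrt n\,\log(|Y|sn),\qquad t\ge c\,s^2n,\qquad a\,\phi_m(u)+b\in[-1,1]\ \text{ for all }u\in\mathbb R,$$ such that for every rounding $r:\mathbb R\to Y$ to a nearest point of $Y$ and every logconcave distribution $D$ on $\mathbb R$ with unit variance, every randomized SQ algorithm that learns the class $\{r\circ f_S: S\subseteq\{1,\dots,n\}\}$ over $D^n$ to regression error less than $\varepsilon_0-\sqrt{1/t}$,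 with probability at least $1/2$, using at most $q$ (arbitrary, not necessarily Lipschitz) queries to $\mathrm{VSTAT}(t)$, satisfies $$q\ \ge\ \frac{2^{cn}}{|Y|\,s^2}.$$ -/

import Mathlib

open MeasureTheory ProbabilityTheory

noncomputable section

/-- The sigmoid gate of sharpness `s`. -/
def sigmoidGate (s x : ℝ) : ℝ := Real.exp (s * x) / (1 + Real.exp (s * x))

/-- The one-variable `s`-wave function `φ_m`, an affine combination of `2 (2m+1)` sigmoid gates of
sharpness `s`. -/
def sWave (s : ℝ) (m : ℕ) (x : ℝ) : ℝ :=
  -(2 * (m : ℝ) + 1) + ∑ k ∈ Finset.Icc (-(m : ℤ)) (m : ℤ),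
    (sigmoidGate s (x - (4 * (k : ℝ) - 1) / s) + sigmoidGate s ((4 * (k : ℝ) + 1) / s - x))

/-- The function `x ↦ a φ_m(∑_{i ∈ S} (x_i - μ)) + b` on `ℝⁿ`: the `s`-wave function of the set `S`,
centred at `μ` in every coordinate and with affine output gate `v ↦ a v + b`. -/
def sWaveOn {n : ℕ} (s : ℝ) (m : ℕ) (a b μ : ℝ) (S : Finset (Fin n)) (x : Fin n → ℝ) : ℝ :=
  a * sWave s m (∑ i ∈ S, (x i - μ)) + b

/-- `Y` is a finite arithmetic progression with positive step. -/
def IsUniformlySpaced (Y : Finset ℝ) : Prop :=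
  ∃ (N : ℕ) (y₀ h : ℝ), 0 < h ∧ Y = (Finset.range N).image (fun j : ℕ => y₀ + (j : ℝ) * h)

/-- `r` rounds every real number to a nearest point of `Y` (ties are broken arbitrarily). -/
def IsRounding {Y : Finset ℝ} (r : ℝ → Y) : Prop :=
  ∀ z : ℝ, ∀ y ∈ Y, |z - (r z : ℝ)| ≤ |z - y|

/-- The measure `D` on `ℝ` has a logconcave density. -/
def HasLogConcaveDensity (D : Measure ℝ) : Prop :=
  ∃ p : ℝ → ℝ, Measurable p ∧ (∀ x, 0 ≤ p x) ∧
    (∀ x y a b : ℝ, 0 ≤ a → 0 ≤ b → a + b = 1 → p x ^ a * p y ^ b ≤ p (a * x + b * y)) ∧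
    D = volume.withDensity (fun x => ENNReal.ofReal (p x))

/-- A statistical query about examples `x : X` with label in `L`: a measurable function with values
in `[0,1]`. No regularity beyond measurability is required. -/
structure SQQuery (X L : Type) [MeasurableSpace X] [MeasurableSpace L] where
  toFun : X × L → ℝ
  measurable_toFun : Measurable toFun
  mem_Icc : ∀ z, toFun z ∈ Set.Icc (0 : ℝ) 1

/-- The expectation of the query `h` over labelled examples `(x, f x)` with `x ∼ μ`. -/
def SQQuery.expect {X L : Type} [MeasurableSpace X] [MeasurableSpace L]
    (h : SQQuery X L) (μ : Measure X) (f : X → L) : ℝ :=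
  ∫ x, h.toFun (x, f x) ∂μ

/-- `O` is a `VSTAT(t)` oracle for the distribution of `(x, f x)`, `x ∼ μ`. -/
def IsVSTATOracle {X L : Type} [MeasurableSpace X] [MeasurableSpace L]
    (t : ℕ) (μ : Measure X) (f : X → L) (O : SQQuery X L → ℝ) : Prop :=
  ∀ h : SQQuery X L, |h.expect μ f - O h| ≤
    max (1 / (t : ℝ)) (Real.sqrt (h.expect μ f * (1 - h.expect μ f) / (t : ℝ)))

/-- A deterministic, adaptive statistical query algorithm: it either stops with a measurable
hypothesis `g : X → ℝ`, or asks a query and continues according to the real number received.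
The computation between queries is unrestricted. -/
inductive SQAlg (X L : Type) [MeasurableSpace X] [MeasurableSpace L] : Type where
  | output (g : X → ℝ) (hg : Measurable g) : SQAlg X L
  | ask (h : SQQuery X L) (next : ℝ → SQAlg X L) : SQAlg X L

/-- The hypothesis returned when the queries are answered by `O`. -/
def SQAlg.hypothesis {X L : Type} [MeasurableSpace X] [MeasurableSpace L]
    (O : SQQuery X L → ℝ) : SQAlg X L → (X → ℝ)
  | .output g _ => g
  | .ask h next => SQAlg.hypothesis O (next (O h))

/-- The number of queries asked when the queries are answered by `O`. -/
def SQAlg.numQueries {X L : Type} [MeasurableSpace X] [MeasurableSpace L]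
    (O : SQQuery X L → ℝ) : SQAlg X L → ℕ
  | .output _ _ => 0
  | .ask h next => SQAlg.numQueries O (next (O h)) + 1

/-- The regression error `E_{x ∼ μ} (g x - f x)²`, as an extended nonnegative real. -/
def regressionError {X : Type} [MeasurableSpace X] (μ : Measure X) (g f : X → ℝ) : ENNReal :=
  ∫⁻ x, ENNReal.ofReal ((g x - f x) ^ 2) ∂μ

/-- The randomized statistical query algorithm `A` (a deterministic one for each random seed
`ω ∼ P`) learns the concept `f`, over inputs drawn from `μ`, to regression error less than `ε`
using at most `q` queries to `VSTAT(t)`, with probability at least `1/2`: whichever `VSTAT(t)`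
oracle answers, there is an event of probability at least `1/2` on which `A` stops after at most
`q` queries with a hypothesis of regression error less than `ε`. -/
def LearnsWithin {X : Type} [MeasurableSpace X] {Y : Finset ℝ} {Ω : Type} [MeasurableSpace Ω]
    (P : Measure Ω) (A : Ω → SQAlg X Y) (μ : Measure X) (f : X → Y) (t q : ℕ) (ε : ℝ) : Prop :=
  ∀ O : SQQuery X Y → ℝ, IsVSTATOracle t μ f O →
    ∃ E : Set Ω, MeasurableSet E ∧ 1 / 2 ≤ P E ∧
      ∀ ω ∈ E, (A ω).numQueries O ≤ q ∧
        regressionError μ ((A ω).hypothesis O) (fun x => (f x : ℝ)) < ENNReal.ofReal ε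

end

/-! While the centred sum over `S` stays in the range covered by the bumps, the wave is almost
periodic with period `4 / s ≤ 4`, so the label is almost `Φ` of that sum for one periodic `Φ : ℝ →
Y` common to all concepts. A sum of many independent logconcave variables of unit variance is
equidistributed modulo such a period up to an exponentially small error
(`exists_equidistribution_rate`): some fixed convolution power dominates a multiple of Lebesgue
measure on an interval of length 4, and every further block of summands contracts periodic functions
of mean zero. If `S \ T` or `T \ S` has linear size, the private coordinates can be integrated out
first, so the labels of `S` and `T` are almost independent, each with nearly the law `labelMass`
(`abs_integral_ite_mul_ite_le`).

Every query is therefore answered as if the label were drawn from `labelMass` independently of the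
input. By a second moment argument this answer is illegal for at most `72 * t * |Y|` concepts of a
family with such differences (`card_not_isVSTATAnswer_le`). A run of `q` queries rules out at most
`q` times as many concepts, and its hypothesis fits at most one of the others, because two concepts
are at constant distance in `L²` (`le_integral_sq_sub`). As an exponentially large family exists
(`exists_separated_family_of_large`), `q` is exponential (`card_le_of_learnsWithin`).

Replacing the wave by its periodization changes a label only if the sum leaves the range of the
bumps or the value falls very close to a rounding threshold. The logarithmic factor in the number of
units makes the first event polynomially rare in `|Y| s n`. For the second, the output gate is
shifted so that the wave is seldom near any midpoint of two labels (`exists_shift_volume_le`).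
Polynomial smallness suffices there, since the second moment argument only loses a factor `(t |Y|) ^
2`. The gate is centred at a threshold in the middle of `Y`, so that rounding preserves the
oscillation of the wave. All these choices precede `r` and `D`. -/

/-! ### Adaptive algorithms against a default oracle. -/

/-- The first `q` queries asked by `A` when the queries are answered by `O`. -/
def SQAlg.queries {X L : Type} [MeasurableSpace X] [MeasurableSpace L]
    (O : SQQuery X L → ℝ) : ℕ → SQAlg X L → List (SQQuery X L)
  | 0, _ => []
  | _ + 1, .output _ _ => []
  | q + 1, .ask h next => h :: SQAlg.queries O q (next (O h))

lemma SQAlg.length_queries_le {X L : Type} [MeasurableSpace X] [MeasurableSpace L]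
    (O : SQQuery X L → ℝ) (q : ℕ) (A : SQAlg X L) : (A.queries O q).length ≤ q := by
  induction q generalizing A with
  | zero => simp [SQAlg.queries]
  | succ q ih =>
    cases A with
    | output g hg => simp [SQAlg.queries]
    | ask h next => simpa [SQAlg.queries] using ih _

lemma SQAlg.measurable_hypothesis {X L : Type} [MeasurableSpace X] [MeasurableSpace L]
    (O : SQQuery X L → ℝ) (A : SQAlg X L) : Measurable (A.hypothesis O) := by
  induction A with
  | output g hg => simpa [SQAlg.hypothesis] using hg
  | ask h next ih => simpa [SQAlg.hypothesis] using ih _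

/-- Equal answers lead down the same branch. Only the run against `O'` is required to stop within
`q` queries: agreement forces the other run to stop at the same leaf. -/
lemma SQAlg.hypothesis_congr {X L : Type} [MeasurableSpace X] [MeasurableSpace L]
    {O O' : SQQuery X L → ℝ} {q : ℕ} {A : SQAlg X L}
    (h : ∀ k ∈ A.queries O q, O' k = O k) (hq : A.numQueries O' ≤ q) :
    A.hypothesis O' = A.hypothesis O := by
  induction A generalizing q with
  | output g hg => simp [SQAlg.hypothesis]
  | ask k next ih =>
    cases q with
    | zero => simp [SQAlg.numQueries] at hq
    | succ q =>
      have h1 : O' k = O k := h k (by simp [SQAlg.queries])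
      simp only [SQAlg.numQueries, h1] at hq
      simp only [SQAlg.hypothesis, h1]
      exact ih _ (q := q) (fun l hl => h l (by simp [SQAlg.queries, hl])) (by omega)

/-- `v` is an admissible answer of a `VSTAT(t)` oracle to the query `h`. -/
def IsVSTATAnswer {X L : Type} [MeasurableSpace X] [MeasurableSpace L]
    (t : ℕ) (μ : Measure X) (f : X → L) (h : SQQuery X L) (v : ℝ) : Prop :=
  |h.expect μ f - v| ≤
    max (1 / (t : ℝ)) (Real.sqrt (h.expect μ f * (1 - h.expect μ f) / (t : ℝ)))

-- Fix the seed and follow the run against the default answers `O`. A concept that accepts all of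
-- the at most `q` answers given there cannot be told apart from the others that do, so all of them
-- receive the same hypothesis, and by separation it is good for at most one. Hence each seed
-- succeeds for at most `q * B + 1` concepts, while each concept succeeds with probability at least
-- one half; double counting over seeds gives the bound.
open Classical in
theorem card_le_of_learnsWithin {X : Type} [MeasurableSpace X] {Y : Finset ℝ} {Ω : Type}
    [MeasurableSpace Ω] (P : Measure Ω) [IsProbabilityMeasure P] (A : Ω → SQAlg X Y)
    (μ : Measure X) {ι : Type} [Fintype ι] (f : ι → X → Y) (t q B : ℕ) (ε : ℝ)
    (O : SQQuery X Y → ℝ)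
    (hB : ∀ h, (Finset.univ.filter (fun i => ¬ IsVSTATAnswer t μ (f i) h (O h))).card ≤ B)
    (hsep : ∀ i j, ∀ g : X → ℝ, Measurable g →
      regressionError μ g (fun x => (f i x : ℝ)) < ENNReal.ofReal ε →
      regressionError μ g (fun x => (f j x : ℝ)) < ENNReal.ofReal ε → i = j)
    (hL : ∀ i, LearnsWithin P A μ (f i) t q ε) : Fintype.card ι ≤ 2 * (q * B + 1) := by
  -- The oracle for concept `i` departs from `O` only where `O` would be illegal for `i`.
  let O' : ι → SQQuery X Y → ℝ := fun i h =>
    if IsVSTATAnswer t μ (f i) h (O h) then O h else h.expect μ (f i)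
  have hO' : ∀ i, IsVSTATOracle t μ (f i) (O' i) := by
    intro i h
    by_cases hv : IsVSTATAnswer t μ (f i) h (O h)
    · simp only [O', hv, if_true]; exact hv
    · simp only [O', hv, if_false, sub_self, abs_zero]
      exact le_max_of_le_left (by positivity)
  choose E hEm hEP hE using fun i => hL i (O' i) (hO' i)
  have key : ∀ ω, (Finset.univ.filter (fun i => ω ∈ E i)).card ≤ q * B + 1 := by
    intro ω
    set Bad : SQQuery X Y → Finset ι :=
      fun h => Finset.univ.filter (fun i => ¬ IsVSTATAnswer t μ (f i) h (O h))
    set U : Finset ι := ((A ω).queries O q).toFinset.biUnion Bad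
    set G : Finset ι := Finset.univ.filter (fun i =>
      regressionError μ ((A ω).hypothesis O) (fun x => (f i x : ℝ)) < ENNReal.ofReal ε)
    have hsub : Finset.univ.filter (fun i => ω ∈ E i) ⊆ U ∪ G := by
      intro i hi
      rw [Finset.mem_filter] at hi
      rw [Finset.mem_union]
      by_cases hU : i ∈ U
      · exact Or.inl hU
      · right
        obtain ⟨h1, h2⟩ := hE i ω hi.2
        have h3 : (A ω).hypothesis (O' i) = (A ω).hypothesis O := by
          refine SQAlg.hypothesis_congr (q := q) (fun k hk => ?_) h1
          have : IsVSTATAnswer t μ (f i) k (O k) := by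
            by_contra hb
            apply hU
            simp only [U, Finset.mem_biUnion, List.mem_toFinset]
            exact ⟨k, hk, by simp [Bad, hb]⟩
          simp only [O', this, if_true]
        rw [h3] at h2
        simp only [G, Finset.mem_filter, Finset.mem_univ, true_and]
        exact h2
    have hU : U.card ≤ q * B := by
      calc U.card ≤ ((A ω).queries O q).toFinset.card * B :=
            Finset.card_biUnion_le_card_mul _ _ _ (fun h _ => hB h)
        _ ≤ q * B := by
            gcongr
            exact (List.toFinset_card_le _).trans (SQAlg.length_queries_le _ _ _)
    have hG : G.card ≤ 1 := by
      rw [Finset.card_le_one]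
      intro i hi j hj
      simp only [G, Finset.mem_filter, Finset.mem_univ, true_and] at hi hj
      exact hsep i j _ (SQAlg.measurable_hypothesis _ _) hi hj
    calc _ ≤ (U ∪ G).card := Finset.card_le_card hsub
      _ ≤ U.card + G.card := Finset.card_union_le _ _
      _ ≤ q * B + 1 := by omega
  have h1 : (Fintype.card ι : ENNReal) * (1 / 2) ≤ ((q * B + 1 : ℕ) : ENNReal) := by
    calc (Fintype.card ι : ENNReal) * (1 / 2) = ∑ _i : ι, (1 / 2 : ENNReal) := by simp
      _ ≤ ∑ i, P (E i) := Finset.sum_le_sum (fun i _ => hEP i)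
      _ = ∑ i, ∫⁻ ω, (E i).indicator 1 ω ∂P := by
          refine Finset.sum_congr rfl (fun i _ => ?_)
          rw [lintegral_indicator_one (hEm i)]
      _ = ∫⁻ ω, ∑ i, (E i).indicator 1 ω ∂P := by
          rw [lintegral_finsetSum]
          intro i _
          exact measurable_one.indicator (hEm i)
      _ ≤ ∫⁻ _, ((q * B + 1 : ℕ) : ENNReal) ∂P := by
          refine lintegral_mono (fun ω => ?_)
          have : ∑ i, (E i).indicator (1 : Ω → ENNReal) ω
              = ((Finset.univ.filter (fun i => ω ∈ E i)).card : ENNReal) := by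
            simp [Set.indicator_apply]
          rw [this]
          exact Nat.cast_le.mpr (by convert key ω)
      _ = _ := by simp
  have h2 : (Fintype.card ι : ENNReal) ≤ ((2 * (q * B + 1) : ℕ) : ENNReal) := by
    have : (Fintype.card ι : ENNReal) = 2 * ((Fintype.card ι : ENNReal) * (1 / 2)) := by
      rw [mul_comm, mul_assoc, ENNReal.div_mul_cancel] <;> simp
    rw [this]
    push_cast at h1 ⊢
    gcongr
  exact_mod_cast h2

/-! ### Few concepts reject the reference answer. -/

/-- A signed sum of deviations of a query is controlled by the covariances of the label events. -/
theorem card_le_of_signed_deviation {X : Type} [MeasurableSpace X] {Y : Type} [Fintype Y]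
    [DecidableEq Y] [Nonempty Y] [MeasurableSpace Y] [MeasurableSingletonClass Y]
    (μ : Measure X) [IsProbabilityMeasure μ] {ι : Type} (f : ι → X → Y)
    (hf : ∀ i, Measurable (f i)) (p : Y → ℝ) (hp : ∀ y, 0 ≤ p y) (hp1 : ∑ y, p y = 1)
    (t : ℕ) (ht : 0 < t) (δ : ℝ) (hδ0 : 0 ≤ δ)
    (hδ : 36 * (t : ℝ) ^ 2 * (Fintype.card Y : ℝ) ^ 2 * δ ≤ 1)
    (hcov : ∀ i j, i ≠ j → ∀ y, |∫ x, ((if f i x = y then (1 : ℝ) else 0) - p y) *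
      ((if f j x = y then (1 : ℝ) else 0) - p y) ∂μ| ≤ δ)
    (hdiag : ∀ i y, ∫ x, (if f i x = y then (1 : ℝ) else 0) ∂μ
      ≤ p y + 1 / (t * Fintype.card Y))
    (h : X → Y → ℝ) (hm : ∀ y, Measurable (fun x => h x y)) (h01 : ∀ x y, h x y ∈ Set.Icc (0 : ℝ) 1)
    (B : Finset ι) (σ : ι → ℝ) (hσ : ∀ i, σ i ^ 2 = 1) (D : ℝ) (hD : 0 < D)
    (hDB : ∀ i ∈ B, D ≤ σ i * ∑ y, ∫ x, h x y * ((if f i x = y then (1 : ℝ) else 0) - p y) ∂μ)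
    (hD2 : (∑ y, p y * ∫ x, h x y ∂μ + 1 / t) / (18 * t) ≤ D ^ 2) :
    (B.card : ℝ) ≤ 72 * t * Fintype.card Y := by
  classical
  have hN : (0 : ℝ) < Fintype.card Y := by exact_mod_cast Fintype.card_pos
  have htR : (0 : ℝ) < t := by exact_mod_cast ht
  set N : ℝ := (Fintype.card Y : ℝ) with hNdef
  have hp_le : ∀ y, p y ≤ 1 := fun y => by
    rw [← hp1]; exact Finset.single_le_sum (fun y _ => hp y) (Finset.mem_univ y)
  set I : ι → Y → X → ℝ := fun i y x => (if f i x = y then (1 : ℝ) else 0) - p y with hI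
  have hIm : ∀ i y, Measurable (I i y) := fun i y =>
    (Measurable.ite (hf i (measurableSet_singleton y)) measurable_const measurable_const).sub_const _
  have hIb : ∀ i y x, |I i y x| ≤ 1 := by
    intro i y x
    have h0 := hp y; have h1 := hp_le y
    simp only [hI]; rw [abs_le]; split_ifs <;> constructor <;> linarith
  have int_of : ∀ (g : X → ℝ) (C : ℝ), Measurable g → (∀ x, |g x| ≤ C) → Integrable g μ :=
    fun g C hg hC => Integrable.of_bound hg.aestronglyMeasurable C (ae_of_all _ hC)
  set F : Y → X → ℝ := fun y x => ∑ i ∈ B, σ i * I i y x with hF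
  have hFm : ∀ y, Measurable (F y) := fun y =>
    Finset.measurable_sum _ (fun i _ => (hIm i y).const_mul _)
  have hσ1 : ∀ i, |σ i| = 1 := fun i => by
    have h1 : |σ i| ^ 2 = 1 := by rw [sq_abs, hσ i]
    nlinarith [abs_nonneg (σ i)]
  have hFb : ∀ y x, |F y x| ≤ B.card := by
    intro y x
    calc |F y x| ≤ ∑ i ∈ B, |σ i * I i y x| := Finset.abs_sum_le_sum_abs _ _
      _ ≤ ∑ _i ∈ B, (1 : ℝ) := Finset.sum_le_sum (fun i _ => by
          rw [abs_mul, hσ1, one_mul]; exact hIb i y x)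
      _ = B.card := by simp
  -- Weights for Cauchy–Schwarz over the labels. The extra `1 / (t * N)` keeps them away from zero,
  -- so that dividing the covariance error `δ` by them is harmless, and it raises the total weight
  -- of the query by at most `1 / t`, the additive tolerance of the oracle.
  set w : Y → ℝ := fun y => p y + 1 / (t * N) with hw
  have hw0 : ∀ y, 1 / (t * N) ≤ w y := fun y => by simp only [hw]; linarith [hp y]
  have hwpos : ∀ y, 0 < w y := fun y => lt_of_lt_of_le (by positivity) (hw0 y)
  have hhb : ∀ y x, |h x y| ≤ 1 := fun y x => by
    rw [abs_of_nonneg (h01 x y).1]; exact (h01 x y).2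
  have hInt : ∀ y, Integrable (fun x => h x y) μ := fun y => int_of _ 1 (hm y) (hhb y)
  have hint1 : ∀ y, ∫ x, h x y ∂μ ≤ 1 := by
    intro y
    calc ∫ x, h x y ∂μ ≤ ∫ _x, (1 : ℝ) ∂μ :=
          integral_mono (hInt y) (integrable_const _) (fun x => (h01 x y).2)
      _ = 1 := by simp
  have hint0 : ∀ y, 0 ≤ ∫ x, h x y ∂μ := fun y => integral_nonneg (fun x => (h01 x y).1)
  set P : ℝ := ∑ y, p y * ∫ x, h x y ∂μ + 1 / t with hP
  have hPpos : 0 < P := by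
    have : 0 ≤ ∑ y, p y * ∫ x, h x y ∂μ :=
      Finset.sum_nonneg (fun y _ => mul_nonneg (hp y) (hint0 y))
    have : (0 : ℝ) < 1 / t := by positivity
    linarith
  have hwP : ∑ y, w y * ∫ x, h x y ∂μ ≤ P := by
    have h1 : ∀ y ∈ Finset.univ, w y * ∫ x, h x y ∂μ ≤ p y * ∫ x, h x y ∂μ + 1 / (t * N) := by
      intro y _
      simp only [hw, add_mul]
      have : 1 / (t * N) * ∫ x, h x y ∂μ ≤ 1 / (t * N) * 1 :=
        mul_le_mul_of_nonneg_left (hint1 y) (by positivity)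
      linarith
    refine (Finset.sum_le_sum h1).trans (le_of_eq ?_)
    rw [Finset.sum_add_distrib, Finset.sum_const, Finset.card_univ, nsmul_eq_mul, ← hNdef, hP]
    congr 1
    field_simp
  have hFsq : ∀ y, ∫ x, F y x ^ 2 ∂μ ≤ 2 * w y * B.card + (B.card : ℝ) ^ 2 * δ := by
    intro y
    have hpair : ∀ i ∈ B, ∀ j ∈ B, ∫ x, (σ i * I i y x) * (σ j * I j y x) ∂μ
        ≤ (if i = j then 2 * w y else 0) + δ := by
      intro i _ j _
      by_cases hij : i = j
      · subst hij
        rw [if_pos rfl]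
        have h1 : ∫ x, (σ i * I i y x) * (σ i * I i y x) ∂μ
            ≤ ∫ x, ((if f i x = y then (1 : ℝ) else 0) + p y) ∂μ := by
          refine integral_mono ?_ ?_ ?_
          · refine int_of _ 1 (((hIm i y).const_mul _).mul ((hIm i y).const_mul _)) (fun x => ?_)
            rw [abs_mul, abs_mul, hσ1, one_mul]
            have := hIb i y x
            nlinarith [abs_nonneg (I i y x)]
          · refine int_of _ 2 ((Measurable.ite (hf i (measurableSet_singleton y))
              measurable_const measurable_const).add_const _) (fun x => ?_)
            have h0 := hp y; have h1 := hp_le y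
            rw [abs_le]; split_ifs <;> constructor <;> linarith
          · intro x
            have h0 := hp y; have h1 := hp_le y; have h2 := hσ i
            have h3 : (σ i * I i y x) * (σ i * I i y x) = I i y x ^ 2 := by
              linear_combination (I i y x) ^ 2 * h2
            simp only [h3]
            simp only [hI]
            split_ifs <;> nlinarith
        have h2 : ∫ x, ((if f i x = y then (1 : ℝ) else 0) + p y) ∂μ ≤ 2 * w y := by
          rw [integral_add _ (integrable_const _)]
          · have h3 := hdiag i y
            have h4 : (0 : ℝ) < 1 / (t * N) := by positivity
            simp only [integral_const, probReal_univ, smul_eq_mul, one_mul, hw]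
            linarith
          · refine int_of _ 1 (Measurable.ite (hf i (measurableSet_singleton y))
              measurable_const measurable_const) (fun x => ?_)
            split_ifs <;> simp
        linarith
      · rw [if_neg hij, zero_add]
        have h1 : ∀ x, (σ i * I i y x) * (σ j * I j y x) = (σ i * σ j) * (I i y x * I j y x) :=
          fun x => by ring
        simp_rw [h1]
        rw [integral_const_mul]
        refine (le_abs_self _).trans ?_
        rw [abs_mul, abs_mul, hσ1, hσ1, one_mul, one_mul]
        exact hcov i j hij y
    have hexp : ∀ x, F y x ^ 2 = ∑ i ∈ B, ∑ j ∈ B, (σ i * I i y x) * (σ j * I j y x) := by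
      intro x
      rw [sq, hF, Finset.sum_mul_sum]
    have hii : ∀ i j, Integrable (fun x => (σ i * I i y x) * (σ j * I j y x)) μ := by
      intro i j
      refine int_of _ 1 (((hIm i y).const_mul _).mul ((hIm j y).const_mul _)) (fun x => ?_)
      rw [abs_mul, abs_mul, abs_mul, hσ1, hσ1, one_mul, one_mul]
      exact mul_le_one₀ (hIb i y x) (abs_nonneg _) (hIb j y x)
    simp_rw [hexp]
    rw [integral_finsetSum _ (fun i _ => integrable_finsetSum _ (fun j _ => hii i j))]
    simp_rw [integral_finsetSum _ (fun j _ => hii _ j)]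
    calc _ ≤ ∑ i ∈ B, ∑ j ∈ B, ((if i = j then 2 * w y else 0) + δ) :=
          Finset.sum_le_sum (fun i hi => Finset.sum_le_sum (fun j hj => hpair i hi j hj))
      _ = ∑ i ∈ B, (2 * w y + B.card * δ) := by
          refine Finset.sum_congr rfl (fun i hi => ?_)
          rw [Finset.sum_add_distrib, Finset.sum_ite_eq, if_pos hi]
          simp
      _ = _ := by
          rw [Finset.sum_const, nsmul_eq_mul]; ring
  set V : ℝ := ∑ y, (∫ x, F y x ^ 2 ∂μ) / w y with hV
  have hVle : V ≤ 2 * N * B.card + (B.card : ℝ) ^ 2 / (36 * t) := by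
    have h1 : ∀ y ∈ Finset.univ, (∫ x, F y x ^ 2 ∂μ) / w y
        ≤ 2 * B.card + (B.card : ℝ) ^ 2 * δ * (t * N) := by
      intro y _
      rw [div_le_iff₀ (hwpos y)]
      refine (hFsq y).trans ?_
      have h2 : 1 ≤ t * N * w y := by
        have := mul_le_mul_of_nonneg_left (hw0 y) (by positivity : 0 ≤ t * N)
        rwa [mul_one_div, div_self (by positivity)] at this
      have h3 : 0 ≤ (B.card : ℝ) ^ 2 * δ := by positivity
      nlinarith
    refine (Finset.sum_le_sum h1).trans ?_
    rw [Finset.sum_const, Finset.card_univ, nsmul_eq_mul, ← hNdef]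
    have h2 : N * ((B.card : ℝ) ^ 2 * δ * (t * N)) ≤ (B.card : ℝ) ^ 2 / (36 * t) := by
      rw [le_div_iff₀ (by positivity)]
      have h3 := mul_le_mul_of_nonneg_left hδ (sq_nonneg (B.card : ℝ))
      nlinarith
    linarith
  by_cases hB0 : B.card = 0
  · rw [hB0]; simp only [Nat.cast_zero]; positivity
  have hBpos : (0 : ℝ) < B.card := by exact_mod_cast Nat.pos_of_ne_zero hB0
  have hsum : B.card * D ≤ ∑ y, ∫ x, h x y * F y x ∂μ := by
    have h1 : (B.card : ℝ) * D
        ≤ ∑ i ∈ B, σ i * ∑ y, ∫ x, h x y * ((if f i x = y then (1 : ℝ) else 0) - p y) ∂μ := by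
      rw [← nsmul_eq_mul]
      exact Finset.card_nsmul_le_sum _ _ _ hDB
    refine h1.trans (le_of_eq ?_)
    simp_rw [Finset.mul_sum]
    rw [Finset.sum_comm]
    refine Finset.sum_congr rfl (fun y _ => ?_)
    have h2 : ∀ x, h x y * F y x = ∑ i ∈ B, σ i * (h x y * I i y x) := by
      intro x
      simp only [hF, Finset.mul_sum]
      exact Finset.sum_congr rfl (fun i _ => by ring)
    simp_rw [h2]
    rw [integral_finsetSum]
    · exact Finset.sum_congr rfl (fun i _ => by rw [integral_const_mul])
    · intro i _
      refine (int_of _ 1 ((hm y).mul (hIm i y)) (fun x => ?_)).const_mul _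
      rw [Pi.mul_apply, abs_mul]
      exact mul_le_one₀ (hhb y x) (abs_nonneg _) (hIb i y x)
  -- Weighted Cauchy–Schwarz in its arithmetic–geometric form, using `h ^ 2 ≤ h`. The optimal `α` is
  -- inserted below and yields `|B|² D² ≤ V P`.
  have hamgm : ∀ α : ℝ, 0 < α → B.card * D ≤ (α * P + V / α) / 2 := by
    intro α hα
    have h1 : ∀ y ∈ Finset.univ, ∫ x, h x y * F y x ∂μ
        ≤ (α * (w y * ∫ x, h x y ∂μ) + ((∫ x, F y x ^ 2 ∂μ) / w y) / α) / 2 := by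
      intro y _
      have hwy := hwpos y
      have hF2 : Integrable (fun x => F y x ^ 2) μ := by
        refine int_of _ ((B.card : ℝ) ^ 2) ((hFm y).pow_const 2) (fun x => ?_)
        rw [abs_pow]
        exact pow_le_pow_left₀ (abs_nonneg _) (hFb y x) 2
      have h2 : ∫ x, h x y * F y x ∂μ
          ≤ ∫ x, ((α * w y / 2) * h x y + (1 / (2 * α * w y)) * F y x ^ 2) ∂μ := by
        refine integral_mono ?_ ?_ ?_
        · refine int_of _ B.card ((hm y).mul (hFm y)) (fun x => ?_)
          rw [abs_mul]
          calc |h x y| * |F y x| ≤ 1 * B.card :=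
                mul_le_mul (hhb y x) (hFb y x) (abs_nonneg _) (by norm_num)
            _ = _ := one_mul _
        · exact ((hInt y).const_mul _).add (hF2.const_mul _)
        · intro x
          have h3 := (h01 x y).1
          have h4 := (h01 x y).2
          have h5 : h x y ^ 2 ≤ h x y := by nlinarith
          have h6 : 0 ≤ (α * w y * h x y - F y x) ^ 2 / (2 * α * w y) := by positivity
          have h7 : (α * w y * h x y - F y x) ^ 2 / (2 * α * w y)
              = (α * w y / 2) * h x y ^ 2 - h x y * F y x + (1 / (2 * α * w y)) * F y x ^ 2 := by
            field_simp
            ring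
          have h8 : (α * w y / 2) * h x y ^ 2 ≤ (α * w y / 2) * h x y :=
            mul_le_mul_of_nonneg_left h5 (by positivity)
          simp only
          linarith
      refine h2.trans (le_of_eq ?_)
      rw [integral_add ((hInt y).const_mul _) (hF2.const_mul _), integral_const_mul,
        integral_const_mul]
      field_simp
    refine hsum.trans ((Finset.sum_le_sum h1).trans ?_)
    rw [← Finset.sum_div, Finset.sum_add_distrib, ← Finset.mul_sum, ← Finset.sum_div, ← hV]
    have := mul_le_mul_of_nonneg_left hwP hα.le
    linarith
  have h1 := hamgm (B.card * D / P) (by positivity)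
  have h2 : (B.card : ℝ) ^ 2 * D ^ 2 ≤ V * P := by
    have e1 : B.card * D / P * P = B.card * D := by field_simp
    rw [e1] at h1
    have e2 : B.card * D ≤ V / (B.card * D / P) := by linarith
    rw [le_div_iff₀ (by positivity)] at e2
    have e3 : B.card * D * (B.card * D / P) * P = (B.card : ℝ) ^ 2 * D ^ 2 := by
      field_simp
    rw [← e3]
    exact mul_le_mul_of_nonneg_right e2 hPpos.le
  have h3 : (B.card : ℝ) ^ 2 / (18 * t) ≤ V := by
    have e1 : (B.card : ℝ) ^ 2 * (P / (18 * t)) ≤ V * P :=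
      (mul_le_mul_of_nonneg_left hD2 (by positivity)).trans h2
    have e2 : (B.card : ℝ) ^ 2 * (P / (18 * t)) = (B.card : ℝ) ^ 2 / (18 * t) * P := by ring
    rw [e2] at e1
    exact le_of_mul_le_mul_right e1 hPpos
  have h4 : (B.card : ℝ) ^ 2 / (36 * t) ≤ 2 * N * B.card := by
    have : (B.card : ℝ) ^ 2 / (18 * t) = 2 * ((B.card : ℝ) ^ 2 / (36 * t)) := by
      field_simp; norm_num
    linarith
  rw [div_le_iff₀ (by positivity)] at h4
  have h5 : (B.card : ℝ) * B.card ≤ (72 * t * N) * B.card := by nlinarith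
  exact le_of_mul_le_mul_right h5 hBpos

/-- A deviation that rules out `VSTAT(t)` is large compared with the reference value `p`. -/
lemma sq_deviation_ge {p d t : ℝ} (ht : 0 < t) (hp : p ≤ 1 / 2)
    (h1 : 1 / t < |d|) (h2 : (p + d) * (1 - (p + d)) / t < d ^ 2) :
    (p + 1 / t) / (18 * t) ≤ d ^ 2 := by
  have ht1 : 0 < 1 / t := by positivity
  have hd2 : (1 / t) ^ 2 < d ^ 2 := by
    rw [← sq_abs d]; exact pow_lt_pow_left₀ h1 ht1.le (by norm_num)
  -- The tolerance is measured at the true value `p + d`, the bound is wanted at `p`. If it failed,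
  -- `|d| > 1 / t` would force `1 / t < p / 9` and then `|d| < p / 9`, so `p + d ≥ 8p/9` and `1 - (p
  -- + d) ≥ 4/9`: the tolerance at `p + d` would exceed `|d|`.
  have hmain : p / (9 * t) ≤ d ^ 2 := by
    by_contra hcon
    push Not at hcon
    have e1 : p / (9 * t) = (p / 9) * (1 / t) := by field_simp
    rw [e1] at hcon
    have e2 : 1 / t < p / 9 := by
      have : (1 / t) * (1 / t) < (p / 9) * (1 / t) := by nlinarith
      exact lt_of_mul_lt_mul_right this ht1.le
    have e3 : d ^ 2 < (p / 9) ^ 2 := by nlinarith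
    have hp0 : 0 < p := by linarith
    obtain ⟨e4, e5⟩ := abs_lt_of_sq_lt_sq' e3 (by positivity)
    have e6 : (p + d) * (1 - (p + d)) / t = ((p + d) * (1 - (p + d))) * (1 / t) := by ring
    rw [e6] at h2
    have e7 : p / 9 ≤ (p + d) * (1 - (p + d)) := by
      have : 8 * p / 9 * (4 / 9) ≤ (p + d) * (1 - (p + d)) := by
        apply mul_le_mul <;> nlinarith
      linarith
    have := mul_le_mul_of_nonneg_right e7 ht1.le
    linarith
  have e8 : (p + 1 / t) / (18 * t) = p / (9 * t) / 2 + (1 / t) ^ 2 / 18 := by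
    field_simp
    ring
  rw [e8]
  nlinarith

lemma SQQuery.expect_sub_eq_sum {X L : Type} [MeasurableSpace X] [MeasurableSpace L] [Fintype L]
    [DecidableEq L] [MeasurableSingletonClass L] (μ : Measure X) [IsProbabilityMeasure μ]
    (f : X → L) (hf : Measurable f) (p : L → ℝ) (h : SQQuery X L) :
    h.expect μ f - ∑ y, p y * ∫ x, h.toFun (x, y) ∂μ
      = ∑ y, ∫ x, h.toFun (x, y) * ((if f x = y then (1 : ℝ) else 0) - p y) ∂μ := by
  have hm : ∀ y, Measurable (fun x => h.toFun (x, y)) := fun y =>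
    h.measurable_toFun.comp measurable_prodMk_right
  have hhb : ∀ y x, |h.toFun (x, y)| ≤ 1 := fun y x => by
    rw [abs_of_nonneg (h.mem_Icc (x, y)).1]; exact (h.mem_Icc (x, y)).2
  have hi1 : ∀ y, Integrable (fun x => h.toFun (x, y) * (if f x = y then (1 : ℝ) else 0)) μ := by
    intro y
    refine Integrable.of_bound ((hm y).mul (Measurable.ite (hf (measurableSet_singleton y))
      measurable_const measurable_const)).aestronglyMeasurable 1 (ae_of_all _ (fun x => ?_))
    have := hhb y x
    rw [Real.norm_eq_abs]
    split_ifs <;> simp [this]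
  have hi2 : ∀ y, Integrable (fun x => h.toFun (x, y)) μ := fun y =>
    Integrable.of_bound (hm y).aestronglyMeasurable 1 (ae_of_all _ (hhb y))
  have h1 : ∀ x, h.toFun (x, f x)
      = ∑ y, h.toFun (x, y) * (if f x = y then (1 : ℝ) else 0) := by
    intro x; simp
  unfold SQQuery.expect
  simp_rw [h1]
  rw [integral_finsetSum _ (fun y _ => hi1 y), ← Finset.sum_sub_distrib]
  refine Finset.sum_congr rfl (fun y _ => ?_)
  rw [← integral_const_mul, ← integral_sub (hi1 y) ((hi2 y).const_mul _)]
  refine integral_congr_ae (ae_of_all _ (fun x => ?_))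
  simp only
  ring

open Classical in
/-- If the label events of the concepts are nearly pairwise independent, the product of the input
distribution with the reference label distribution `p` answers every query correctly for all but
few concepts. -/
theorem card_not_isVSTATAnswer_le {X : Type} [MeasurableSpace X] {Y : Type} [Fintype Y]
    [Nonempty Y] [MeasurableSpace Y] [MeasurableSingletonClass Y]
    (μ : Measure X) [IsProbabilityMeasure μ] {ι : Type} [Fintype ι] (f : ι → X → Y)
    (hf : ∀ i, Measurable (f i)) (p : Y → ℝ) (hp : ∀ y, 0 ≤ p y) (hp1 : ∑ y, p y = 1)
    (t : ℕ) (ht : 0 < t) (δ : ℝ) (hδ0 : 0 ≤ δ)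
    (hδ : 36 * (t : ℝ) ^ 2 * (Fintype.card Y : ℝ) ^ 2 * δ ≤ 1)
    (hcov : ∀ i j, i ≠ j → ∀ y, |∫ x, ((if f i x = y then (1 : ℝ) else 0) - p y) *
      ((if f j x = y then (1 : ℝ) else 0) - p y) ∂μ| ≤ δ)
    (hdiag : ∀ i y, ∫ x, (if f i x = y then (1 : ℝ) else 0) ∂μ
      ≤ p y + 1 / (t * Fintype.card Y)) (h : SQQuery X Y) :
    (Finset.univ.filter (fun i =>
      ¬ IsVSTATAnswer t μ (f i) h (∑ y, p y * ∫ x, h.toFun (x, y) ∂μ))).card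
      ≤ 72 * t * Fintype.card Y := by
  set p0 : ℝ := ∑ y, p y * ∫ x, h.toFun (x, y) ∂μ with hp0
  have htR : (0 : ℝ) < t := by exact_mod_cast ht
  have hm : ∀ y, Measurable (fun x => h.toFun (x, y)) := fun y =>
    h.measurable_toFun.comp measurable_prodMk_right
  have hhb : ∀ y x, |h.toFun (x, y)| ≤ 1 := fun y x => by
    rw [abs_of_nonneg (h.mem_Icc (x, y)).1]; exact (h.mem_Icc (x, y)).2
  have hi2 : ∀ y, Integrable (fun x => h.toFun (x, y)) μ := fun y =>
    Integrable.of_bound (hm y).aestronglyMeasurable 1 (ae_of_all _ (hhb y))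
  have hi3 : ∀ i y, Integrable (fun x => (if f i x = y then (1 : ℝ) else 0) - p y) μ := by
    intro i y
    refine Integrable.sub ?_ (integrable_const _)
    refine Integrable.of_bound (Measurable.ite (hf i (measurableSet_singleton y))
      measurable_const measurable_const).aestronglyMeasurable 1 (ae_of_all _ (fun x => ?_))
    split_ifs <;> simp
  have hi4 : ∀ i y, Integrable
      (fun x => h.toFun (x, y) * ((if f i x = y then (1 : ℝ) else 0) - p y)) μ := by
    intro i y
    exact (hi3 i y).bdd_mul (hm y).aestronglyMeasurable (ae_of_all _ (hhb y))
  set d : ι → ℝ := fun i => h.expect μ (f i) - p0 with hd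
  have hdeq : ∀ i, d i
      = ∑ y, ∫ x, h.toFun (x, y) * ((if f i x = y then (1 : ℝ) else 0) - p y) ∂μ :=
    fun i => SQQuery.expect_sub_eq_sum μ (f i) (hf i) p h
  set B : Finset ι := Finset.univ.filter (fun i => ¬ IsVSTATAnswer t μ (f i) h p0) with hB
  have hbad : ∀ i ∈ B, 1 / (t : ℝ) < |d i| ∧
      (p0 + d i) * (1 - (p0 + d i)) / t < d i ^ 2 := by
    intro i hi
    rw [hB, Finset.mem_filter] at hi
    have h1 := hi.2
    unfold IsVSTATAnswer at h1
    rw [not_le, max_lt_iff] at h1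
    refine ⟨h1.1, ?_⟩
    have e : p0 + d i = h.expect μ (f i) := by simp [hd]
    rw [e, ← sq_abs (d i)]
    have h2 := h1.2
    rw [Real.sqrt_lt' (lt_of_le_of_lt (Real.sqrt_nonneg _) h2)] at h2
    exact h2
  have hσ : ∀ i, (if 0 ≤ d i then (1 : ℝ) else -1) ^ 2 = 1 := by
    intro i; split_ifs <;> norm_num
  have hσd : ∀ i, (if 0 ≤ d i then (1 : ℝ) else -1) * d i = |d i| := by
    intro i
    split_ifs with h0
    · rw [abs_of_nonneg h0, one_mul]
    · rw [abs_of_neg (not_le.mp h0)]; ring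
  have hp0nn : 0 ≤ p0 := Finset.sum_nonneg (fun y _ =>
    mul_nonneg (hp y) (integral_nonneg (fun x => (h.mem_Icc _).1)))
  have hfin : (B.card : ℝ) ≤ 72 * t * Fintype.card Y := by
    rcases le_or_gt p0 (1 / 2) with hhalf | hhalf
    · have hPpos : 0 < (p0 + 1 / t) / (18 * t) := by positivity
      refine card_le_of_signed_deviation μ f hf p hp hp1 t ht δ hδ0 hδ hcov hdiag
        (fun x y => h.toFun (x, y)) hm (fun x y => h.mem_Icc _) B
        (fun i => if 0 ≤ d i then (1 : ℝ) else -1) hσ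
        (Real.sqrt ((p0 + 1 / t) / (18 * t))) (Real.sqrt_pos.mpr hPpos) ?_ ?_
      · intro i hi
        rw [← hdeq i, hσd]
        obtain ⟨h1, h2⟩ := hbad i hi
        refine Real.sqrt_le_iff.mpr ⟨abs_nonneg _, ?_⟩
        rw [sq_abs]
        exact sq_deviation_ge htR hhalf h1 h2
      · rw [Real.sq_sqrt hPpos.le]
    -- When the reference value exceeds one half, pass to `1 - h`. The tolerance is symmetric, and
    -- deviations change sign because the label deviations sum to zero over `y`.
    · have hp0' : ∑ y, p y * ∫ x, (1 - h.toFun (x, y)) ∂μ = 1 - p0 := by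
        rw [show 1 - p0 = ∑ y, p y - p0 by rw [hp1], hp0, ← Finset.sum_sub_distrib]
        refine Finset.sum_congr rfl (fun y _ => ?_)
        rw [integral_sub (integrable_const _) (hi2 y)]
        simp; ring
      have hd' : ∀ i, ∑ y, ∫ x, (1 - h.toFun (x, y)) *
          ((if f i x = y then (1 : ℝ) else 0) - p y) ∂μ = - d i := by
        intro i
        have e1 : ∑ y, ∫ x, ((if f i x = y then (1 : ℝ) else 0) - p y) ∂μ = 0 := by
          rw [← integral_finsetSum _ (fun y _ => hi3 i y)]
          have : ∀ x, ∑ y, ((if f i x = y then (1 : ℝ) else 0) - p y) = 0 := by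
            intro x
            rw [Finset.sum_sub_distrib, hp1]; simp
          simp [this]
        have e2 : ∀ y, ∫ x, (1 - h.toFun (x, y)) * ((if f i x = y then (1 : ℝ) else 0) - p y) ∂μ
            = ∫ x, ((if f i x = y then (1 : ℝ) else 0) - p y) ∂μ
              - ∫ x, h.toFun (x, y) * ((if f i x = y then (1 : ℝ) else 0) - p y) ∂μ := by
          intro y
          rw [← integral_sub (hi3 i y) (hi4 i y)]
          refine integral_congr_ae (ae_of_all _ (fun x => ?_))
          simp only
          ring
        simp_rw [e2]
        rw [Finset.sum_sub_distrib, e1, ← hdeq i, zero_sub]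
      have hp0le : p0 ≤ 1 := by
        have : 0 ≤ 1 - p0 := by
          rw [← hp0']
          exact Finset.sum_nonneg (fun y _ => mul_nonneg (hp y)
            (integral_nonneg (fun x => sub_nonneg.mpr (h.mem_Icc _).2)))
        linarith
      have hPpos : 0 < (1 - p0 + 1 / t) / (18 * t) := by
        have : 0 ≤ 1 - p0 := by linarith
        positivity
      refine card_le_of_signed_deviation μ f hf p hp hp1 t ht δ hδ0 hδ hcov hdiag
        (fun x y => 1 - h.toFun (x, y)) (fun y => (hm y).const_sub 1) (fun x y => ?_) B
        (fun i => - (if 0 ≤ d i then (1 : ℝ) else -1)) (fun i => by rw [neg_sq]; exact hσ i)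
        (Real.sqrt ((1 - p0 + 1 / t) / (18 * t))) (Real.sqrt_pos.mpr hPpos) ?_ ?_
      · have := h.mem_Icc (x, y)
        exact ⟨by linarith [this.2], by linarith [this.1]⟩
      · intro i hi
        rw [hd' i, neg_mul_neg, hσd]
        obtain ⟨h1, h2⟩ := hbad i hi
        refine Real.sqrt_le_iff.mpr ⟨abs_nonneg _, ?_⟩
        have h3 : (1 - p0 + 1 / t) / (18 * t) ≤ (- d i) ^ 2 := by
          refine sq_deviation_ge htR (by linarith) (by rwa [abs_neg]) ?_
          · have e : (1 - p0 + -d i) * (1 - (1 - p0 + -d i)) = (p0 + d i) * (1 - (p0 + d i)) := by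
              ring
            rw [e, neg_sq]; exact h2
        rw [sq_abs]; rwa [neg_sq] at h3
      · rw [hp0', Real.sq_sqrt hPpos.le]
  exact_mod_cast hfin

/-! ### Separated families of subsets. -/

/-- Chernoff's bound for a Hamming ball: weighting each set by `(1/8) ^ card`, all subsets together
have weight `(1 + 1/8) ^ n`. -/
lemma card_filter_card_le_mul (n d : ℕ) :
    ((Finset.univ.filter (fun U : Finset (Fin n) => U.card ≤ d)).card : ℝ) * (1 / 8) ^ d
      ≤ (9 / 8) ^ n := by
  have h1 : ∑ U : Finset (Fin n), (1 / 8 : ℝ) ^ U.card = (9 / 8) ^ n := by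
    have := Finset.prod_one_add (f := fun _ : Fin n => (1 / 8 : ℝ)) Finset.univ
    simp only [Finset.prod_const, Finset.powerset_univ, Finset.card_univ, Fintype.card_fin] at this
    rw [← this]; norm_num
  rw [← h1, ← nsmul_eq_mul]
  calc _ ≤ ∑ U ∈ Finset.univ.filter (fun U : Finset (Fin n) => U.card ≤ d), (1 / 8 : ℝ) ^ U.card := by
        refine Finset.card_nsmul_le_sum _ _ _ (fun U hU => ?_)
        exact pow_le_pow_of_le_one (by norm_num) (by norm_num) (Finset.mem_filter.mp hU).2
    _ ≤ _ := Finset.sum_le_sum_of_subset_of_nonneg (Finset.subset_univ _)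
        (fun _ _ _ => by positivity)

/-- A Gilbert–Varshamov family: exponentially many sets with pairwise large symmetric differences. -/
theorem exists_separated_family (n : ℕ) : ∃ 𝓕 : Finset (Finset (Fin n)),
    (∀ S ∈ 𝓕, ∀ T ∈ 𝓕, S ≠ T → n / 16 < (symmDiff S T).card) ∧ (3 / 2 : ℝ) ^ n ≤ 𝓕.card := by
  classical
  set d := n / 16
  let good : Finset (Finset (Finset (Fin n))) := Finset.univ.filter
    (fun 𝓕 => ∀ S ∈ 𝓕, ∀ T ∈ 𝓕, S ≠ T → d < (symmDiff S T).card)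
  have hne : good.Nonempty := ⟨∅, by simp [good]⟩
  obtain ⟨𝓕, h𝓕, hmax⟩ := Finset.exists_max_image good Finset.card hne
  have hsep : ∀ S ∈ 𝓕, ∀ T ∈ 𝓕, S ≠ T → d < (symmDiff S T).card := by
    simpa [good] using h𝓕
  refine ⟨𝓕, hsep, ?_⟩
  -- By maximality the balls of radius `d` around the members cover the cube; otherwise an uncovered
  -- set could be added.
  have hcover : ∀ T : Finset (Fin n), ∃ S ∈ 𝓕, (symmDiff S T).card ≤ d := by
    intro T
    by_contra hcon
    push Not at hcon
    have hT : T ∉ 𝓕 := fun hT => by simpa using hcon T hT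
    have h1 : insert T 𝓕 ∈ good := by
      simp only [good, Finset.mem_filter, Finset.mem_univ, true_and]
      intro A hA B hB hAB
      rw [Finset.mem_insert] at hA hB
      rcases hA with rfl | hA <;> rcases hB with rfl | hB
      · exact absurd rfl hAB
      · rw [symmDiff_comm]; exact hcon B hB
      · exact hcon A hA
      · exact hsep A hA B hB hAB
    have h2 := hmax _ h1
    rw [Finset.card_insert_of_notMem hT] at h2
    omega
  set V := (Finset.univ.filter (fun U : Finset (Fin n) => U.card ≤ d)).card with hV
  have h2n : (2 : ℝ) ^ n ≤ 𝓕.card * V := by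
    have h1 : (Finset.univ : Finset (Finset (Fin n)))
        ⊆ 𝓕.biUnion (fun S => Finset.univ.filter (fun T => (symmDiff S T).card ≤ d)) := by
      intro T _
      obtain ⟨S, hS, hST⟩ := hcover T
      simp only [Finset.mem_biUnion, Finset.mem_filter, Finset.mem_univ, true_and]
      exact ⟨S, hS, hST⟩
    have h2 := Finset.card_le_card h1
    have h3 : (𝓕.biUnion (fun S => Finset.univ.filter
        (fun T => (symmDiff S T).card ≤ d))).card ≤ 𝓕.card * V := by
      refine Finset.card_biUnion_le_card_mul _ _ _ (fun S _ => ?_)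
      refine Finset.card_le_card_of_injOn (fun T => symmDiff S T) (fun T hT => ?_) ?_
      · simpa using hT
      · exact (symmDiff_right_injective S).injOn
    have h4 := h2.trans h3
    simp only [Finset.card_univ, Fintype.card_finset, Fintype.card_fin] at h4
    exact_mod_cast h4
  have hVb := card_filter_card_le_mul n d
  rw [← hV] at hVb
  -- Together with the Chernoff bound this gives balls of size at most `(9/7) ^ n`, and `(3/2) *
  -- (9/7) = 27/14 < 2`.
  have h8 : (8 : ℝ) ^ d ≤ (8 / 7) ^ n := by
    calc (8 : ℝ) ^ d ≤ ((8 / 7) ^ 16) ^ d := by gcongr; norm_num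
      _ = (8 / 7) ^ (16 * d) := by rw [pow_mul]
      _ ≤ (8 / 7) ^ n := pow_le_pow_right₀ (by norm_num) (Nat.mul_div_le n 16)
  have hV2 : (V : ℝ) ≤ (9 / 7) ^ n := by
    have h1 : (V : ℝ) = V * (1 / 8) ^ d * 8 ^ d := by
      rw [mul_assoc, ← mul_pow]; norm_num
    calc (V : ℝ) = V * (1 / 8) ^ d * 8 ^ d := h1
      _ ≤ (9 / 8) ^ n * (8 / 7) ^ n := by gcongr
      _ = (9 / 7) ^ n := by rw [← mul_pow]; norm_num
  have h3 : (3 / 2 : ℝ) ^ n * (9 / 7) ^ n ≤ 𝓕.card * (9 / 7) ^ n := by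
    calc (3 / 2 : ℝ) ^ n * (9 / 7) ^ n = (27 / 14) ^ n := by rw [← mul_pow]; norm_num
      _ ≤ 2 ^ n := by gcongr; norm_num
      _ ≤ 𝓕.card * V := h2n
      _ ≤ _ := by gcongr
  exact le_of_mul_le_mul_right h3 (by positivity)

/-- A family as in `exists_separated_family` whose members are large and, for any two members, one
of the two differences is large. -/
theorem exists_separated_family_of_large (n : ℕ) : ∃ 𝓕 : Finset (Finset (Fin n)),
    (∀ S ∈ 𝓕, n / 32 ≤ S.card) ∧
    (∀ S ∈ 𝓕, ∀ T ∈ 𝓕, S ≠ T → n / 32 ≤ (S \ T).card ∨ n / 32 ≤ (T \ S).card) ∧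
    (3 / 2 : ℝ) ^ n - 1 ≤ 𝓕.card := by
  classical
  obtain ⟨𝓕, hsep, hcard⟩ := exists_separated_family n
  have hsd : ∀ S T : Finset (Fin n), (symmDiff S T).card = (S \ T).card + (T \ S).card := by
    intro S T
    rw [symmDiff_def, Finset.sup_eq_union, Finset.card_union_of_disjoint disjoint_sdiff_sdiff]
  refine ⟨𝓕.filter (fun S => n / 32 ≤ S.card), fun S hS => (Finset.mem_filter.mp hS).2, ?_, ?_⟩
  · intro S hS T hT hST
    have h1 := hsep S (Finset.mem_filter.mp hS).1 T (Finset.mem_filter.mp hT).1 hST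
    rw [hsd] at h1
    omega
  -- Two distinct sets with fewer than `n / 32` elements would have too small a symmetric
  -- difference, so discarding small sets costs at most one member.
  · have h1 : (𝓕.filter (fun S => ¬ n / 32 ≤ S.card)).card ≤ 1 := by
      rw [Finset.card_le_one]
      intro S hS T hT
      rw [Finset.mem_filter] at hS hT
      by_contra hST
      have h2 := hsep S hS.1 T hT.1 hST
      rw [hsd] at h2
      have h3 : (S \ T).card ≤ S.card := Finset.card_le_card Finset.sdiff_subset
      have h4 : (T \ S).card ≤ T.card := Finset.card_le_card Finset.sdiff_subset
      omega
    have h2 := Finset.card_filter_add_card_filter_not (s := 𝓕) (fun S => n / 32 ≤ S.card)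
    have h3 : 𝓕.card ≤ (𝓕.filter (fun S => n / 32 ≤ S.card)).card + 1 := by omega
    have h4 : (𝓕.card : ℝ) ≤ (𝓕.filter (fun S => n / 32 ≤ S.card)).card + 1 := by exact_mod_cast h3
    linarith

/-! ### Logconcave densities of unit variance. -/

/-- `p` is a logconcave probability density on the line. -/
structure IsLogConcaveDensity (p : ℝ → ℝ) : Prop where
  measurable : Measurable p
  nonneg : ∀ x, 0 ≤ p x
  logConcave : ∀ x y a b : ℝ, 0 ≤ a → 0 ≤ b → a + b = 1 → p x ^ a * p y ^ b ≤ p (a * x + b * y)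
  lintegral_eq_one : ∫⁻ x, ENNReal.ofReal (p x) = 1

lemma HasLogConcaveDensity.exists_isLogConcaveDensity {D : Measure ℝ} [IsProbabilityMeasure D]
    (h : HasLogConcaveDensity D) :
    ∃ p, IsLogConcaveDensity p ∧ D = volume.withDensity (fun x => ENNReal.ofReal (p x)) := by
  obtain ⟨p, h1, h2, h3, h4⟩ := h
  refine ⟨p, ⟨h1, h2, h3, ?_⟩, h4⟩
  have : D Set.univ = 1 := measure_univ
  rwa [h4, withDensity_apply _ MeasurableSet.univ, Measure.restrict_univ] at this

namespace IsLogConcaveDensity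

variable {p : ℝ → ℝ}

lemma mul_volume_le (hp : IsLogConcaveDensity p) {c : ℝ} {J : Set ℝ} (hJ : MeasurableSet J)
    (h : ∀ x ∈ J, c ≤ p x) : ENNReal.ofReal c * volume J ≤ 1 := by
  calc ENNReal.ofReal c * volume J = ∫⁻ _x in J, ENNReal.ofReal c := by simp
    _ ≤ ∫⁻ x in J, ENNReal.ofReal (p x) :=
        setLIntegral_mono_ae' hJ (ae_of_all _ (fun x hx => ENNReal.ofReal_le_ofReal (h x hx)))
    _ ≤ ∫⁻ x, ENNReal.ofReal (p x) := setLIntegral_le_lintegral _ _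
    _ = 1 := hp.lintegral_eq_one

lemma min_le_of_mem_uIcc (hp : IsLogConcaveDensity p) {c x y z : ℝ} (hc : 0 < c)
    (hx : c ≤ p x) (hy : c ≤ p y) (hz : z ∈ Set.Icc x y) : c ≤ p z := by
  rw [← segment_eq_Icc (hz.1.trans hz.2)] at hz
  obtain ⟨a, b, ha, hb, hab, rfl⟩ := hz
  refine le_trans ?_ (hp.logConcave x y a b ha hb hab)
  calc c = c ^ a * c ^ b := by rw [← Real.rpow_add hc, hab, Real.rpow_one]
    _ ≤ p x ^ a * p y ^ b := by
        have := Real.rpow_nonneg (hp.nonneg x) a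
        gcongr

/-- Exponential decay of a logconcave density away from any point where it is positive. -/
lemma le_mul_exp (hp : IsLogConcaveDensity p) {x₁ y : ℝ} (hM : 0 < p x₁)
    (hy : 4 / p x₁ ≤ |y - x₁|) : p y ≤ p x₁ * Real.exp (-(p x₁ * |y - x₁| / 4)) := by
  by_contra hcon
  push Not at hcon
  set M := p x₁ with hMdef
  set τ := |y - x₁| with hτ
  have hτ0 : 0 < τ := lt_of_lt_of_le (by positivity) hy
  -- If `p y` beat the claimed decay, interpolation between `x₁` and `y` would keep the density
  -- above `M / e` on an interval of length `4 / M`, which would then carry mass `4 / e > 1`.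
  have hseg : ∀ r : ℝ, 0 ≤ r → r ≤ 4 / M → M * Real.exp (-1) ≤ p (x₁ + r / τ * (y - x₁)) := by
    intro r hr0 hr
    have hr1 : r / τ ≤ 1 := (div_le_one hτ0).mpr (hr.trans hy)
    have hr2 : 0 ≤ r / τ := by positivity
    have h1 := hp.logConcave x₁ y (1 - r / τ) (r / τ) (by linarith) hr2 (by ring)
    have e1 : (1 - r / τ) * x₁ + r / τ * y = x₁ + r / τ * (y - x₁) := by ring
    rw [e1] at h1
    refine le_trans ?_ h1
    calc M * Real.exp (-1) ≤ M * Real.exp (-(M * τ / 4) * (r / τ)) := by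
          gcongr
          have : -(M * τ / 4) * (r / τ) = -(M * r / 4) := by field_simp
          rw [this]
          have : M * r ≤ 4 := by
            calc M * r ≤ M * (4 / M) := by gcongr
              _ = 4 := by field_simp
          linarith
      _ = M ^ (1 - r / τ) * (M * Real.exp (-(M * τ / 4))) ^ (r / τ) := by
          rw [Real.mul_rpow hM.le (Real.exp_pos _).le, ← Real.exp_mul, ← mul_assoc,
            ← Real.rpow_add hM, sub_add_cancel, Real.rpow_one]
      _ ≤ M ^ (1 - r / τ) * p y ^ (r / τ) := by gcongr
  have hexp : 1 < 4 * Real.exp (-1) := by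
    rw [Real.exp_neg, ← div_eq_mul_inv, lt_div_iff₀ (Real.exp_pos _)]
    have := Real.exp_one_lt_d9
    linarith
  have hfin : ∀ u, (∀ x ∈ Set.Icc u (u + 4 / M), M * Real.exp (-1) ≤ p x) → False := by
    intro u hu
    have h1 := hp.mul_volume_le measurableSet_Icc hu
    rw [Real.volume_Icc, add_sub_cancel_left, ← ENNReal.ofReal_mul (by positivity)] at h1
    have h2 : M * Real.exp (-1) * (4 / M) = 4 * Real.exp (-1) := by field_simp
    rw [h2, ENNReal.ofReal_le_one] at h1
    linarith
  rcases le_total x₁ y with hxy | hxy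
  · have hτe : τ = y - x₁ := abs_of_nonneg (by linarith)
    refine hfin x₁ (fun x hx => ?_)
    have h1 := hseg (x - x₁) (by linarith [hx.1]) (by linarith [hx.2])
    rw [← hτe, div_mul_cancel₀ _ hτ0.ne'] at h1
    simpa using h1
  · have hτe : y - x₁ = -τ := by rw [hτ, abs_of_nonpos (by linarith)]; ring
    refine hfin (x₁ - 4 / M) (fun x hx => ?_)
    have h1 := hseg (x₁ - x) (by linarith [hx.2]) (by linarith [hx.1])
    rw [hτe, mul_neg, div_mul_cancel₀ _ hτ0.ne'] at h1
    simpa using h1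

end IsLogConcaveDensity

lemma lintegral_exp_neg_mul_abs {a : ℝ} (ha : 0 < a) (c : ℝ) :
    ∫⁻ x : ℝ, ENNReal.ofReal (Real.exp (-(a * |x - c|))) = ENNReal.ofReal (2 / a) := by
  have h0 : ∫⁻ x : ℝ, ENNReal.ofReal (Real.exp (-(a * |x - c|)))
      = ∫⁻ x : ℝ, ENNReal.ofReal (Real.exp (-(a * |x|))) :=
    lintegral_sub_right_eq_self (fun x => ENNReal.ofReal (Real.exp (-(a * |x|)))) c
  have hI : Integrable (fun x : ℝ => Real.exp (-(a * |x|))) := by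
    rw [← integrableOn_univ, ← Set.Iic_union_Ioi (a := (0 : ℝ)), integrableOn_union]
    constructor
    · refine (integrableOn_exp_mul_Iic ha 0).congr_fun (fun x hx => ?_) measurableSet_Iic
      simp only
      rw [abs_of_nonpos hx]; ring_nf
    · refine (integrableOn_exp_mul_Ioi (neg_lt_zero.mpr ha) 0).congr_fun (fun x hx => ?_)
        measurableSet_Ioi
      simp only
      rw [abs_of_pos hx]; ring_nf
  rw [h0, ← ofReal_integral_eq_lintegral_ofReal hI (ae_of_all _ (fun x => (Real.exp_pos _).le))]
  congr 1
  have h1 := integral_comp_abs (f := fun x : ℝ => Real.exp (-(a * x)))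
  rw [h1]
  have h2 := integral_exp_mul_Ioi (neg_lt_zero.mpr ha) 0
  simp only [neg_mul] at h2
  rw [h2]
  simp
  field_simp

lemma abs_exp_mul_le {z : ℝ} : Real.exp z ≤ 1 + z + z ^ 2 * Real.exp |z| := by
  have h := Complex.norm_exp_sub_sum_le_norm_mul_exp (z : ℂ) 2
  have e : Complex.exp (z : ℂ) - ∑ m ∈ Finset.range 2, (z : ℂ) ^ m / (m.factorial : ℂ)
      = ((Real.exp z - (1 + z) : ℝ) : ℂ) := by
    simp [Finset.sum_range_succ]
  rw [e, Complex.norm_real, Complex.norm_real, Real.norm_eq_abs, Real.norm_eq_abs, sq_abs] at h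
  linarith [(abs_le.mp h).2]

section Moments

variable {D : Measure ℝ} [IsProbabilityMeasure D] {p : ℝ → ℝ}

/-- The variance of a variable that is not square integrable is zero by convention, so the value one
carries integrability. -/
lemma memLp_of_variance_eq_one (hv : variance (fun x : ℝ => x) D = 1) :
    MemLp (fun x : ℝ => x) 2 D := by
  by_contra h
  rw [variance_of_not_memLp measurable_id'.aestronglyMeasurable h] at hv
  norm_num at hv

lemma one_le_lintegral_sq (hv : variance (fun x : ℝ => x) D = 1) (c : ℝ) :
    1 ≤ ∫⁻ x, ENNReal.ofReal ((x - c) ^ 2) ∂D := by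
  have h1 : variance (fun x : ℝ => x - c) D = 1 := by
    rw [variance_sub_const measurable_id'.aestronglyMeasurable, hv]
  have h2 := variance_le_expectation_sq (μ := D) (X := fun x : ℝ => x - c)
    (measurable_id'.sub_const c).aestronglyMeasurable
  simp only [Pi.pow_apply] at h2
  rw [h1, integral_eq_lintegral_of_nonneg_ae (ae_of_all _ (fun x => sq_nonneg _))
    ((measurable_id'.sub_const c).pow_const 2).aestronglyMeasurable] at h2
  have h3 := ENNReal.ofReal_le_ofReal h2
  rw [ENNReal.ofReal_one] at h3
  exact h3.trans ENNReal.ofReal_toReal_le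

/-- A peak of height `M` forces exponential decay on the scale `1 / M`, hence a second moment about
`x₁` of at most `2064 / M ^ 2`. Unit variance makes that moment at least one, and `46 ^ 2 > 2064`.
-/
lemma IsLogConcaveDensity.le_of_variance (hp : IsLogConcaveDensity p)
    (hD : D = volume.withDensity (fun x => ENNReal.ofReal (p x)))
    (hv : variance (fun x : ℝ => x) D = 1) (x₁ : ℝ) : p x₁ ≤ 46 := by
  by_contra hcon
  push Not at hcon
  set M := p x₁ with hM
  have hM0 : 0 < M := by linarith
  have hpt : ∀ x, p x * (x - x₁) ^ 2
      ≤ 16 / M ^ 2 * p x + 128 / M * Real.exp (-(M / 8 * |x - x₁|)) := by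
    intro x
    have hpx := hp.nonneg x
    rcases lt_or_ge |x - x₁| (4 / M) with h | h
    · have h1 : (x - x₁) ^ 2 ≤ 16 / M ^ 2 := by
        rw [← sq_abs]
        calc |x - x₁| ^ 2 ≤ (4 / M) ^ 2 := by gcongr
          _ = 16 / M ^ 2 := by rw [div_pow]; norm_num
      have h2 : 0 ≤ 128 / M * Real.exp (-(M / 8 * |x - x₁|)) := by positivity
      nlinarith
    · have h1 := hp.le_mul_exp hM0 h
      rw [← hM] at h1
      have h0 : 0 ≤ 16 / M ^ 2 * p x := by positivity
      set w := M / 8 * |x - x₁| with hw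
      have hw0 : 0 ≤ w := by positivity
      have h2 : -(M * |x - x₁| / 4) = -w + -w := by rw [hw]; ring
      rw [h2, Real.exp_add] at h1
      have h3 : w ^ 2 * Real.exp (-w) ≤ 2 := by
        rw [Real.exp_neg, ← div_eq_mul_inv, div_le_iff₀ (Real.exp_pos _)]
        nlinarith [Real.quadratic_le_exp_of_nonneg hw0]
      have h4 : (x - x₁) ^ 2 = 64 / M ^ 2 * w ^ 2 := by
        rw [hw, mul_pow, sq_abs]; field_simp; norm_num
      have h5 : p x * (x - x₁) ^ 2
          ≤ M * (Real.exp (-w) * Real.exp (-w)) * (64 / M ^ 2 * w ^ 2) := by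
        rw [h4]; gcongr
      have h6 : M * (Real.exp (-w) * Real.exp (-w)) * (64 / M ^ 2 * w ^ 2)
          = 64 / M * (w ^ 2 * Real.exp (-w)) * Real.exp (-w) := by
        field_simp
      have h7 : 64 / M * (w ^ 2 * Real.exp (-w)) * Real.exp (-w)
          ≤ 64 / M * 2 * Real.exp (-w) := by gcongr
      have h8 : 64 / M * 2 = 128 / M := by ring
      rw [h8] at h7
      linarith
  have h1 := one_le_lintegral_sq hv x₁
  have hpm : Measurable (fun x => ENNReal.ofReal (p x)) := hp.measurable.ennreal_ofReal
  have hsq : Measurable (fun x : ℝ => ENNReal.ofReal ((x - x₁) ^ 2)) := by fun_prop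
  rw [hD, lintegral_withDensity_eq_lintegral_mul _ hpm hsq] at h1
  have h2 : ∫⁻ x, ((fun x => ENNReal.ofReal (p x)) * fun x => ENNReal.ofReal ((x - x₁) ^ 2)) x
      ≤ ∫⁻ x, (ENNReal.ofReal (16 / M ^ 2) * ENNReal.ofReal (p x)
        + ENNReal.ofReal (128 / M) * ENNReal.ofReal (Real.exp (-(M / 8 * |x - x₁|)))) := by
    refine lintegral_mono (fun x => ?_)
    simp only [Pi.mul_apply]
    rw [← ENNReal.ofReal_mul (hp.nonneg x), ← ENNReal.ofReal_mul (by positivity),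
      ← ENNReal.ofReal_mul (by positivity), ← ENNReal.ofReal_add
        (mul_nonneg (by positivity) (hp.nonneg x)) (by positivity)]
    exact ENNReal.ofReal_le_ofReal (hpt x)
  rw [lintegral_add_left (hpm.const_mul _), lintegral_const_mul _ hpm,
    lintegral_const_mul _ (by fun_prop), hp.lintegral_eq_one,
    lintegral_exp_neg_mul_abs (by positivity), mul_one, ← ENNReal.ofReal_mul (by positivity),
    ← ENNReal.ofReal_add (by positivity) (by positivity)] at h2
  have h3 := ENNReal.one_le_ofReal.mp (h1.trans h2)
  have h4 : 16 / M ^ 2 + 128 / M * (2 / (M / 8)) = 2064 / M ^ 2 := by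
    field_simp; norm_num
  rw [h4, le_div_iff₀ (by positivity)] at h3
  nlinarith

/-- Chebyshev puts mass 3/4 within distance 2 of the mean. Points there with density below 1/16
carry at most 1/4, so by the upper bound 46 the remaining points have Lebesgue measure at least
1/92. This exceeds 1/100, so two of them lie at least 1/200 apart, and convexity of superlevel sets
fills the gap. -/
lemma IsLogConcaveDensity.exists_interval (hp : IsLogConcaveDensity p)
    (hD : D = volume.withDensity (fun x => ENNReal.ofReal (p x)))
    (hv : variance (fun x : ℝ => x) D = 1) :
    ∃ x, |x - ∫ u, u ∂D| ≤ 2 ∧ ∀ z ∈ Set.Icc x (x + 1 / 200), 1 / 16 ≤ p z := by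
  set μ := ∫ u, u ∂D with hμ
  set J := Set.Icc (μ - 2) (μ + 2) with hJ
  have hDJ : ENNReal.ofReal (3 / 4) ≤ D J := by
    have h1 := meas_ge_le_variance_div_sq (memLp_of_variance_eq_one hv) (c := 2) (by norm_num)
    rw [hv, ← hμ] at h1
    have h2 : Jᶜ ⊆ {x | 2 ≤ |x - μ|} := by
      intro x hx
      by_contra h
      simp only [Set.mem_ofPred_eq, not_le] at h
      rw [abs_lt] at h
      exact hx ⟨by linarith, by linarith⟩
    have h3 := (measure_mono h2).trans h1
    rw [prob_compl_eq_one_sub measurableSet_Icc, tsub_le_iff_right] at h3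
    have h4 : (1 : ENNReal) = ENNReal.ofReal (1 / 2 ^ 2) + ENNReal.ofReal (3 / 4) := by
      rw [← ENNReal.ofReal_add (by norm_num) (by norm_num)]; norm_num
    rw [h4, add_comm (ENNReal.ofReal (1 / 2 ^ 2))] at h3
    rw [add_comm] at h3
    exact (ENNReal.add_le_add_iff_left ENNReal.ofReal_ne_top).mp h3
  set A := J ∩ {x | 1 / 16 ≤ p x} with hA
  have hAm : MeasurableSet A :=
    measurableSet_Icc.inter (measurableSet_le measurable_const hp.measurable)
  have hvol : ENNReal.ofReal (1 / 2) ≤ ENNReal.ofReal 46 * volume A := by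
    have h1 : D J ≤ ENNReal.ofReal (1 / 4) + ENNReal.ofReal 46 * volume A := by
      rw [hD, withDensity_apply _ measurableSet_Icc]
      calc ∫⁻ x in J, ENNReal.ofReal (p x)
          ≤ ∫⁻ x in J, (ENNReal.ofReal (1 / 16) + A.indicator (fun _ => ENNReal.ofReal 46) x) := by
            refine setLIntegral_mono_ae' measurableSet_Icc (ae_of_all _ (fun x hx => ?_))
            by_cases hxA : x ∈ A
            · rw [Set.indicator_of_mem hxA]
              exact (ENNReal.ofReal_le_ofReal (hp.le_of_variance hD hv x)).trans le_add_self
            · rw [Set.indicator_of_notMem hxA, add_zero]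
              refine ENNReal.ofReal_le_ofReal (le_of_not_ge fun h => hxA ⟨hx, h⟩)
        _ ≤ _ := by
            rw [lintegral_add_left measurable_const, lintegral_const, Measure.restrict_apply_univ,
              hJ, Real.volume_Icc, ← ENNReal.ofReal_mul (by norm_num)]
            refine add_le_add (le_of_eq (by congr 1; ring)) ?_
            refine (setLIntegral_le_lintegral _ _).trans ?_
            rw [lintegral_indicator_const hAm]
    have h2 := hDJ.trans h1
    have h3 : ENNReal.ofReal (3 / 4) = ENNReal.ofReal (1 / 4) + ENNReal.ofReal (1 / 2) := by
      rw [← ENNReal.ofReal_add (by norm_num) (by norm_num)]; norm_num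
    rw [h3] at h2
    exact (ENNReal.add_le_add_iff_left ENNReal.ofReal_ne_top).mp h2
  have hex : ∃ x ∈ A, ∃ y ∈ A, x + 1 / 200 ≤ y := by
    by_contra hcon
    push Not at hcon
    have hne : A.Nonempty := by
      by_contra h
      rw [Set.not_nonempty_iff_eq_empty] at h
      rw [h] at hvol
      norm_num at hvol
    obtain ⟨x, hx⟩ := hne
    have hsub : A ⊆ Set.Icc (x - 1 / 200) (x + 1 / 200) := fun y hy =>
      ⟨by linarith [hcon y hy x hx], by linarith [hcon x hx y hy]⟩
    have h1 := hvol.trans (mul_le_mul_right (measure_mono hsub) (ENNReal.ofReal 46))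
    rw [Real.volume_Icc, ← ENNReal.ofReal_mul (by norm_num),
      ENNReal.ofReal_le_ofReal_iff (by ring_nf; norm_num)] at h1
    ring_nf at h1
    norm_num at h1
  obtain ⟨x, hx, y, hy, hxy⟩ := hex
  refine ⟨x, abs_le.mpr ⟨by linarith [hx.1.1], by linarith [hx.1.2]⟩, fun z hz => ?_⟩
  exact hp.min_le_of_mem_uIcc (by norm_num) hx.2 hy.2 ⟨hz.1, hz.2.trans hxy⟩

/-- The decay started at a point of density at least 1/16 near the mean has rate 1/64, uniformly in
`D`. Half of that rate pays for the exponential moment, and `64512 = 252 * 256`. -/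
lemma IsLogConcaveDensity.lintegral_exp_le (hp : IsLogConcaveDensity p)
    (hD : D = volume.withDensity (fun x => ENNReal.ofReal (p x)))
    (hv : variance (fun x : ℝ => x) D = 1) :
    ∫⁻ x, ENNReal.ofReal (Real.exp (|x - ∫ u, u ∂D| / 128)) ∂D ≤ ENNReal.ofReal 64512 := by
  set μ := ∫ u, u ∂D with hμ
  obtain ⟨x₀, hx₀, hInt⟩ := hp.exists_interval hD hv
  have hM : 1 / 16 ≤ p x₀ := hInt x₀ ⟨le_rfl, by norm_num⟩
  have hM46 := hp.le_of_variance hD hv x₀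
  have hMpos : 0 < p x₀ := by linarith
  have hdecay : ∀ x, p x ≤ 126 * Real.exp (-(|x - x₀| / 64)) := by
    intro x
    rcases lt_or_ge |x - x₀| 64 with h | h
    · have h1 : Real.exp (-1) ≤ Real.exp (-(|x - x₀| / 64)) := by
        apply Real.exp_le_exp.mpr; linarith
      have h2 := hp.le_of_variance hD hv x
      have h3 : 46 ≤ 126 * Real.exp (-1) := by
        rw [Real.exp_neg, ← div_eq_mul_inv, le_div_iff₀ (Real.exp_pos _)]
        have := Real.exp_one_lt_d9
        linarith
      linarith
    · have h1 : 4 / p x₀ ≤ |x - x₀| := by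
        rw [div_le_iff₀ hMpos]; nlinarith
      have h2 := hp.le_mul_exp hMpos h1
      have h3 : Real.exp (-(p x₀ * |x - x₀| / 4)) ≤ Real.exp (-(|x - x₀| / 64)) := by
        apply Real.exp_le_exp.mpr
        nlinarith [abs_nonneg (x - x₀)]
      have h4 := Real.exp_pos (-(|x - x₀| / 64))
      nlinarith
  have hpm : Measurable (fun x => ENNReal.ofReal (p x)) := hp.measurable.ennreal_ofReal
  rw [hD, lintegral_withDensity_eq_lintegral_mul _ hpm (by fun_prop)]
  calc _ ≤ ∫⁻ x, ENNReal.ofReal 252 * ENNReal.ofReal (Real.exp (-(1 / 128 * |x - x₀|))) := by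
        refine lintegral_mono (fun x => ?_)
        simp only [Pi.mul_apply]
        rw [← ENNReal.ofReal_mul (hp.nonneg x), ← ENNReal.ofReal_mul (by norm_num)]
        refine ENNReal.ofReal_le_ofReal ?_
        have h1 : |x - μ| ≤ |x - x₀| + 2 := by
          calc |x - μ| = |(x - x₀) + (x₀ - μ)| := by ring_nf
            _ ≤ |x - x₀| + |x₀ - μ| := abs_add_le _ _
            _ ≤ _ := by linarith
        have h2 : Real.exp (|x - μ| / 128) ≤ 2 * Real.exp (|x - x₀| / 128) := by
          have h3 : Real.exp (|x - μ| / 128) ≤ Real.exp (1 / 2 + |x - x₀| / 128) := by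
            apply Real.exp_le_exp.mpr; linarith
          rw [Real.exp_add] at h3
          have h4 : Real.exp (1 / 2) ≤ 2 := by
            have := Real.exp_bound_div_one_sub_of_interval (x := 1 / 2) (by norm_num) (by norm_num)
            norm_num at this ⊢
            exact this
          nlinarith [Real.exp_pos (|x - x₀| / 128)]
        calc p x * Real.exp (|x - μ| / 128)
            ≤ (126 * Real.exp (-(|x - x₀| / 64))) * (2 * Real.exp (|x - x₀| / 128)) := by
              gcongr
              exact hdecay x
          _ = 252 * (Real.exp (-(|x - x₀| / 64)) * Real.exp (|x - x₀| / 128)) := by ring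
          _ = 252 * Real.exp (-(1 / 128 * |x - x₀|)) := by
              rw [← Real.exp_add]; congr 2; ring
    _ = _ := by
        rw [lintegral_const_mul _ (by fun_prop), lintegral_exp_neg_mul_abs (by norm_num),
          ← ENNReal.ofReal_mul (by norm_num)]
        congr 1; norm_num

end Moments

/-! ### Concentration of coordinate sums. -/

section Tails

variable {D : Measure ℝ} [IsProbabilityMeasure D]

/-- The moment generating function of a centred logconcave distribution of unit variance is
subgaussian near the origin. -/
lemma mgf_sub_mean_le (hlc : HasLogConcaveDensity D) (hv : variance (fun x : ℝ => x) D = 1)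
    {l : ℝ} (hl : |l| ≤ 1 / 256) :
    Integrable (fun x => Real.exp (l * (x - ∫ u, u ∂D))) D ∧
    mgf (fun x => x - ∫ u, u ∂D) D l ≤ Real.exp (2 * 256 ^ 2 * 64512 * l ^ 2) := by
  obtain ⟨p, hp, hD⟩ := hlc.exists_isLogConcaveDensity
  have hexp := hp.lintegral_exp_le hD hv
  set μ := ∫ u, u ∂D with hμ
  set E : ℝ → ℝ := fun x => Real.exp (|x - μ| / 128) with hE
  have hEm : Measurable E := by fun_prop
  have hEint : Integrable E D := by
    refine ⟨hEm.aestronglyMeasurable, ?_⟩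
    rw [hasFiniteIntegral_iff_ofReal (ae_of_all _ (fun x => (Real.exp_pos _).le))]
    exact hexp.trans_lt ENNReal.ofReal_lt_top
  have hEle : ∫ x, E x ∂D ≤ 64512 := by
    rw [integral_eq_lintegral_of_nonneg_ae (ae_of_all _ (fun x => (Real.exp_pos _).le))
      hEm.aestronglyMeasurable]
    exact ENNReal.toReal_le_of_le_ofReal (by norm_num) hexp
  have hInt : Integrable (fun x => Real.exp (l * (x - μ))) D := by
    refine hEint.mono' (by fun_prop) (ae_of_all _ (fun x => ?_))
    rw [Real.norm_eq_abs, Real.abs_exp]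
    refine Real.exp_le_exp.mpr ?_
    calc l * (x - μ) ≤ |l| * |x - μ| := by rw [← abs_mul]; exact le_abs_self _
      _ ≤ 1 / 128 * |x - μ| := by gcongr; linarith
      _ = _ := by ring
  refine ⟨hInt, ?_⟩
  have hid : Integrable (fun x : ℝ => x) D :=
    (memLp_of_variance_eq_one hv).integrable (by norm_num)
  have hlin : Integrable (fun x : ℝ => l * (x - μ)) D := (hid.sub (integrable_const _)).const_mul _
  have hmean : ∫ x, l * (x - μ) ∂D = 0 := by
    rw [integral_const_mul, integral_sub hid (integrable_const _)]
    simp [hμ]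
  have hlin1 : Integrable (fun x : ℝ => 1 + l * (x - μ)) D := (integrable_const _).add hlin
  -- The linear term vanishes on integration. In the quadratic term, half of the available exponent
  -- absorbs `|x - μ| ^ 2` and the other half absorbs the exponential in the Taylor remainder.
  have hpt : ∀ x, Real.exp (l * (x - μ)) ≤ 1 + l * (x - μ) + 2 * 256 ^ 2 * l ^ 2 * E x := by
    intro x
    have h1 := abs_exp_mul_le (z := l * (x - μ))
    set w := |x - μ| / 256 with hw
    have hw0 : 0 ≤ w := by positivity
    have h2 : Real.exp |l * (x - μ)| ≤ Real.exp w := by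
      refine Real.exp_le_exp.mpr ?_
      rw [abs_mul, hw]
      nlinarith [abs_nonneg (x - μ)]
    have h3 : (l * (x - μ)) ^ 2 = 256 ^ 2 * l ^ 2 * w ^ 2 := by
      rw [mul_pow, hw, div_pow, sq_abs]; ring
    have h4 : w ^ 2 ≤ 2 * Real.exp w := by
      nlinarith [Real.quadratic_le_exp_of_nonneg hw0]
    have h5 : E x = Real.exp w * Real.exp w := by
      simp only [hE]; rw [← Real.exp_add]; congr 1; rw [hw]; ring
    rw [h5]
    have h6 : (l * (x - μ)) ^ 2 * Real.exp |l * (x - μ)|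
        ≤ 256 ^ 2 * l ^ 2 * (2 * Real.exp w) * Real.exp w := by
      rw [h3]; gcongr
    linarith
  calc mgf (fun x => x - μ) D l = ∫ x, Real.exp (l * (x - μ)) ∂D := rfl
    _ ≤ ∫ x, (1 + l * (x - μ) + 2 * 256 ^ 2 * l ^ 2 * E x) ∂D :=
        integral_mono hInt (hlin1.add (hEint.const_mul _)) hpt
    _ = 1 + 2 * 256 ^ 2 * l ^ 2 * ∫ x, E x ∂D := by
        rw [integral_add hlin1 (hEint.const_mul _),
          integral_add (integrable_const _) hlin, hmean, integral_const_mul]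
        simp
    _ ≤ 1 + 2 * 256 ^ 2 * l ^ 2 * 64512 := by gcongr
    _ ≤ _ := by
        rw [add_comm]
        refine le_trans (Real.add_one_le_exp _) (le_of_eq ?_)
        congr 1; ring

/-- Subexponential concentration of sums of independent centred logconcave variables. -/
theorem measureReal_sum_sub_mean_ge_le (hlc : HasLogConcaveDensity D)
    (hv : variance (fun x : ℝ => x) D = 1) {n : ℕ} (hn : 0 < n) (S : Finset (Fin n)) (R : ℝ) :
    (Measure.pi (fun _ : Fin n => D)).real {x | R * Real.sqrt n ≤ |∑ i ∈ S, (x i - ∫ u, u ∂D)|}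
      ≤ 2 * Real.exp (2 * 64512 - R / 256) := by
  set μ := ∫ u, u ∂D with hμ
  set π := Measure.pi (fun _ : Fin n => D) with hπ
  have hnR : (1 : ℝ) ≤ n := by exact_mod_cast hn
  have hsq : 1 ≤ Real.sqrt n := Real.one_le_sqrt.mpr hnR
  have hsq2 : Real.sqrt n ^ 2 = n := Real.sq_sqrt (by positivity)
  have key : ∀ σ : ℝ, |σ| = 1 →
      π.real {x | R * Real.sqrt n ≤ σ * ∑ i ∈ S, (x i - μ)} ≤ Real.exp (2 * 64512 - R / 256) := by
    intro σ hσ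
    -- Of order `1 / √n`, so the product of at most `n` moment generating functions stays below the
    -- constant `exp (2 * 64512)`, while the threshold contributes `exp (-R / 256)`.
    set l : ℝ := σ / (256 * Real.sqrt n) with hl
    have hlabs : |l| ≤ 1 / 256 := by
      rw [hl, abs_div, hσ, abs_of_pos (by positivity)]
      exact one_div_le_one_div_of_le (by norm_num) (by linarith)
    have hl2 : l ^ 2 = 1 / (256 ^ 2 * n) := by
      rw [hl, div_pow, mul_pow, hsq2, ← sq_abs σ, hσ, one_pow]
    obtain ⟨hInt, hmgf⟩ := mgf_sub_mean_le hlc hv hlabs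
    rw [← hμ] at hInt hmgf
    have hind : iIndepFun (fun (i : Fin n) (x : Fin n → ℝ) => x i - μ) π :=
      iIndepFun_pi (X := fun _ x => x - μ) (fun i => by fun_prop)
    have hmeas : ∀ i : Fin n, Measurable (fun x : Fin n → ℝ => x i - μ) := fun i => by fun_prop
    have hev : ∀ i : Fin n, MeasurePreserving (Function.eval i) π D :=
      fun i => measurePreserving_eval (fun _ : Fin n => D) i
    have hmgfi : ∀ i, mgf (fun x : Fin n → ℝ => x i - μ) π l = mgf (fun x => x - μ) D l := by
      intro i
      unfold mgf
      rw [← (hev i).map_eq, integral_map (hev i).measurable.aemeasurable (by fun_prop)]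
    have hinti : ∀ i : Fin n, Integrable (fun x : Fin n → ℝ => Real.exp (l * (x i - μ))) π :=
      fun i => (hev i).integrable_comp_of_integrable hInt
    have hsum := hind.mgf_sum (t := l) hmeas S
    have hsumint := hind.integrable_exp_mul_sum (t := l) hmeas (s := S) (fun i _ => hinti i)
    have hfun : (∑ i ∈ S, fun x : Fin n → ℝ => x i - μ) = fun x => ∑ i ∈ S, (x i - μ) := by
      ext x; simp
    rw [hfun] at hsum hsumint
    have h1 := measure_ge_le_exp_mul_mgf (μ := π) (X := fun x => σ * ∑ i ∈ S, (x i - μ))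
      (t := 1 / (256 * Real.sqrt n)) (R * Real.sqrt n) (by positivity) (by
        refine hsumint.congr (ae_of_all _ (fun x => ?_))
        simp only [hl]; congr 1; ring)
    refine h1.trans ?_
    have h2 : mgf (fun x => σ * ∑ i ∈ S, (x i - μ)) π (1 / (256 * Real.sqrt n))
        = mgf (fun x => ∑ i ∈ S, (x i - μ)) π l := by
      unfold mgf
      refine integral_congr_ae (ae_of_all _ (fun x => ?_))
      simp only [hl]; congr 1; ring
    rw [h2, hsum]
    have h3 : ∏ i ∈ S, mgf (fun x : Fin n → ℝ => x i - μ) π l ≤ Real.exp (2 * 64512) := by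
      simp_rw [hmgfi]
      rw [Finset.prod_const]
      have hb : Real.exp (2 * 256 ^ 2 * 64512 * l ^ 2) = Real.exp (2 * 64512 / n) := by
        congr 1; rw [hl2]; field_simp
      rw [hb] at hmgf
      calc mgf (fun x => x - μ) D l ^ S.card ≤ Real.exp (2 * 64512 / n) ^ S.card :=
            pow_le_pow_left₀ mgf_nonneg hmgf _
        _ = Real.exp (S.card * (2 * 64512 / n)) := by rw [← Real.exp_nat_mul]
        _ ≤ Real.exp (2 * 64512) := by
            refine Real.exp_le_exp.mpr ?_
            have hc : (S.card : ℝ) ≤ n := by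
              have := Finset.card_le_univ S
              rw [Fintype.card_fin] at this
              exact_mod_cast this
            calc (S.card : ℝ) * (2 * 64512 / n) ≤ n * (2 * 64512 / n) := by gcongr
              _ = 2 * 64512 := by field_simp
    calc _ ≤ Real.exp (-(1 / (256 * Real.sqrt n)) * (R * Real.sqrt n)) * Real.exp (2 * 64512) := by
          gcongr
      _ = _ := by
          rw [← Real.exp_add]; congr 1; field_simp; ring
  have hsub : {x : Fin n → ℝ | R * Real.sqrt n ≤ |∑ i ∈ S, (x i - μ)|}
      ⊆ {x | R * Real.sqrt n ≤ 1 * ∑ i ∈ S, (x i - μ)}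
        ∪ {x | R * Real.sqrt n ≤ (-1) * ∑ i ∈ S, (x i - μ)} := by
    intro x hx
    rcases le_abs.mp (show R * Real.sqrt n ≤ |∑ i ∈ S, (x i - μ)| from hx) with h | h
    · left; simpa using h
    · right; simpa using h
  calc _ ≤ _ := measureReal_mono hsub
    _ ≤ _ := measureReal_union_le _ _
    _ ≤ _ := by
        have h1 := key 1 (by simp)
        have h2 := key (-1) (by simp)
        linarith

end Tails

/-! ### Convolution powers and equidistribution modulo a period. -/

/-- If two measures dominate multiples of Lebesgue measure on intervals, so does their
convolution, on a longer interval. -/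
lemma smul_restrict_le_conv {μ ν : Measure ℝ} [SFinite μ] [SFinite ν] {c c' : ENNReal}
    {a b l l' : ℝ} (hl : 0 ≤ l) (hll' : l ≤ l')
    (hμ : c • volume.restrict (Set.Icc a (a + l)) ≤ μ)
    (hν : c' • volume.restrict (Set.Icc b (b + l')) ≤ ν) :
    (c * c' * ENNReal.ofReal (l / 4)) •
      volume.restrict (Set.Icc (a + b + l / 4) (a + b + l / 4 + (l' + l / 2))) ≤ μ ∗ ν := by
  refine Measure.le_iff.mpr (fun B hB => ?_)
  set f : ℝ → ENNReal := B.indicator 1 with hf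
  have hfm : Measurable f := measurable_one.indicator hB
  have h1 : (μ ∗ ν) B = ∫⁻ x, ∫⁻ y, f (x + y) ∂ν ∂μ := by
    rw [← Measure.lintegral_conv hfm, hf, lintegral_indicator_one hB]
  set J := Set.Icc a (a + l)
  set J' := Set.Icc b (b + l')
  have h2 : c * c' * ∫⁻ x in J, ∫⁻ y in J', f (x + y) ≤ (μ ∗ ν) B := by
    rw [h1]
    calc c * c' * ∫⁻ x in J, ∫⁻ y in J', f (x + y)
        = ∫⁻ x, ∫⁻ y, f (x + y) ∂(c' • volume.restrict J') ∂(c • volume.restrict J) := by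
          simp_rw [lintegral_smul_measure, smul_eq_mul]
          rw [lintegral_const_mul, mul_assoc]
          exact Measurable.lintegral_prod_right' (f := fun z : ℝ × ℝ => f (z.1 + z.2))
            (hfm.comp measurable_add)
      _ ≤ ∫⁻ x, ∫⁻ y, f (x + y) ∂ν ∂(c • volume.restrict J) :=
          lintegral_mono (fun x => lintegral_mono' hν le_rfl)
      _ ≤ _ := lintegral_mono' hμ le_rfl
  refine le_trans ?_ h2
  set K := Set.Icc (a + b + l / 4) (a + b + l / 4 + (l' + l / 2)) with hK
  have h3 : ∀ x, ∫⁻ y in J', f (x + y) = ∫⁻ w, J'.indicator 1 (w - x) * f w := by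
    intro x
    rw [← lintegral_indicator measurableSet_Icc,
      ← lintegral_add_left_eq_self (fun w => J'.indicator 1 (w - x) * f w) x]
    refine lintegral_congr (fun y => ?_)
    have e : x + y - x = y := by ring
    by_cases hy : y ∈ J'
    · rw [Set.indicator_of_mem hy, e, Set.indicator_of_mem hy, Pi.one_apply, one_mul]
    · rw [Set.indicator_of_notMem hy, e, Set.indicator_of_notMem hy, zero_mul]
  simp_rw [h3]
  rw [lintegral_lintegral_swap]
  · calc (c * c' * ENNReal.ofReal (l / 4)) • (volume.restrict K) B
        = c * c' * ∫⁻ w, ENNReal.ofReal (l / 4) * (K.indicator 1 w * f w) := by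
          have : (volume.restrict K) B = ∫⁻ w, K.indicator 1 w * f w := by
            rw [Measure.restrict_apply hB, ← lintegral_indicator_one (hB.inter measurableSet_Icc)]
            refine lintegral_congr (fun w => ?_)
            rw [hf, Set.inter_indicator_one, Pi.mul_apply, mul_comm]
          have hm : Measurable (fun w => K.indicator (1 : ℝ → ENNReal) w * f w) :=
            (measurable_one.indicator measurableSet_Icc).mul hfm
          rw [lintegral_const_mul _ hm, this,
            smul_eq_mul, mul_assoc]
      _ ≤ _ := by
          gcongr with w
          rw [lintegral_mul_const _ ?_, ← mul_assoc]
          swap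
          · exact (measurable_one.indicator measurableSet_Icc).comp (measurable_const.sub measurable_id)
          gcongr
          by_cases hw : w ∈ K
          · rw [Set.indicator_of_mem hw, Pi.one_apply, mul_one]
            -- The sumset of the two intervals is trimmed by `l / 4` at both ends; each remaining
            -- `w` splits as `x + (w - x)` for a set of `x` of length at least `l / 4`.
            have h4 : Set.Icc (max a (w - b - l')) (min (a + l) (w - b))
                ⊆ {x | x ∈ J ∧ w - x ∈ J'} := by
              intro x hx
              obtain ⟨hx1, hx2⟩ := hx
              rw [max_le_iff] at hx1
              rw [le_min_iff] at hx2
              exact ⟨⟨hx1.1, hx2.1⟩, ⟨by linarith [hx2.2], by linarith [hx1.2]⟩⟩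
            calc ENNReal.ofReal (l / 4)
                ≤ volume (Set.Icc (max a (w - b - l')) (min (a + l) (w - b))) := by
                  rw [Real.volume_Icc]
                  refine ENNReal.ofReal_le_ofReal ?_
                  obtain ⟨hw1, hw2⟩ := hw
                  rcases max_cases a (w - b - l') with ⟨e, _⟩ | ⟨e, _⟩ <;>
                  rcases min_cases (a + l) (w - b) with ⟨e', _⟩ | ⟨e', _⟩ <;>
                  rw [e, e'] <;> linarith
              _ ≤ volume.restrict J {x | w - x ∈ J'} := by
                  rw [Measure.restrict_apply]
                  · exact measure_mono (fun x hx => ⟨(h4 hx).2, (h4 hx).1⟩)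
                  · exact measurableSet_Icc.preimage (measurable_const.sub measurable_id)
              _ = _ := by
                  rw [← lintegral_indicator_one]
                  · rfl
                  · exact measurableSet_Icc.preimage (measurable_const.sub measurable_id)
          · simp [hw]
  · have hm : Measurable (fun z : ℝ × ℝ => J'.indicator (1 : ℝ → ENNReal) (z.2 - z.1) * f z.2) :=
      ((measurable_one.indicator measurableSet_Icc).comp
        (measurable_snd.sub measurable_fst)).mul (hfm.comp measurable_snd)
    exact hm.aemeasurable

/-- The `(k+1)`-fold convolution power. -/
noncomputable def convPow (D : Measure ℝ) : ℕ → Measure ℝ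
  | 0 => D
  | k + 1 => D ∗ convPow D k

instance convPow.instIsProbabilityMeasure (D : Measure ℝ) [IsProbabilityMeasure D] (k : ℕ) :
    IsProbabilityMeasure (convPow D k) := by
  induction k with
  | zero => exact ‹_›
  | succ k ih => unfold convPow; infer_instance

/-- Each convolution lengthens the interval by `l / 2`. What matters is the order of quantifiers:
`η` serves all `D` at once. -/
lemma exists_smul_restrict_le_convPow {c : ENNReal} (hc : 0 < c) {l : ℝ} (hl : 0 < l) (k : ℕ) :
    ∃ η : ENNReal, 0 < η ∧ ∀ (D : Measure ℝ) [IsProbabilityMeasure D],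
      (∃ a, c • volume.restrict (Set.Icc a (a + l)) ≤ D) →
      ∃ a, η • volume.restrict (Set.Icc a (a + l * (1 + k / 2))) ≤ convPow D k := by
  induction k with
  | zero =>
    refine ⟨c, hc, fun D _ h => ?_⟩
    simpa [convPow] using h
  | succ k ih =>
    obtain ⟨η, hη, h⟩ := ih
    refine ⟨c * η * ENNReal.ofReal (l / 4), ?_, fun D _ hD => ?_⟩
    · refine ENNReal.mul_pos (ENNReal.mul_pos hc.ne' hη.ne').ne' ?_
      rw [Ne, ENNReal.ofReal_eq_zero]
      linarith
    · obtain ⟨b, hb⟩ := h D hD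
      obtain ⟨a, ha⟩ := hD
      refine ⟨a + b + l / 4, ?_⟩
      have hk : (0 : ℝ) ≤ k := Nat.cast_nonneg k
      have h1 := smul_restrict_le_conv hl.le (by nlinarith : l ≤ l * (1 + k / 2)) ha hb
      have e : l * (1 + ((k + 1 : ℕ) : ℝ) / 2) = l * (1 + k / 2) + l / 2 := by push_cast; ring
      rw [e]
      exact h1

lemma HasLogConcaveDensity.exists_smul_restrict_le {D : Measure ℝ} [IsProbabilityMeasure D]
    (hlc : HasLogConcaveDensity D) (hv : variance (fun x : ℝ => x) D = 1) :
    ∃ a, ENNReal.ofReal (1 / 16) • volume.restrict (Set.Icc a (a + 1 / 200)) ≤ D := by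
  obtain ⟨p, hp, hD⟩ := hlc.exists_isLogConcaveDensity
  obtain ⟨x, -, hx⟩ := hp.exists_interval hD hv
  refine ⟨x, ?_⟩
  rw [← withDensity_const, ← withDensity_indicator measurableSet_Icc, hD]
  refine withDensity_mono (ae_of_all _ (fun z => ?_))
  by_cases hz : z ∈ Set.Icc x (x + 1 / 200)
  · rw [Set.indicator_of_mem hz]
    exact ENNReal.ofReal_le_ofReal (hx z hz)
  · rw [Set.indicator_of_notMem hz]
    exact zero_le

/-- Translation averaging of `G` by `D`. -/
noncomputable def avg (D : Measure ℝ) (G : ℝ → ℝ) (z : ℝ) : ℝ := ∫ x, G (z + x) ∂D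

/-- `G` is measurable, bounded by `d`, `p`-periodic and of mean zero over a period. -/
structure IsMeanZeroPeriodic (p d : ℝ) (G : ℝ → ℝ) : Prop where
  measurable : Measurable G
  abs_le : ∀ x, |G x| ≤ d
  periodic : Function.Periodic G p
  integral_eq_zero : ∫ x in (0 : ℝ)..p, G x = 0

namespace IsMeanZeroPeriodic

variable {p d : ℝ} {G : ℝ → ℝ}

lemma integrable (h : IsMeanZeroPeriodic p d G) (z : ℝ) (D : Measure ℝ) [IsFiniteMeasure D] :
    Integrable (fun x => G (z + x)) D :=
  Integrable.of_bound (h.measurable.comp (measurable_const_add z)).aestronglyMeasurable d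
    (ae_of_all _ (fun _ => h.abs_le _))

lemma intervalIntegrable (h : IsMeanZeroPeriodic p d G) (a b : ℝ) :
    IntervalIntegrable G volume a b := by
  have : IsFiniteMeasure (volume.restrict (Set.uIoc a b)) := by rw [Set.uIoc]; infer_instance
  exact intervalIntegrable_iff.mpr (Integrable.of_bound h.measurable.aestronglyMeasurable d
    (ae_of_all _ (fun _ => h.abs_le _)))

lemma integral_add_nsmul (h : IsMeanZeroPeriodic p d G) (a : ℝ) (k : ℕ) :
    ∫ x in a..a + k * p, G x = 0 := by
  have h1 := h.periodic.intervalIntegral_add_zsmul_eq k a (fun t₁ t₂ => h.intervalIntegrable t₁ t₂)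
  have h2 := h.periodic.intervalIntegral_add_eq a 0
  rw [zero_add, h.integral_eq_zero] at h2
  rw [h2, smul_zero] at h1
  simpa using h1

lemma avg (h : IsMeanZeroPeriodic p d G) (D : Measure ℝ) [IsProbabilityMeasure D] :
    IsMeanZeroPeriodic p d (avg D G) where
  measurable := by
    have h1 : StronglyMeasurable (fun z : ℝ × ℝ => G (z.1 + z.2)) :=
      (h.measurable.comp measurable_add).stronglyMeasurable
    exact h1.integral_prod_right.measurable
  abs_le x := by
    have := norm_integral_le_of_norm_le_const (μ := D) (f := fun y => G (x + y)) (C := d)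
      (ae_of_all _ (fun y => h.abs_le (x + y)))
    simpa [_root_.avg] using this
  periodic x := by
    unfold _root_.avg
    congr 1; ext y
    rw [add_right_comm]; exact h.periodic _
  integral_eq_zero := by
    unfold _root_.avg
    have : IsFiniteMeasure (volume.restrict (Set.uIoc 0 p)) := by rw [Set.uIoc]; infer_instance
    have hi : Integrable (Function.uncurry fun (x y : ℝ) => G (x + y))
        ((volume.restrict (Set.uIoc 0 p)).prod D) :=
      Integrable.of_bound (h.measurable.comp measurable_add).aestronglyMeasurable d
        (ae_of_all _ (fun _ => h.abs_le _))
    rw [intervalIntegral_integral_swap hi]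
    have : ∀ y, ∫ x in (0 : ℝ)..p, G (x + y) = 0 := by
      intro y
      rw [intervalIntegral.integral_comp_add_right, zero_add, add_comm]
      simpa using h.integral_add_nsmul y 1
    simp [this]

/-- Averaging by a measure which dominates a multiple of Lebesgue measure on a long interval
contracts periodic functions of mean zero. -/
lemma abs_avg_le (h : IsMeanZeroPeriodic p d G) (hp : 0 < p) (hp4 : p ≤ 4) {η a : ℝ} (hη : 0 ≤ η)
    {L : Measure ℝ} [IsProbabilityMeasure L]
    (hL : ENNReal.ofReal η • volume.restrict (Set.Icc a (a + 4)) ≤ L) (z : ℝ) :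
    |_root_.avg L G z| ≤ (1 - 2 * η) * d := by
  -- A whole number of periods of total length between 2 and 4 fits into the interval. There `G`
  -- integrates to zero, so at least `2 * η` of the mass of `L` is wasted.
  set k := ⌊4 / p⌋₊ with hk
  have hk1 : k * p ≤ 4 := by
    have := Nat.floor_le (by positivity : 0 ≤ 4 / p)
    rwa [← hk, le_div_iff₀ hp] at this
  have hk2 : 2 ≤ k * p := by
    have h1 := Nat.lt_floor_add_one (4 / p)
    rw [← hk, div_lt_iff₀ hp] at h1
    have h2 : 1 ≤ k := by
      rw [hk]; exact Nat.le_floor (by rw [Nat.cast_one, le_div_iff₀ hp]; linarith)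
    have h3 : (1 : ℝ) ≤ k := by exact_mod_cast h2
    nlinarith
  set ν := ENNReal.ofReal η • volume.restrict (Set.Icc a (a + k * p)) with hν
  have hνL : ν ≤ L := by
    refine le_trans ?_ hL
    refine Measure.le_iff.mpr (fun B _ => ?_)
    simp only [hν, Measure.smul_apply, smul_eq_mul]
    gcongr
  have : IsFiniteMeasure ν := isFiniteMeasure_of_le L hνL
  have hsplit : L = (L - ν) + ν := (Measure.sub_add_cancel_of_le hνL).symm
  have : IsFiniteMeasure (L - ν) := isFiniteMeasure_of_le L Measure.sub_le
  have hνuniv : ν.real Set.univ = η * (k * p) := by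
    rw [measureReal_def, hν, Measure.smul_apply, Measure.restrict_apply_univ, Real.volume_Icc,
      add_sub_cancel_left, smul_eq_mul, ← ENNReal.ofReal_mul hη, ENNReal.toReal_ofReal]
    positivity
  have hLuniv : (L - ν).real Set.univ = 1 - η * (k * p) := by
    have h1 : L.real Set.univ = (L - ν).real Set.univ + ν.real Set.univ := by
      conv_lhs => rw [hsplit]
      rw [measureReal_add_apply]
    rw [probReal_univ, hνuniv] at h1
    linarith
  have hν0 : ∫ x, G (z + x) ∂ν = 0 := by
    rw [hν, integral_smul_measure, integral_Icc_eq_integral_Ioc,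
      ← intervalIntegral.integral_of_le (by linarith), intervalIntegral.integral_comp_add_left,
      ← add_assoc, h.integral_add_nsmul, smul_zero]
  have hd : 0 ≤ d := (abs_nonneg _).trans (h.abs_le 0)
  unfold _root_.avg
  have h1 : ∫ x, G (z + x) ∂L = ∫ x, G (z + x) ∂(L - ν) := by
    conv_lhs => rw [hsplit]
    rw [integral_add_measure (h.integrable z _) (h.integrable z _), hν0, add_zero]
  rw [h1]
  have h2 := norm_integral_le_of_norm_le_const (μ := L - ν) (f := fun y => G (z + y)) (C := d)
      (ae_of_all _ (fun y => h.abs_le (z + y)))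
  rw [hLuniv, Real.norm_eq_abs] at h2
  refine h2.trans ?_
  rw [mul_comm]
  refine mul_le_mul_of_nonneg_right ?_ hd
  nlinarith

lemma avg_convPow (h : IsMeanZeroPeriodic p d G) (D : Measure ℝ) [IsProbabilityMeasure D] (k : ℕ) :
    _root_.avg (convPow D k) G = (_root_.avg D)^[k + 1] G := by
  induction k with
  | zero => rfl
  | succ k ih =>
    rw [Function.iterate_succ', Function.comp_apply, ← ih]
    ext z
    change ∫ x, G (z + x) ∂(D ∗ convPow D k) = _
    rw [integral_conv (h.integrable z _)]
    simp [_root_.avg, add_assoc]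

lemma iterate_avg (h : IsMeanZeroPeriodic p d G) (D : Measure ℝ) [IsProbabilityMeasure D] (j : ℕ) :
    IsMeanZeroPeriodic p d ((_root_.avg D)^[j] G) := by
  induction j with
  | zero => exact h
  | succ j ih => rw [Function.iterate_succ', Function.comp_apply]; exact ih.avg D

lemma iterate_avg_mul {k : ℕ} {θ : ℝ} {D : Measure ℝ} [IsProbabilityMeasure D]
    (hc : ∀ d' G', IsMeanZeroPeriodic p d' G' → ∀ z, |(_root_.avg D)^[k] G' z| ≤ θ * d')
    (h : IsMeanZeroPeriodic p d G) (j : ℕ) :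
    IsMeanZeroPeriodic p (θ ^ j * d) ((_root_.avg D)^[k * j] G) := by
  induction j with
  | zero => simpa using h
  | succ j ih =>
    have e : k * (j + 1) = k + k * j := by ring
    rw [e, Function.iterate_add_apply]
    have h1 := ih.iterate_avg D k
    refine ⟨h1.measurable, fun x => ?_, h1.periodic, h1.integral_eq_zero⟩
    rw [pow_succ', mul_assoc]
    exact hc _ _ ih x

end IsMeanZeroPeriodic

/-- Sums of independent logconcave variables of unit variance equidistribute exponentially fast
modulo every period of length at most `4`. -/
theorem exists_equidistribution_rate : ∃ (k : ℕ) (θ : ℝ), 0 < k ∧ 0 < θ ∧ θ < 1 ∧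
    ∀ (D : Measure ℝ) [IsProbabilityMeasure D], HasLogConcaveDensity D →
      variance (fun x : ℝ => x) D = 1 → ∀ (p d : ℝ) (G : ℝ → ℝ), 0 < p → p ≤ 4 →
      IsMeanZeroPeriodic p d G → ∀ (j : ℕ) (z : ℝ), |(avg D)^[j] G z| ≤ θ ^ (j / k) * d := by
  -- `1598` convolutions stretch the interval to length `(1 / 200) * (1 + 1598 / 2) = 4`, enough for
  -- every admissible period.
  obtain ⟨η, hη, hη'⟩ := exists_smul_restrict_le_convPow
    (c := ENNReal.ofReal (1 / 16)) (by simp) (l := 1 / 200) (by norm_num) 1598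
  obtain ⟨e, he0, heη⟩ : ∃ e : ℝ, 0 < e ∧ ENNReal.ofReal e ≤ η := by
    obtain ⟨r, hr0, hr⟩ := ENNReal.lt_iff_exists_nnreal_btwn.mp hη
    exact ⟨r, by exact_mod_cast hr0, by rw [ENNReal.ofReal_coe_nnreal]; exact hr.le⟩
  -- The cap keeps the contraction factor `1 - 2 * e'` positive.
  set e' := min e (1 / 4) with he'
  have he'0 : 0 < e' := lt_min he0 (by norm_num)
  have he'1 : e' ≤ 1 / 4 := min_le_right _ _
  refine ⟨1599, 1 - 2 * e', by norm_num, by linarith, by linarith, ?_⟩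
  intro D _ hlc hv p d G hp hp4 hG j z
  obtain ⟨a, ha⟩ := hη' D (hlc.exists_smul_restrict_le hv)
  have hL : ENNReal.ofReal e' • volume.restrict (Set.Icc a (a + 4)) ≤ convPow D 1598 := by
    refine le_trans ?_ ha
    have e4 : (1 / 200 : ℝ) * (1 + (1598 : ℕ) / 2) = 4 := by norm_num
    rw [e4]
    refine Measure.le_iff.mpr (fun B _ => ?_)
    simp only [Measure.smul_apply, smul_eq_mul]
    gcongr
    exact (ENNReal.ofReal_le_ofReal (min_le_left _ _)).trans heη
  have hc : ∀ d' G', IsMeanZeroPeriodic p d' G' →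
      ∀ z, |(avg D)^[1599] G' z| ≤ (1 - 2 * e') * d' := by
    intro d' G' hG' z
    rw [← hG'.avg_convPow D 1598]
    exact hG'.abs_avg_le hp hp4 he'0.le hL z
  have h1 := (hG.iterate_avg_mul hc (j / 1599)).iterate_avg D (j % 1599)
  rw [← Function.iterate_add_apply, Nat.mod_add_div] at h1
  exact h1.abs_le z

/-! ### Integrating out coordinates of a product measure. -/

/-- Redrawing one coordinate independently does not change the product law. This integrates a
coordinate out without splitting the index set. -/
lemma measurePreserving_update {n : ℕ} (D : Measure ℝ) [IsProbabilityMeasure D] (i : Fin n) :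
    MeasurePreserving (fun z : (Fin n → ℝ) × ℝ => Function.update z.1 i z.2)
      ((Measure.pi (fun _ : Fin n => D)).prod D) (Measure.pi (fun _ : Fin n => D)) := by
  have hm : Measurable (fun z : (Fin n → ℝ) × ℝ => Function.update z.1 i z.2) := by
    refine measurable_pi_lambda _ (fun j => ?_)
    by_cases hj : j = i
    · subst hj; simpa using measurable_snd
    · simpa [hj, Function.comp_def] using (measurable_pi_apply j).comp measurable_fst
  refine ⟨hm, (Measure.pi_eq (fun s hs => ?_)).symm⟩
  rw [Measure.map_apply hm (MeasurableSet.univ_pi hs)]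
  have hpre : (fun z : (Fin n → ℝ) × ℝ => Function.update z.1 i z.2) ⁻¹' (Set.univ.pi s)
      = (Set.univ.pi (Function.update s i Set.univ)) ×ˢ (s i) := by
    ext z
    simp only [Set.mem_preimage, Set.mem_univ_pi, Set.mem_prod]
    constructor
    · intro h
      refine ⟨fun j => ?_, by simpa using h i⟩
      by_cases hj : j = i
      · subst hj; simp
      · simpa [hj] using h j
    · rintro ⟨h1, h2⟩ j
      by_cases hj : j = i
      · subst hj; simpa using h2
      · simpa [hj] using h1 j
  rw [hpre, Measure.prod_prod, Measure.pi_pi, ← Finset.mul_prod_erase Finset.univ _ (Finset.mem_univ i),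
    ← Finset.mul_prod_erase Finset.univ (fun j => D (s j)) (Finset.mem_univ i)]
  have h1 : ∏ j ∈ Finset.univ.erase i, D (Function.update s i Set.univ j)
      = ∏ j ∈ Finset.univ.erase i, D (s j) := by
    refine Finset.prod_congr rfl (fun j hj => ?_)
    rw [Function.update_of_ne (Finset.ne_of_mem_erase hj)]
  rw [h1, Function.update_self, measure_univ, one_mul, mul_comm]

/-- Integrating out the coordinates in `K` replaces `G` by an iterated average. -/
lemma integral_mul_comp_sum {n : ℕ} (D : Measure ℝ) [IsProbabilityMeasure D] {p d B : ℝ}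
    {G : ℝ → ℝ} (hG : IsMeanZeroPeriodic p d G) {F : (Fin n → ℝ) → ℝ} (hF : Measurable F)
    (hFB : ∀ x, |F x| ≤ B) (S K : Finset (Fin n)) (hKS : K ⊆ S)
    (hFK : ∀ i ∈ K, ∀ x u, F (Function.update x i u) = F x) :
    ∫ x, F x * G (∑ i ∈ S, x i) ∂(Measure.pi (fun _ : Fin n => D))
      = ∫ x, F x * (avg D)^[K.card] G (∑ i ∈ S \ K, x i) ∂(Measure.pi (fun _ : Fin n => D)) := by
  induction K using Finset.induction_on with
  | empty => simp
  | insert i K hi ih =>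
    rw [ih (fun j hj => hKS (Finset.mem_insert_of_mem hj))
      (fun j hj => hFK j (Finset.mem_insert_of_mem hj))]
    rw [Finset.card_insert_of_notMem hi, Function.iterate_succ', Function.comp_apply]
    set G' := (avg D)^[K.card] G with hG'
    have hG'm : IsMeanZeroPeriodic p d G' := hG.iterate_avg D _
    have hB : 0 ≤ B := (abs_nonneg _).trans (hFB 0)
    have hmeas : Measurable (fun x : Fin n → ℝ => F x * G' (∑ j ∈ S \ K, x j)) :=
      hF.mul (hG'm.measurable.comp (by fun_prop))
    have hmp := measurePreserving_update (n := n) D i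
    have hbd : ∀ x, ‖F x * G' (∑ j ∈ S \ K, x j)‖ ≤ B * d := fun x => by
      rw [Real.norm_eq_abs, abs_mul]
      exact mul_le_mul (hFB x) (hG'm.abs_le _) (abs_nonneg _) hB
    have hInt : Integrable (fun z : (Fin n → ℝ) × ℝ =>
        F (Function.update z.1 i z.2) * G' (∑ j ∈ S \ K, Function.update z.1 i z.2 j))
        ((Measure.pi (fun _ : Fin n => D)).prod D) :=
      Integrable.of_bound (hmeas.comp hmp.measurable).aestronglyMeasurable (B * d)
        (ae_of_all _ (fun z => hbd _))
    conv_lhs => rw [← hmp.map_eq]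
    rw [integral_map hmp.measurable.aemeasurable hmeas.aestronglyMeasurable, integral_prod _ hInt]
    refine integral_congr_ae (ae_of_all _ (fun x => ?_))
    have hiS : i ∈ S \ K := Finset.mem_sdiff.mpr ⟨hKS (Finset.mem_insert_self i K), hi⟩
    have hsum : ∀ u, ∑ j ∈ S \ K, Function.update x i u j = ∑ j ∈ S \ insert i K, x j + u := by
      intro u
      rw [Finset.sum_update_of_mem hiS, add_comm]
      congr 2
      ext j
      simp only [Finset.mem_sdiff, Finset.mem_insert, Finset.mem_singleton]
      tauto
    simp only [hFK i (Finset.mem_insert_self i K), hsum]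
    rw [integral_const_mul]
    rfl

lemma IsMeanZeroPeriodic.comp_sub_const {p d : ℝ} {G : ℝ → ℝ} (hG : IsMeanZeroPeriodic p d G)
    (c : ℝ) : IsMeanZeroPeriodic p d (fun x => G (x - c)) where
  measurable := hG.measurable.comp (measurable_id.sub_const c)
  abs_le x := hG.abs_le _
  periodic x := by
    have : x + p - c = x - c + p := by ring
    simp only [this]; exact hG.periodic _
  integral_eq_zero := by
    rw [intervalIntegral.integral_comp_sub_right]
    have := hG.integral_add_nsmul (0 - c) 1
    rw [Nat.cast_one, one_mul] at this
    rwa [show p - c = 0 - c + p by ring]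

/-- `F` does not see the coordinates in `K`, so averaging over them acts on `G` alone and makes that
factor uniformly small. The centring only translates `G`, which preserves periodicity and mean zero.
-/
theorem abs_integral_mul_comp_sum_le {n : ℕ} (D : Measure ℝ) [IsProbabilityMeasure D]
    {p d B ε : ℝ} {G : ℝ → ℝ} (hG : IsMeanZeroPeriodic p d G) {F : (Fin n → ℝ) → ℝ}
    (hF : Measurable F) (hFB : ∀ x, |F x| ≤ B) (c : ℝ) (S K : Finset (Fin n)) (hKS : K ⊆ S)
    (hFK : ∀ i ∈ K, ∀ x u, F (Function.update x i u) = F x)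
    (hrate : ∀ G' : ℝ → ℝ, IsMeanZeroPeriodic p d G' → ∀ z, |(avg D)^[K.card] G' z| ≤ ε) :
    |∫ x, F x * G (∑ i ∈ S, (x i - c)) ∂(Measure.pi (fun _ : Fin n => D))| ≤ B * ε := by
  have hB : 0 ≤ B := (abs_nonneg _).trans (hFB 0)
  have h0 : ∀ x : Fin n → ℝ, ∑ i ∈ S, (x i - c) = ∑ i ∈ S, x i - S.card * c := by
    intro x; rw [Finset.sum_sub_distrib]; simp
  simp_rw [h0]
  rw [integral_mul_comp_sum D (hG.comp_sub_const (S.card * c)) hF hFB S K hKS hFK]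
  have h1 := norm_integral_le_of_norm_le_const (μ := Measure.pi (fun _ : Fin n => D))
    (f := fun x => F x * (avg D)^[K.card] (fun y => G (y - S.card * c)) (∑ i ∈ S \ K, x i))
    (C := B * ε) (ae_of_all _ (fun x => by
      rw [Real.norm_eq_abs, abs_mul]
      exact mul_le_mul (hFB x) (hrate _ (hG.comp_sub_const _) _) (abs_nonneg _) hB))
  simpa using h1

/-! ### The wave and its periodization. -/

/-- The logistic function. -/
noncomputable def logistic (u : ℝ) : ℝ := Real.exp u / (1 + Real.exp u)

lemma logistic_pos (u : ℝ) : 0 < logistic u := by unfold logistic; positivity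

lemma logistic_le_one (u : ℝ) : logistic u ≤ 1 := by
  unfold logistic
  rw [div_le_one (by positivity)]
  linarith

lemma logistic_neg (u : ℝ) : logistic (-u) = 1 - logistic u := by
  unfold logistic
  have := Real.exp_pos u
  rw [Real.exp_neg]
  field_simp
  ring

lemma logistic_mono : Monotone logistic := by
  intro u v h
  unfold logistic
  rw [div_le_div_iff₀ (by positivity) (by positivity)]
  have := Real.exp_le_exp.mpr h
  nlinarith

lemma logistic_le_exp (u : ℝ) : logistic u ≤ Real.exp u := by
  unfold logistic
  have := Real.exp_pos u
  rw [div_le_iff₀ (by positivity)]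
  nlinarith

lemma logistic_sub_le {u v : ℝ} (h : v ≤ u) : logistic u - logistic v ≤ u - v := by
  have h1 : Real.exp v = Real.exp u * Real.exp (v - u) := by rw [← Real.exp_add]; ring_nf
  have h2 := Real.add_one_le_exp (v - u)
  have hu := Real.exp_pos u
  have hv := Real.exp_pos v
  have h3 : Real.exp v ≤ Real.exp u := Real.exp_le_exp.mpr h
  unfold logistic
  have e : Real.exp u / (1 + Real.exp u) - Real.exp v / (1 + Real.exp v)
      = (Real.exp u - Real.exp v) / ((1 + Real.exp u) * (1 + Real.exp v)) := by
    field_simp; ring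
  rw [e, div_le_iff₀ (by positivity)]
  have h4 : Real.exp u - Real.exp v ≤ Real.exp u * (u - v) := by
    rw [h1]; nlinarith
  have h5 : Real.exp u * (u - v) ≤ ((1 + Real.exp u) * (1 + Real.exp v)) * (u - v) := by
    apply mul_le_mul_of_nonneg_right _ (by linarith)
    nlinarith
  linarith

lemma measurable_logistic : Measurable logistic := logistic_mono.measurable

/-- A single bump of the wave. -/
noncomputable def bump (v : ℝ) : ℝ := logistic (v + 1) - logistic (v - 1)

lemma bump_nonneg (v : ℝ) : 0 ≤ bump v := sub_nonneg.mpr (logistic_mono (by linarith))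

lemma bump_le_exp (v : ℝ) : bump v ≤ Real.exp (1 - |v|) := by
  unfold bump
  rcases le_total 0 v with h | h
  · rw [abs_of_nonneg h]
    have h1 := logistic_le_one (v + 1)
    have h2 := logistic_neg (v - 1)
    have h3 := logistic_le_exp (-(v - 1))
    have e : -(v - 1) = 1 - v := by ring
    rw [e] at h2 h3
    linarith
  · rw [abs_of_nonpos h]
    have h1 := logistic_pos (v - 1)
    have h3 := logistic_le_exp (v + 1)
    have e : v + 1 = 1 - -v := by ring
    rw [← e]
    linarith

lemma bump_sub_le (v v₀ : ℝ) : bump v₀ - 2 * |v - v₀| ≤ bump v := by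
  have key : ∀ a b : ℝ, |logistic a - logistic b| ≤ |a - b| := by
    intro a b
    rcases le_total a b with h | h
    · rw [abs_of_nonpos (sub_nonpos.mpr (logistic_mono h)), abs_of_nonpos (by linarith)]
      linarith [logistic_sub_le h]
    · rw [abs_of_nonneg (sub_nonneg.mpr (logistic_mono h)), abs_of_nonneg (by linarith)]
      exact logistic_sub_le h
  have h1 := key (v + 1) (v₀ + 1)
  have h2 := key (v - 1) (v₀ - 1)
  rw [add_sub_add_right_eq_sub] at h1
  rw [sub_sub_sub_cancel_right] at h2
  unfold bump
  have := (abs_le.mp h1).1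
  have := (abs_le.mp h2).2
  linarith

/-- The wave of unit sharpness. -/
noncomputable def wave (m : ℕ) (u : ℝ) : ℝ := ∑ j ∈ Finset.range (2 * m + 1), bump (u + 4 * m - 4 * j)

lemma sum_Icc_neg_eq_sum_range (m : ℕ) (f : ℤ → ℝ) :
    ∑ k ∈ Finset.Icc (-(m : ℤ)) (m : ℤ), f k = ∑ j ∈ Finset.range (2 * m + 1), f ((j : ℤ) - m) := by
  refine Finset.sum_nbij' (fun k => (k + m).toNat) (fun j => (j : ℤ) - m) ?_ ?_ ?_ ?_ ?_
  · intro k hk; simp only [Finset.mem_Icc, Finset.mem_range] at *; omega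
  · intro k hk; simp only [Finset.mem_Icc, Finset.mem_range] at *; omega
  · intro k hk; simp only [Finset.mem_Icc] at *; omega
  · intro k hk; simp only [Finset.mem_range] at *; omega
  · intro k hk
    simp only [Finset.mem_Icc] at *
    congr 1; omega

/-- The symmetry `logistic (-u) = 1 - logistic u` turns each pair of gates into one plus a bump, and
the `2m + 1` ones cancel the constant in `sWave`. -/
lemma sWave_eq_wave {s : ℝ} (hs : 0 < s) (m : ℕ) (x : ℝ) : sWave s m x = wave m (s * x) := by
  unfold sWave wave
  rw [sum_Icc_neg_eq_sum_range]
  have h1 : ∀ j ∈ Finset.range (2 * m + 1),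
      sigmoidGate s (x - (4 * (((j : ℤ) - m : ℤ) : ℝ) - 1) / s)
        + sigmoidGate s ((4 * (((j : ℤ) - m : ℤ) : ℝ) + 1) / s - x)
      = 1 + bump (s * x + 4 * m - 4 * j) := by
    intro j _
    have e1 : s * (x - (4 * (((j : ℤ) - m : ℤ) : ℝ) - 1) / s) = s * x + 4 * m - 4 * j + 1 := by
      push_cast; field_simp; ring
    have e2 : s * ((4 * (((j : ℤ) - m : ℤ) : ℝ) + 1) / s - x) = -(s * x + 4 * m - 4 * j - 1) := by
      push_cast; field_simp; ring
    have e3 : ∀ y, sigmoidGate s y = logistic (s * y) := fun y => rfl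
    rw [e3, e3, e1, e2, logistic_neg]
    unfold bump
    ring
  rw [Finset.sum_congr rfl h1, Finset.sum_add_distrib]
  simp
  ring

lemma measurable_wave (m : ℕ) : Measurable (wave m) := by
  unfold wave bump
  refine Finset.measurable_sum _ (fun j _ => ?_)
  exact (measurable_logistic.comp (by fun_prop)).sub (measurable_logistic.comp (by fun_prop))

lemma wave_nonneg (m : ℕ) (u : ℝ) : 0 ≤ wave m u := Finset.sum_nonneg (fun _ _ => bump_nonneg _)

/-- The wave shifted by half a period fills exactly the gaps, so the sum telescopes to a difference
of two logistic values. Besides the bound by one, this makes the wave low at distance 2 from a point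
where it exceeds one half. -/
lemma wave_add_wave_sub_le (m : ℕ) (u : ℝ) : wave m u + wave m (u - 2) ≤ 1 := by
  unfold wave
  rw [← Finset.sum_add_distrib]
  have h1 : ∀ j ∈ Finset.range (2 * m + 1), bump (u + 4 * m - 4 * j) + bump (u - 2 + 4 * m - 4 * j)
      = logistic (u + 4 * m - 4 * (j : ℕ) + 1) - logistic (u + 4 * m - 4 * ((j + 1 : ℕ) : ℝ) + 1) := by
    intro j _
    unfold bump
    have e1 : u - 2 + 4 * m - 4 * j + 1 = u + 4 * m - 4 * (j : ℝ) - 1 := by ring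
    have e2 : u - 2 + 4 * m - 4 * j - 1 = u + 4 * m - 4 * ((j + 1 : ℕ) : ℝ) + 1 := by
      push_cast; ring
    rw [e1, e2]; ring
  rw [Finset.sum_congr rfl h1,
    Finset.sum_range_sub' (fun j : ℕ => logistic (u + 4 * m - 4 * (j : ℝ) + 1))]
  have h2 := logistic_le_one (u + 4 * m - 4 * ((0 : ℕ) : ℝ) + 1)
  have h3 := logistic_pos (u + 4 * m - 4 * ((2 * m + 1 : ℕ) : ℝ) + 1)
  linarith

lemma wave_add_wave_add_le (m : ℕ) (u : ℝ) : wave m u + wave m (u + 2) ≤ 1 := by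
  have := wave_add_wave_sub_le m (u + 2)
  rw [add_sub_cancel_right] at this
  linarith

lemma wave_le_one (m : ℕ) (u : ℝ) : wave m u ≤ 1 := by
  linarith [wave_add_wave_sub_le m u, wave_nonneg m (u - 2)]

/-- A shift by one period moves each bump to its neighbour, so only the two outermost bumps survive.
-/
lemma wave_add_four_sub (m : ℕ) (u : ℝ) :
    wave m (u + 4) - wave m u = bump (u + 4 * m + 4) - bump (u - 4 * m) := by
  unfold wave
  set g : ℕ → ℝ := fun j => bump (u + 4 * m + 4 - 4 * j) with hg
  have h1 : ∀ j ∈ Finset.range (2 * m + 1), bump (u + 4 + 4 * m - 4 * j) = g j := fun j _ => by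
    simp only [hg]; congr 1; ring
  have h2 : ∀ j ∈ Finset.range (2 * m + 1), bump (u + 4 * m - 4 * j) = g (j + 1) := fun j _ => by
    simp only [hg]; congr 1; push_cast; ring
  rw [Finset.sum_congr rfl h1, Finset.sum_congr rfl h2, ← Finset.sum_sub_distrib,
    Finset.sum_range_sub']
  congr 1
  · simp
  · congr 1; push_cast; ring

lemma abs_wave_add_four_sub_le {m : ℕ} {u : ℝ} (h1 : -(2 * m) - 4 ≤ u) (h2 : u ≤ 2 * m) :
    |wave m (u + 4) - wave m u| ≤ Real.exp (1 - 2 * m) := by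
  rw [wave_add_four_sub]
  have hm : (0 : ℝ) ≤ m := Nat.cast_nonneg m
  have h3 : bump (u + 4 * m + 4) ≤ Real.exp (1 - 2 * m) := by
    refine (bump_le_exp _).trans (Real.exp_le_exp.mpr ?_)
    rw [abs_of_nonneg (by linarith)]; linarith
  have h4 : bump (u - 4 * m) ≤ Real.exp (1 - 2 * m) := by
    refine (bump_le_exp _).trans (Real.exp_le_exp.mpr ?_)
    rw [abs_of_nonpos (by linarith)]; linarith
  have := bump_nonneg (u + 4 * m + 4)
  have := bump_nonneg (u - 4 * m)
  rw [abs_le]; constructor <;> linarith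

/-- The periodization of the central period of the wave. -/
noncomputable def periodicWave (m : ℕ) (u : ℝ) : ℝ := wave m (4 * Int.fract (u / 4 + 1 / 2) - 2)

lemma measurable_periodicWave (m : ℕ) : Measurable (periodicWave m) :=
  (measurable_wave m).comp ((measurable_fract.comp (by fun_prop)).const_mul 4 |>.sub_const 2)

lemma periodicWave_add_four (m : ℕ) (u : ℝ) : periodicWave m (u + 4) = periodicWave m u := by
  unfold periodicWave
  have : (u + 4) / 4 + 1 / 2 = u / 4 + 1 / 2 + 1 := by ring
  rw [this, Int.fract_add_one]

lemma periodicWave_nonneg (m : ℕ) (u : ℝ) : 0 ≤ periodicWave m u := wave_nonneg _ _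

lemma periodicWave_le_one (m : ℕ) (u : ℝ) : periodicWave m u ≤ 1 := wave_le_one _ _

/-- The point is moved into the central period by at most `m + 1` shifts. During them it stays at
distance at least `2m` from the outer bumps, so each shift costs at most `exp (1 - 2m)`. -/
lemma abs_wave_sub_periodicWave_le {m : ℕ} {u : ℝ} (hu : |u| ≤ 2 * m) :
    |wave m u - periodicWave m u| ≤ (m + 1) * Real.exp (1 - 2 * m) := by
  obtain ⟨hu1, hu2⟩ := abs_le.mp hu
  have hE := Real.exp_pos (1 - 2 * (m : ℝ))
  have hm : (0 : ℝ) ≤ m := Nat.cast_nonneg m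
  set v := 4 * Int.fract (u / 4 + 1 / 2) - 2 with hv
  have hv1 : -2 ≤ v := by linarith [Int.fract_nonneg (u / 4 + 1 / 2)]
  have hv2 : v < 2 := by linarith [Int.fract_lt_one (u / 4 + 1 / 2)]
  have huv : u = v + 4 * (⌊u / 4 + 1 / 2⌋ : ℤ) := by
    rw [hv, Int.fract]; ring
  have hup : ∀ j : ℕ, v + 4 * j ≤ 2 * m + 4 →
      |wave m (v + 4 * j) - wave m v| ≤ j * Real.exp (1 - 2 * m) := by
    intro j
    induction j with
    | zero => intro _; simp
    | succ j ih =>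
      intro hj
      push_cast at hj ⊢
      have hj0 : (0 : ℝ) ≤ j := Nat.cast_nonneg j
      have h1 := ih (by linarith)
      have h2 := abs_wave_add_four_sub_le (m := m) (u := v + 4 * j) (by linarith) (by linarith)
      have e : v + 4 * ((j : ℝ) + 1) = v + 4 * j + 4 := by ring
      rw [e]
      calc |wave m (v + 4 * j + 4) - wave m v|
          = |(wave m (v + 4 * j + 4) - wave m (v + 4 * j)) + (wave m (v + 4 * j) - wave m v)| := by
            ring_nf
        _ ≤ _ := (abs_add_le _ _).trans (by linarith)
  have hdown : ∀ j : ℕ, -(2 * m) - 4 ≤ v - 4 * j →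
      |wave m (v - 4 * j) - wave m v| ≤ j * Real.exp (1 - 2 * m) := by
    intro j
    induction j with
    | zero => intro _; simp
    | succ j ih =>
      intro hj
      push_cast at hj ⊢
      have hj0 : (0 : ℝ) ≤ j := Nat.cast_nonneg j
      have h1 := ih (by linarith)
      have h2 := abs_wave_add_four_sub_le (m := m) (u := v - 4 * (j + 1)) (by linarith)
        (by linarith)
      have e : v - 4 * ((j : ℝ) + 1) + 4 = v - 4 * j := by ring
      rw [e, abs_sub_comm] at h2
      calc |wave m (v - 4 * (j + 1)) - wave m v|
          = |(wave m (v - 4 * (j + 1)) - wave m (v - 4 * j)) + (wave m (v - 4 * j) - wave m v)| := by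
            ring_nf
        _ ≤ _ := (abs_add_le _ _).trans (by linarith)
  change |wave m u - wave m v| ≤ _
  obtain ⟨j, hj | hj⟩ := Int.eq_nat_or_neg ⌊u / 4 + 1 / 2⌋
  · rw [hj, Int.cast_natCast] at huv
    have h1 := hup j (by linarith)
    rw [← huv] at h1
    refine h1.trans (mul_le_mul_of_nonneg_right ?_ hE.le)
    linarith
  · rw [hj, Int.cast_neg, Int.cast_natCast] at huv
    have e : v + 4 * -(j : ℝ) = v - 4 * j := by ring
    rw [e] at huv
    have h1 := hdown j (by linarith)
    rw [← huv] at h1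
    refine h1.trans (mul_le_mul_of_nonneg_right ?_ hE.le)
    linarith

/-- The central bump alone peaks at about 0.46; only with its two neighbours does the wave rise
above one half, as the comparison with its half-period shift requires. -/
lemma bump_zero_add_two_mul_bump_four : 0.54 ≤ bump 0 + bump 4 + bump (-4) := by
  have h1 := Real.exp_one_gt_d9
  have h2 := Real.exp_one_lt_d9
  have e1 : logistic (-1) = 1 - logistic 1 := logistic_neg 1
  have e3 : logistic (-3) = 1 - logistic 3 := logistic_neg 3
  have e5 : logistic (-5) = 1 - logistic 5 := logistic_neg 5
  have b1 : 0.731 ≤ logistic 1 := by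
    unfold logistic
    rw [le_div_iff₀ (by positivity)]
    linarith
  have b3 : logistic 3 ≤ 0.9526 := by
    unfold logistic
    rw [div_le_iff₀ (by positivity)]
    have h3 : Real.exp 3 = Real.exp 1 ^ 3 := by rw [← Real.exp_nat_mul]; norm_num
    have h4 : Real.exp 1 ^ 3 ≤ 2.7182818286 ^ 3 := by gcongr
    rw [h3]; norm_num at h4; linarith
  have b5 : 0.9933 ≤ logistic 5 := by
    unfold logistic
    rw [le_div_iff₀ (by positivity)]
    have h3 : Real.exp 5 = Real.exp 1 ^ 5 := by rw [← Real.exp_nat_mul]; norm_num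
    have h4 : 2.7182818283 ^ 5 ≤ Real.exp 1 ^ 5 := by gcongr
    rw [h3]; norm_num at h4 ⊢; linarith
  have f0 : bump 0 = 2 * logistic 1 - 1 := by
    unfold bump; rw [zero_add, zero_sub, e1]; ring
  have f4 : bump 4 = logistic 5 - logistic 3 := by unfold bump; norm_num
  have f4' : bump (-4) = logistic 5 - logistic 3 := by
    unfold bump
    rw [show (-4 : ℝ) + 1 = -3 by norm_num, show (-4 : ℝ) - 1 = -5 by norm_num, e3, e5]; ring
  rw [f0, f4, f4']
  norm_num at *
  linarith

lemma wave_near_zero {m : ℕ} (hm : 1 ≤ m) {v : ℝ} (hv : |v| ≤ 1 / 1000) : 0.53 ≤ wave m v := by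
  have h1 : bump v + bump (v - 4) + bump (v + 4) ≤ wave m v := by
    unfold wave
    have hsub : ({m, m + 1, m - 1} : Finset ℕ) ⊆ Finset.range (2 * m + 1) := by
      intro j hj
      simp only [Finset.mem_insert, Finset.mem_singleton] at hj
      rw [Finset.mem_range]; omega
    refine le_trans (le_of_eq ?_)
      (Finset.sum_le_sum_of_subset_of_nonneg hsub (fun _ _ _ => bump_nonneg _))
    rw [Finset.sum_insert (by simp; omega), Finset.sum_insert (by simp; omega),
      Finset.sum_singleton, Nat.cast_sub hm]
    push_cast
    rw [← add_assoc]
    congr 2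
    · congr 1; ring_nf
    · congr 1; ring
    · ring
  have h2 := bump_sub_le v 0
  have h3 := bump_sub_le (v - 4) (-4)
  have h4 := bump_sub_le (v + 4) 4
  have e3 : v - 4 - -4 = v := by ring
  have e4 : v + 4 - 4 = v := by ring
  rw [sub_zero] at h2
  rw [e3] at h3
  rw [e4] at h4
  have h5 := bump_zero_add_two_mul_bump_four
  norm_num at *
  linarith

lemma periodicWave_near_zero {m : ℕ} (hm : 1 ≤ m) {v : ℝ} (hv : |v| ≤ 1 / 1000) :
    0.53 ≤ periodicWave m v := by
  obtain ⟨h1, h2⟩ := abs_le.mp hv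
  unfold periodicWave
  have : Int.fract (v / 4 + 1 / 2) = v / 4 + 1 / 2 :=
    Int.fract_eq_self.mpr ⟨by linarith, by linarith⟩
  rw [this]
  have e : 4 * (v / 4 + 1 / 2) - 2 = v := by ring
  rw [e]
  exact wave_near_zero hm hv

lemma periodicWave_near_two {m : ℕ} (hm : 1 ≤ m) {v : ℝ} (hv : |v| ≤ 1 / 1000) :
    periodicWave m (v + 2) ≤ 0.47 := by
  obtain ⟨h1, h2⟩ := abs_le.mp hv
  have h3 := wave_near_zero hm hv
  unfold periodicWave
  have e0 : (v + 2) / 4 + 1 / 2 = v / 4 + 1 := by ring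
  rw [e0, Int.fract_add_one]
  rcases le_or_gt 0 v with h | h
  · have : Int.fract (v / 4) = v / 4 := Int.fract_eq_self.mpr ⟨by linarith, by linarith⟩
    rw [this]
    have e : 4 * (v / 4) - 2 = v - 2 := by ring
    rw [e]
    have := wave_add_wave_sub_le m v
    norm_num at *
    linarith
  · have : Int.fract (v / 4) = v / 4 + 1 := by
      rw [← Int.fract_add_one]
      exact Int.fract_eq_self.mpr ⟨by linarith, by linarith⟩
    rw [this]
    have e : 4 * (v / 4 + 1) - 2 = v + 2 := by ring
    rw [e]
    have := wave_add_wave_add_le m v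
    norm_num at *
    linarith

/-! ### Rounding to uniformly spaced labels. -/

namespace IsRounding

variable {Y : Finset ℝ} {r : ℝ → Y}

lemma le_midpoint (hr : IsRounding r) {z y : ℝ} (hy : y ∈ Y) (h : (r z : ℝ) < y) :
    z ≤ (r z + y) / 2 := by
  have h1 := hr z y hy
  rw [← sq_le_sq] at h1
  nlinarith

lemma midpoint_le (hr : IsRounding r) {z y : ℝ} (hy : y ∈ Y) (h : y < (r z : ℝ)) :
    (r z + y) / 2 ≤ z := by
  have h1 := hr z y hy
  rw [← sq_le_sq] at h1
  nlinarith

lemma monotone (hr : IsRounding r) : Monotone (fun z => (r z : ℝ)) := by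
  intro z z' hzz
  rcases hzz.eq_or_lt with rfl | hlt
  · exact le_rfl
  by_contra h
  simp only [not_le] at h
  have h1 := hr.le_midpoint (z := z') (r z).2 h
  have h2 := hr.midpoint_le (z := z) (r z').2 h
  linarith

lemma measurable (hr : IsRounding r) : Measurable r :=
  hr.monotone.measurable.subtype_mk

/-- Two points that are rounded differently are separated by a midpoint of two labels. -/
lemma exists_midpoint_of_ne (hr : IsRounding r) {z z' : ℝ} (h : r z ≠ r z') :
    ∃ q ∈ Y ×ˢ Y, |z - (q.1 + q.2) / 2| ≤ |z - z'| := by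
  refine ⟨((r z : ℝ), (r z' : ℝ)), Finset.mem_product.mpr ⟨(r z).2, (r z').2⟩, ?_⟩
  have hne : (r z : ℝ) ≠ r z' := fun e => h (Subtype.ext e)
  simp only
  rcases lt_or_gt_of_ne hne with hlt | hlt
  · have h1 := hr.le_midpoint (r z').2 hlt
    have h2 := hr.midpoint_le (r z).2 hlt
    rw [abs_of_nonpos (by linarith), abs_of_nonpos (by linarith)]
    linarith
  · have h1 := hr.midpoint_le (r z').2 hlt
    have h2 := hr.le_midpoint (r z).2 hlt
    rw [abs_of_nonneg (by linarith), abs_of_nonneg (by linarith)]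
    linarith

end IsRounding

/-- In the middle of a uniformly spaced set there is a rounding threshold across which rounding
moves points apart. -/
lemma IsUniformlySpaced.exists_threshold {Y : Finset ℝ} (hY : IsUniformlySpaced Y)
    (hY1 : ∀ y ∈ Y, y ∈ Set.Icc (-1 : ℝ) 1) {κ : ℝ} (hκ : 0 < κ)
    (hYκ : ∃ y ∈ Y, ∃ y' ∈ Y, κ ≤ y' - y) :
    2 ≤ Y.card ∧ ∃ w θ : ℝ, κ ≤ w ∧ (∀ y ∈ Y, ∀ y' ∈ Y, |y - y'| ≤ w) ∧
      -1 ≤ θ - w / 4 ∧ θ + w / 4 ≤ 1 ∧ ∀ r : ℝ → Y, IsRounding r → ∀ z₁ z₂ : ℝ,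
        θ - w / 4 ≤ z₁ → z₁ < θ → θ < z₂ → z₂ ≤ θ + w / 4 →
        (z₂ - z₁) / 2 ≤ (r z₂ : ℝ) - r z₁ := by
  obtain ⟨N, y₀, h, hh, rfl⟩ := hY
  have hcard : ((Finset.range N).image (fun j : ℕ => y₀ + (j : ℝ) * h)).card = N := by
    rw [Finset.card_image_of_injective, Finset.card_range]
    intro i j hij
    simp only [add_right_inj, mul_eq_mul_right_iff, Nat.cast_inj, hh.ne', or_false] at hij
    exact hij
  have hmem : ∀ j : ℕ, j < N →
      y₀ + (j : ℝ) * h ∈ (Finset.range N).image (fun j : ℕ => y₀ + (j : ℝ) * h) := fun j hj =>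
    Finset.mem_image_of_mem _ (Finset.mem_range.mpr hj)
  have hform : ∀ y ∈ (Finset.range N).image (fun j : ℕ => y₀ + (j : ℝ) * h),
      ∃ j : ℕ, j < N ∧ y = y₀ + (j : ℝ) * h := by
    intro y hy
    obtain ⟨j, hj, rfl⟩ := Finset.mem_image.mp hy
    exact ⟨j, Finset.mem_range.mp hj, rfl⟩
  obtain ⟨y, hy, y', hy', hyy⟩ := hYκ
  obtain ⟨i, hi, rfl⟩ := hform y hy
  obtain ⟨i', hi', rfl⟩ := hform y' hy'
  have hii : i < i' := by
    have : (i : ℝ) < i' := by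
      by_contra hcon
      push Not at hcon
      nlinarith
    exact_mod_cast this
  have hN : 2 ≤ N := by omega
  have hNR : (2 : ℝ) ≤ N := by exact_mod_cast hN
  have hle : ∀ j : ℕ, j < N → (j : ℝ) ≤ N - 1 := by
    intro j hj
    have : ((j + 1 : ℕ) : ℝ) ≤ N := by exact_mod_cast hj
    push_cast at this; linarith
  -- `w` is the full width of `Y`, and `θ` is the midpoint of two consecutive central labels. Being
  -- central, it has room `w / 4` on both sides inside the hull of `Y`.
  refine ⟨by rw [hcard]; exact hN, (N - 1) * h, y₀ + (((N - 2) / 2 : ℕ) + 1 / 2) * h, ?_, ?_, ?_⟩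
  · have h1 := hle i' hi'
    have h2 : (0 : ℝ) ≤ i := Nat.cast_nonneg i
    nlinarith
  · intro y hy y' hy'
    obtain ⟨j, hj, rfl⟩ := hform y hy
    obtain ⟨j', hj', rfl⟩ := hform y' hy'
    have h1 := hle j hj
    have h2 := hle j' hj'
    have h3 : (0 : ℝ) ≤ j := Nat.cast_nonneg j
    have h4 : (0 : ℝ) ≤ j' := Nat.cast_nonneg j'
    rw [abs_le]; constructor <;> nlinarith
  set j := (N - 2) / 2 with hj
  have hj1 : (N - 1 : ℝ) / 4 ≤ j + 1 / 2 := by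
    rcases Nat.lt_or_ge N 3 with h3 | h3
    · have : N = 2 := by omega
      subst this
      norm_num
    · have h1 : N ≤ 2 * j + 3 := by omega
      have h2 : (N : ℝ) ≤ 2 * j + 3 := by exact_mod_cast h1
      have h4 : (3 : ℝ) ≤ N := by exact_mod_cast h3
      linarith
  have hj2 : (j : ℝ) + 1 / 2 + (N - 1) / 4 ≤ N - 1 := by
    have h1 : 2 * j + 2 ≤ N := by omega
    have h2 : 2 * (j : ℝ) + 2 ≤ N := by exact_mod_cast h1
    linarith
  have hjN : j + 1 < N := by omega
  have hbot : y₀ ≤ y₀ + (j + 1 / 2) * h - (N - 1) * h / 4 := by nlinarith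
  have htop : y₀ + (j + 1 / 2) * h + (N - 1) * h / 4 ≤ y₀ + (N - 1) * h := by nlinarith
  have h0 := (hY1 _ (hmem 0 (by omega))).1
  have h1 := (hY1 _ (hmem (N - 1) (by omega))).2
  rw [Nat.cast_sub (by omega)] at h1
  push_cast at h0 h1
  refine ⟨by linarith, by linarith, ?_⟩
  intro r hr z₁ z₂ hz1 hz1' hz2 hz2'
  have hround : ∀ z, y₀ ≤ z → z ≤ y₀ + (N - 1) * h → |z - r z| ≤ h / 2 := by
    intro z hzl hzu
    set k := ⌊(z - y₀) / h + 1 / 2⌋₊ with hk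
    have hnn : 0 ≤ (z - y₀) / h := div_nonneg (by linarith) hh.le
    have hk1 := Nat.floor_le (by linarith : 0 ≤ (z - y₀) / h + 1 / 2)
    have hk2 := Nat.lt_floor_add_one ((z - y₀) / h + 1 / 2)
    rw [← hk] at hk1 hk2
    have e : (z - y₀) / h * h = z - y₀ := div_mul_cancel₀ _ hh.ne'
    have hkN : k < N := by
      have h2 : (z - y₀) / h ≤ N - 1 := by rw [div_le_iff₀ hh]; linarith
      have h3 : (k : ℝ) < N := by linarith
      exact_mod_cast h3
    refine (hr z _ (hmem k hkN)).trans ?_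
    rw [abs_le]
    constructor <;> nlinarith
  have ha := hround z₁ (by linarith) (by linarith)
  have hb := hround z₂ (by linarith) (by linarith)
  have hc : (r z₁ : ℝ) ≤ y₀ + j * h := by
    by_contra hcon
    push Not at hcon
    have := hr.midpoint_le (z := z₁) (hmem j (by omega)) hcon
    obtain ⟨l, hl, hl'⟩ := hform _ (r z₁).2
    rw [hl'] at hcon this
    have hjl : j < l := by
      have : (j : ℝ) < l := by
        by_contra hcon2
        push Not at hcon2
        nlinarith
      exact_mod_cast this
    have hjl2 : (j : ℝ) + 1 ≤ l := by exact_mod_cast hjl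
    nlinarith
  have hd : y₀ + (j + 1) * h ≤ r z₂ := by
    by_contra hcon
    push Not at hcon
    have := hr.le_midpoint (z := z₂) (hmem (j + 1) hjN) (by push_cast; exact hcon)
    obtain ⟨l, hl, hl'⟩ := hform _ (r z₂).2
    rw [hl'] at hcon this
    have hjl : l < j + 1 := by
      have : (l : ℝ) < j + 1 := by
        by_contra hcon2
        push Not at hcon2
        nlinarith
      exact_mod_cast this
    have hjl2 : (l : ℝ) ≤ j := by
      have : l ≤ j := by omega
      exact_mod_cast this
    push_cast at this
    nlinarith
  -- Rounding errors give a label gap of at least `z₂ - z₁ - h`; crossing the threshold gives at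
  -- least `h`. The average of the two bounds is free of `h`, so the conclusion does not depend on
  -- how fine `Y` is.
  have ha' := abs_le.mp ha
  have hb' := abs_le.mp hb
  linarith

/-- For some shift `β`, the function `ψ + β` is rarely close to the midpoint of two labels. -/
lemma exists_shift_volume_le (Y : Finset ℝ) {ψ : ℝ → ℝ} (hψ : Measurable ψ) {p w δ : ℝ}
    (hw : 0 < w) (hδ : 0 ≤ δ) :
    ∃ β ∈ Set.Icc 0 w, volume (Set.Ico 0 p ∩
      {x | ∃ q ∈ Y ×ˢ Y, |ψ x + β - (q.1 + q.2) / 2| ≤ δ})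
      ≤ ENNReal.ofReal (p * ((Y.card : ℝ) ^ 2 * (2 * δ) / w)) := by
  set Z : ℝ × ℝ → Set (ℝ × ℝ) := fun q => {z | |ψ z.2 + z.1 - (q.1 + q.2) / 2| ≤ δ} with hZ
  have hZm : ∀ q, MeasurableSet (Z q) := fun q =>
    measurableSet_le (by fun_prop) measurable_const
  set f : ℝ → ENNReal := fun β =>
    ∑ q ∈ Y ×ˢ Y, ∫⁻ x in Set.Ico 0 p, (Z q).indicator 1 (β, x) with hf
  have hind : ∀ q, Measurable (fun z : ℝ × ℝ => (Z q).indicator (1 : ℝ × ℝ → ENNReal) z) := fun q =>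
    measurable_one.indicator (hZm q)
  have hle : ∀ β, volume (Set.Ico 0 p ∩
      {x | ∃ q ∈ Y ×ˢ Y, |ψ x + β - (q.1 + q.2) / 2| ≤ δ}) ≤ f β := by
    intro β
    have h1 : Set.Ico 0 p ∩ {x | ∃ q ∈ Y ×ˢ Y, |ψ x + β - (q.1 + q.2) / 2| ≤ δ}
        = ⋃ q ∈ Y ×ˢ Y, Set.Ico 0 p ∩ (fun x => (β, x)) ⁻¹' (Z q) := by
      ext x
      simp only [hZ, Set.mem_inter_iff, Set.mem_ofPred_eq, Set.mem_iUnion, Set.mem_preimage,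
        exists_prop]
      constructor
      · rintro ⟨a, q, b, c⟩; exact ⟨q, b, a, c⟩
      · rintro ⟨q, b, a, c⟩; exact ⟨a, q, b, c⟩
    rw [h1]
    refine (measure_biUnion_finset_le _ _).trans (Finset.sum_le_sum (fun q _ => ?_))
    have hm : MeasurableSet ((fun x => (β, x)) ⁻¹' (Z q)) := (hZm q).preimage (by fun_prop)
    have : ∫⁻ x in Set.Ico 0 p, (Z q).indicator (1 : ℝ × ℝ → ENNReal) (β, x)
        = ∫⁻ x in Set.Ico 0 p, ((fun x => (β, x)) ⁻¹' (Z q)).indicator 1 x := rfl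
    rw [this, lintegral_indicator_one hm, Measure.restrict_apply hm, Set.inter_comm]
  -- By Fubini: for a fixed `x` and a fixed pair of labels, the bad shifts form an interval of
  -- length `2 * δ`. Some shift is then no worse than the average.
  have htot : ∫⁻ β in Set.Icc 0 w, f β ≤ ENNReal.ofReal (p * ((Y.card : ℝ) ^ 2 * (2 * δ))) := by
    simp only [hf]
    rw [lintegral_finsetSum]
    swap
    · intro q _
      exact Measurable.lintegral_prod_right' (hind q)
    have hq : ∀ q ∈ Y ×ˢ Y, ∫⁻ β in Set.Icc 0 w, ∫⁻ x in Set.Ico 0 p, (Z q).indicator 1 (β, x)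
        ≤ ENNReal.ofReal (p * (2 * δ)) := by
      intro q _
      rw [lintegral_lintegral_swap]
      swap
      · exact (hind q).aemeasurable
      calc _ ≤ ∫⁻ x in Set.Ico 0 p, ENNReal.ofReal (2 * δ) := by
            refine lintegral_mono (fun x => ?_)
            set c := (q.1 + q.2) / 2 - ψ x with hc
            have h1 : ∫⁻ β in Set.Icc 0 w, (Z q).indicator (1 : ℝ × ℝ → ENNReal) (β, x)
                ≤ ∫⁻ β, (Set.Icc (c - δ) (c + δ)).indicator 1 β := by
              refine (setLIntegral_le_lintegral _ _).trans (lintegral_mono (fun β => ?_))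
              by_cases hβ : (β, x) ∈ Z q
              · have h2 : β ∈ Set.Icc (c - δ) (c + δ) := by
                  have h3 := abs_le.mp (show |ψ x + β - (q.1 + q.2) / 2| ≤ δ from hβ)
                  exact ⟨by simp only [hc]; linarith [h3.1], by simp only [hc]; linarith [h3.2]⟩
                rw [Set.indicator_of_mem hβ, Set.indicator_of_mem h2]
                exact le_rfl
              · rw [Set.indicator_of_notMem hβ]; exact zero_le
            refine h1.trans ?_
            rw [lintegral_indicator_one measurableSet_Icc, Real.volume_Icc]
            exact ENNReal.ofReal_le_ofReal (by linarith)
        _ = _ := by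
            rw [lintegral_const, Measure.restrict_apply_univ, Real.volume_Ico, sub_zero,
              ← ENNReal.ofReal_mul (by positivity), mul_comm]
    refine (Finset.sum_le_card_nsmul _ _ _ hq).trans (le_of_eq ?_)
    rw [Finset.card_product, nsmul_eq_mul, ← ENNReal.ofReal_natCast, ← ENNReal.ofReal_mul
      (by positivity)]
    congr 1; push_cast; ring
  obtain ⟨β, hβ, hβf⟩ := exists_le_setLAverage (μ := volume) (s := Set.Icc 0 w) (f := f)
    (by rw [Real.volume_Icc]; simpa using hw) (by rw [Real.volume_Icc]; exact ENNReal.ofReal_ne_top)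
    (Finset.measurable_sum _ (fun q _ => Measurable.lintegral_prod_right' (hind q))).aemeasurable
  refine ⟨β, hβ, (hle β).trans (hβf.trans ?_)⟩
  rw [setLAverage_eq, Real.volume_Icc, sub_zero]
  refine (ENNReal.div_le_div_right htot _).trans (le_of_eq ?_)
  rw [← ENNReal.ofReal_div_of_pos hw, mul_div_assoc]

/-! ### Near independence of the label events. -/

/-- The mean of a function over `[0, p]`. -/
noncomputable def periodMean (p : ℝ) (G : ℝ → ℝ) : ℝ := (∫ x in (0 : ℝ)..p, G x) / p

lemma intervalIntegrable_of_abs_le {G : ℝ → ℝ} (hG : Measurable G) {C : ℝ} (hC : ∀ x, |G x| ≤ C)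
    (a b : ℝ) : IntervalIntegrable G volume a b := by
  have : IsFiniteMeasure (volume.restrict (Set.uIoc a b)) := by rw [Set.uIoc]; infer_instance
  exact intervalIntegrable_iff.mpr (Integrable.of_bound hG.aestronglyMeasurable C (ae_of_all _ hC))

lemma abs_le_of_mem_Icc {α d y : ℝ} (h : y ∈ Set.Icc α (α + d)) : |y| ≤ |α| + |d| := by
  obtain ⟨h1, h2⟩ := h
  have := neg_abs_le α; have := le_abs_self α; have := le_abs_self d; have := abs_nonneg d
  rw [abs_le]; constructor <;> linarith

lemma periodMean_mem_Icc {p α d : ℝ} (hp : 0 < p) {G : ℝ → ℝ} (hG : Measurable G)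
    (hGα : ∀ x, G x ∈ Set.Icc α (α + d)) : periodMean p G ∈ Set.Icc α (α + d) := by
  have hi := intervalIntegrable_of_abs_le hG (fun x => abs_le_of_mem_Icc (hGα x)) 0 p
  have h1 := intervalIntegral.integral_mono_on hp.le (intervalIntegrable_const (c := α)) hi
    (fun x _ => (hGα x).1)
  have h2 := intervalIntegral.integral_mono_on hp.le hi (intervalIntegrable_const (c := α + d))
    (fun x _ => (hGα x).2)
  simp only [intervalIntegral.integral_const, smul_eq_mul, sub_zero] at h1 h2
  unfold periodMean
  rw [Set.mem_Icc, le_div_iff₀ hp, div_le_iff₀ hp]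
  constructor <;> linarith

lemma isMeanZeroPeriodic_sub_periodMean {p α d : ℝ} (hp : 0 < p) {G : ℝ → ℝ} (hG : Measurable G)
    (hper : Function.Periodic G p) (hGα : ∀ x, G x ∈ Set.Icc α (α + d)) :
    IsMeanZeroPeriodic p d (fun x => G x - periodMean p G) where
  measurable := hG.sub_const _
  abs_le x := by
    have h1 := hGα x
    have h2 := periodMean_mem_Icc hp hG hGα
    rw [_root_.abs_le]
    constructor <;> linarith [h1.1, h1.2, h2.1, h2.2]
  periodic x := by simp only [hper x]
  integral_eq_zero := by
    rw [intervalIntegral.integral_sub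
      (intervalIntegrable_of_abs_le hG (fun x => abs_le_of_mem_Icc (hGα x)) 0 p)
      intervalIntegrable_const]
    simp only [intervalIntegral.integral_const, smul_eq_mul, sub_zero, periodMean]
    field_simp
    ring

/-- The sum over `S` of the coordinates centred at `μ`. -/
def centredSum {n : ℕ} (μ : ℝ) (S : Finset (Fin n)) (x : Fin n → ℝ) : ℝ := ∑ i ∈ S, (x i - μ)

lemma measurable_centredSum {n : ℕ} (μ : ℝ) (S : Finset (Fin n)) : Measurable (centredSum μ S) := by
  unfold centredSum
  fun_prop

/-- Averaging by `D` at least `N` times shrinks every bounded `p`-periodic function of mean zero by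
the factor `e`. -/
def EquidistributesWithin (D : Measure ℝ) (p : ℝ) (N : ℕ) (e : ℝ) : Prop :=
  ∀ (d : ℝ) (G : ℝ → ℝ), IsMeanZeroPeriodic p d G →
    ∀ j, N ≤ j → ∀ z, |(avg D)^[j] G z| ≤ e * d

section Equidistribution

variable {n N : ℕ} {D : Measure ℝ} [IsProbabilityMeasure D] {p e μ : ℝ}

lemma abs_integral_comp_centredSum_sub_le (h : EquidistributesWithin D p N e) (hp : 0 < p)
    {α d : ℝ} {G : ℝ → ℝ} (hG : Measurable G) (hper : Function.Periodic G p)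
    (hGα : ∀ x, G x ∈ Set.Icc α (α + d)) {S : Finset (Fin n)} (hS : N ≤ S.card) :
    |∫ x, G (centredSum μ S x) ∂(Measure.pi (fun _ : Fin n => D)) - periodMean p G| ≤ e * d := by
  have h0 := isMeanZeroPeriodic_sub_periodMean hp hG hper hGα
  have h1 := abs_integral_mul_comp_sum_le D h0 (F := fun _ => 1) (B := 1) measurable_const
    (fun _ => by simp) μ S S (Finset.Subset.refl S) (fun _ _ _ _ => rfl)
    (ε := e * d) (fun G' hG' z => h d G' hG' _ hS z)
  simp only [one_mul] at h1
  rw [integral_sub _ (integrable_const _)] at h1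
  · simpa [centredSum] using h1
  · exact Integrable.of_bound (hG.comp (measurable_centredSum μ S)).aestronglyMeasurable
      (|α| + |d|) (ae_of_all _ (fun x => abs_le_of_mem_Icc (hGα _)))

/-- The coordinates in `S \ T` occur only in the first factor; averaging over them makes it small
for every value of the rest. -/
lemma abs_integral_mul_centredSum_le_of_sdiff (h : EquidistributesWithin D p N e) {d : ℝ}
    {G : ℝ → ℝ} (hG : IsMeanZeroPeriodic p d G) {S T : Finset (Fin n)} (hST : N ≤ (S \ T).card) :
    |∫ x, G (centredSum μ S x) * G (centredSum μ T x) ∂(Measure.pi (fun _ : Fin n => D))|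
      ≤ d * (e * d) := by
  have h1 := abs_integral_mul_comp_sum_le D hG (F := fun x => G (centredSum μ T x)) (B := d)
    (hG.measurable.comp (measurable_centredSum μ T)) (fun x => hG.abs_le _) μ S (S \ T)
    Finset.sdiff_subset (fun i hi x u => by
      simp only [centredSum]
      congr 1
      refine Finset.sum_congr rfl (fun j hj => ?_)
      have : j ≠ i := fun hji => (Finset.mem_sdiff.mp hi).2 (hji ▸ hj)
      rw [Function.update_of_ne this])
    (fun G' hG' z => h d G' hG' _ hST z)
  simpa only [mul_comm, centredSum] using h1

lemma abs_integral_mul_centredSum_le (h : EquidistributesWithin D p N e) {d : ℝ}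
    {G : ℝ → ℝ} (hG : IsMeanZeroPeriodic p d G) {S T : Finset (Fin n)}
    (hST : N ≤ (S \ T).card ∨ N ≤ (T \ S).card) :
    |∫ x, G (centredSum μ S x) * G (centredSum μ T x) ∂(Measure.pi (fun _ : Fin n => D))|
      ≤ d * (e * d) := by
  rcases hST with h1 | h1
  · exact abs_integral_mul_centredSum_le_of_sdiff h hG h1
  · have := abs_integral_mul_centredSum_le_of_sdiff (μ := μ) h hG h1
    simpa only [mul_comm] using this

end Equidistribution

lemma abs_integral_sub_integral_le {X : Type} [MeasurableSpace X] {π : Measure X}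
    [IsProbabilityMeasure π] {u v : X → ℝ} (hu : Measurable u) (hv : Measurable v) {C C' τ : ℝ}
    (hC : 0 ≤ C) (huC : ∀ x, |u x| ≤ C') (hvC : ∀ x, |v x| ≤ C') (huv : ∀ x, |u x - v x| ≤ C)
    {A : Set X} (hA : MeasurableSet A) (hAτ : π.real A ≤ τ) (h : ∀ x, x ∉ A → u x = v x) :
    |∫ x, u x ∂π - ∫ x, v x ∂π| ≤ C * τ := by
  have hui : Integrable u π := Integrable.of_bound hu.aestronglyMeasurable C' (ae_of_all _ huC)
  have hvi : Integrable v π := Integrable.of_bound hv.aestronglyMeasurable C' (ae_of_all _ hvC)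
  rw [← integral_sub hui hvi]
  calc |∫ x, (u x - v x) ∂π| ≤ ∫ x, |u x - v x| ∂π := abs_integral_le_integral_abs
    _ ≤ ∫ x, A.indicator (fun _ => C) x ∂π := by
        refine integral_mono (hui.sub hvi).abs ((integrable_const C).indicator hA) (fun x => ?_)
        by_cases hx : x ∈ A
        · rw [Set.indicator_of_mem hx]; exact huv x
        · rw [Set.indicator_of_notMem hx]; simp [h x hx]
    _ = C * π.real A := by rw [integral_indicator_const _ hA, smul_eq_mul, mul_comm]
    _ ≤ C * τ := by gcongr

section Labels

variable {n N : ℕ} {D : Measure ℝ} [IsProbabilityMeasure D] {p e μ τ : ℝ} {Y : Finset ℝ}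
  {Φ : ℝ → Y} {f : Finset (Fin n) → (Fin n → ℝ) → Y}

/-- The reference probability of the label `y`. -/
noncomputable def labelMass (p : ℝ) (Φ : ℝ → Y) (y : Y) : ℝ :=
  periodMean p (fun x => if Φ x = y then 1 else 0)

lemma measurable_ite_eq {X : Type} [MeasurableSpace X] {g : X → Y} (hg : Measurable g) (y : Y) :
    Measurable (fun x => if g x = y then (1 : ℝ) else 0) :=
  Measurable.ite (hg (measurableSet_singleton y)) measurable_const measurable_const

lemma ite_mem_Icc (P : Prop) [Decidable P] :
    (if P then (1 : ℝ) else 0) ∈ Set.Icc (0 : ℝ) (0 + 1) := by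
  split_ifs <;> simp

lemma labelMass_mem_Icc (hp : 0 < p) (hΦ : Measurable Φ) (y : Y) :
    labelMass p Φ y ∈ Set.Icc (0 : ℝ) 1 := by
  have := periodMean_mem_Icc (α := 0) (d := 1) hp (measurable_ite_eq hΦ y)
    (fun x => ite_mem_Icc (Φ x = y))
  rwa [zero_add] at this

lemma sum_labelMass (hp : 0 < p) (hΦ : Measurable Φ) : ∑ y, labelMass p Φ y = 1 := by
  unfold labelMass periodMean
  rw [← Finset.sum_div, ← intervalIntegral.integral_finsetSum]
  · simp [hp.ne']
  · intro y _
    exact intervalIntegrable_of_abs_le (measurable_ite_eq hΦ y)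
      (fun x => abs_le_of_mem_Icc (ite_mem_Icc (Φ x = y))) 0 p

lemma measurableSet_ne {X : Type} [MeasurableSpace X] {g g' : X → Y} (hg : Measurable g)
    (hg' : Measurable g') : MeasurableSet {x | g x ≠ g' x} :=
  (measurableSet_eq_fun hg hg').compl

lemma integral_ite_le (h : EquidistributesWithin D p N e) (hp : 0 < p) (hΦ : Measurable Φ)
    (hper : Function.Periodic Φ p) (hf : ∀ S, Measurable (f S)) {S : Finset (Fin n)}
    (hS : N ≤ S.card)
    (hτ : (Measure.pi (fun _ : Fin n => D)).real {x | f S x ≠ Φ (centredSum μ S x)} ≤ τ) (y : Y) :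
    ∫ x, (if f S x = y then (1 : ℝ) else 0) ∂(Measure.pi (fun _ : Fin n => D))
      ≤ labelMass p Φ y + (e + τ) := by
  have hm := hΦ.comp (measurable_centredSum (n := n) μ S)
  have h1 := abs_integral_comp_centredSum_sub_le (n := n) (μ := μ) (α := 0) (d := 1) h hp
    (measurable_ite_eq hΦ y) (fun x => by simp only [hper x])
    (fun x => ite_mem_Icc (Φ x = y)) hS
  have h2 := abs_integral_sub_integral_le (π := Measure.pi (fun _ : Fin n => D)) (C := 1) (C' := 1)
    (measurable_ite_eq (hf S) y) (measurable_ite_eq hm y) (by norm_num)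
    (fun x => by split_ifs <;> simp) (fun x => by split_ifs <;> simp)
    (fun x => by split_ifs <;> simp) (measurableSet_ne (hf S) hm) hτ (fun x hx => by
      simp only [Set.mem_ofPred_eq, not_not] at hx
      rw [hx])
  have h3 := (abs_le.mp h1).2
  have h4 := (abs_le.mp h2).2
  simp only [Function.comp_apply] at h4
  unfold labelMass
  linarith

/-- For the periodic labels the covariance is at most `e`. Passing to the true concepts changes a
product bounded by one on a set of mass at most `2 * τ`, which costs `4 * τ`. -/
lemma abs_integral_ite_mul_ite_le (h : EquidistributesWithin D p N e) (hp : 0 < p)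
    (hΦ : Measurable Φ) (hper : Function.Periodic Φ p) (hf : ∀ S, Measurable (f S))
    {S T : Finset (Fin n)} (hST : N ≤ (S \ T).card ∨ N ≤ (T \ S).card)
    (hS : (Measure.pi (fun _ : Fin n => D)).real {x | f S x ≠ Φ (centredSum μ S x)} ≤ τ)
    (hT : (Measure.pi (fun _ : Fin n => D)).real {x | f T x ≠ Φ (centredSum μ T x)} ≤ τ) (y : Y) :
    |∫ x, ((if f S x = y then (1 : ℝ) else 0) - labelMass p Φ y) *
      ((if f T x = y then (1 : ℝ) else 0) - labelMass p Φ y) ∂(Measure.pi (fun _ : Fin n => D))|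
      ≤ e + 4 * τ := by
  have hmS := hΦ.comp (measurable_centredSum (n := n) μ S)
  have hmT := hΦ.comp (measurable_centredSum (n := n) μ T)
  have hmean := isMeanZeroPeriodic_sub_periodMean (α := 0) (d := 1) hp (measurable_ite_eq hΦ y)
    (fun x => by simp only [hper x]) (fun x => ite_mem_Icc (Φ x = y))
  have h1 := abs_integral_mul_centredSum_le (μ := μ) h hmean hST
  rw [mul_one, one_mul] at h1
  have hb : ∀ (P : Prop) [Decidable P],
      |(if P then (1 : ℝ) else 0) - labelMass p Φ y| ≤ 1 := by
    intro P _
    have := labelMass_mem_Icc hp hΦ y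
    rw [abs_le]
    split_ifs <;> constructor <;> linarith [this.1, this.2]
  have hb2 : ∀ (P Q : Prop) [Decidable P] [Decidable Q],
      |((if P then (1 : ℝ) else 0) - labelMass p Φ y) *
        ((if Q then (1 : ℝ) else 0) - labelMass p Φ y)| ≤ 1 := by
    intro P Q _ _
    rw [abs_mul]
    exact mul_le_one₀ (hb P) (abs_nonneg _) (hb Q)
  have h2 := abs_integral_sub_integral_le (π := Measure.pi (fun _ : Fin n => D)) (C := 2) (C' := 1)
    (τ := τ + τ)
    (((measurable_ite_eq (hf S) y).sub_const (labelMass p Φ y)).mul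
      ((measurable_ite_eq (hf T) y).sub_const (labelMass p Φ y)))
    (((measurable_ite_eq hmS y).sub_const (labelMass p Φ y)).mul
      ((measurable_ite_eq hmT y).sub_const (labelMass p Φ y)))
    (by norm_num) (fun x => hb2 _ _) (fun x => hb2 _ _)
    (fun x => (abs_sub _ _).trans ((add_le_add (hb2 _ _) (hb2 _ _)).trans (by norm_num)))
    ((measurableSet_ne (hf S) hmS).union (measurableSet_ne (hf T) hmT))
    ((measureReal_union_le _ _).trans (add_le_add hS hT)) (fun x hx => by
      simp only [Set.mem_union, Set.mem_ofPred_eq, not_or, not_not] at hx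
      simp only [Pi.mul_apply, hx.1, hx.2])
  simp only [Pi.mul_apply, Function.comp_apply] at h2
  unfold labelMass at h2 ⊢
  have h3 := abs_le.mp h1
  have h4 := abs_le.mp h2
  rw [abs_le]
  constructor <;> linarith [h3.1, h3.2, h4.1, h4.2]

end Labels

/-! ### Separation of the concepts in mean square. -/

/-- Two values that differ by `γ` have squares summing to at least `γ ^ 2 / 2`. The period is cut at
`-ρ`, so that the window around 0 and its half-period translate both lie inside it. -/
lemma periodMean_sq_ge {p d ρ γ : ℝ} {g : ℝ → ℝ} (hg : IsMeanZeroPeriodic p d g) (hp : 0 < p)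
    (hρ : 0 ≤ ρ) (hρp : ρ ≤ p / 4) (hγ : 0 ≤ γ) (hgap : ∀ x, |x| ≤ ρ → γ ≤ g x - g (x + p / 2)) :
    ρ * γ ^ 2 / p ≤ periodMean p (fun x => g x ^ 2) := by
  have hd : 0 ≤ d := (abs_nonneg _).trans (hg.abs_le 0)
  have hii : ∀ a b, IntervalIntegrable (fun x => g x ^ 2) volume a b :=
    intervalIntegrable_of_abs_le (hg.measurable.pow_const 2) (C := d ^ 2) (fun x => by
      rw [abs_pow]; exact pow_le_pow_left₀ (abs_nonneg _) (hg.abs_le x) 2)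
  have hper : Function.Periodic (fun x => g x ^ 2) p := fun x => by simp only [hg.periodic x]
  have h1 : ∫ x in (0 : ℝ)..p, g x ^ 2 = ∫ x in (-ρ)..(-ρ + p), g x ^ 2 := by
    have := hper.intervalIntegral_add_eq 0 (-ρ)
    rwa [zero_add] at this
  have hnn : ∀ a b, a ≤ b → 0 ≤ ∫ x in a..b, g x ^ 2 := fun a b hab =>
    intervalIntegral.integral_nonneg hab (fun x _ => sq_nonneg _)
  have h2 : ∫ x in (-ρ)..(-ρ + p), g x ^ 2
      = (∫ x in (-ρ)..ρ, g x ^ 2) + (∫ x in ρ..(-ρ + p / 2), g x ^ 2)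
        + (∫ x in (-ρ + p / 2)..(ρ + p / 2), g x ^ 2)
        + ∫ x in (ρ + p / 2)..(-ρ + p), g x ^ 2 := by
    rw [intervalIntegral.integral_add_adjacent_intervals (hii _ _) (hii _ _),
      intervalIntegral.integral_add_adjacent_intervals (hii _ _) (hii _ _),
      intervalIntegral.integral_add_adjacent_intervals (hii _ _) (hii _ _)]
  have h3 : ∫ x in (-ρ + p / 2)..(ρ + p / 2), g x ^ 2 = ∫ x in (-ρ)..ρ, g (x + p / 2) ^ 2 := by
    rw [intervalIntegral.integral_comp_add_right (fun x => g x ^ 2)]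
  have hii' : ∀ a b, IntervalIntegrable (fun x => g (x + p / 2) ^ 2) volume a b :=
    intervalIntegrable_of_abs_le ((hg.measurable.comp (measurable_add_const _)).pow_const 2)
      (C := d ^ 2) (fun x => by
        rw [abs_pow]; exact pow_le_pow_left₀ (abs_nonneg _) (hg.abs_le _) 2)
  have h4 : ρ * γ ^ 2 ≤ ∫ x in (-ρ)..ρ, (g x ^ 2 + g (x + p / 2) ^ 2) := by
    have := intervalIntegral.integral_mono_on (by linarith : -ρ ≤ ρ)
      (intervalIntegrable_const (c := γ ^ 2 / 2)) ((hii _ _).add (hii' _ _)) (fun x hx => by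
        have h5 := hgap x (abs_le.mpr hx)
        have h6 : γ ^ 2 ≤ (g x - g (x + p / 2)) ^ 2 := pow_le_pow_left₀ hγ h5 2
        have h7 := sq_nonneg (g x + g (x + p / 2))
        show γ ^ 2 / 2 ≤ g x ^ 2 + g (x + p / 2) ^ 2
        linarith)
    refine le_trans (le_of_eq ?_) this
    simp only [intervalIntegral.integral_const, smul_eq_mul]
    ring
  rw [intervalIntegral.integral_add (hii _ _) (hii' _ _)] at h4
  unfold periodMean
  rw [h1, h2, h3]
  have h8 := hnn ρ (-ρ + p / 2) (by linarith)
  have h9 := hnn (ρ + p / 2) (-ρ + p) (by linarith)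
  refine div_le_div_of_nonneg_right ?_ hp.le
  linarith

section Separation

variable {n N : ℕ} {D : Measure ℝ} [IsProbabilityMeasure D] {p e μ τ : ℝ} {Y : Finset ℝ}
  {Φ : ℝ → Y} {f : Finset (Fin n) → (Fin n → ℝ) → Y}

/-- Expanding the square, the distance is two variances minus twice a covariance. Equidistribution
costs `e * w ^ 2` for each square and twice that for the cross term; disagreement with `Φ` costs `2
* τ * w ^ 2`. -/
lemma le_integral_sq_sub (h : EquidistributesWithin D p N e) (hp : 0 < p)
    (hΦ : Measurable Φ) (hper : Function.Periodic Φ p) (hf : ∀ S, Measurable (f S))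
    {w ρ γ : ℝ} (hw : ∀ y ∈ Y, ∀ y' ∈ Y, |y - y'| ≤ w)
    (hρ : 0 ≤ ρ) (hρp : ρ ≤ p / 4) (hγ : 0 ≤ γ)
    (hgap : ∀ x, |x| ≤ ρ → γ ≤ (Φ x : ℝ) - Φ (x + p / 2))
    {S T : Finset (Fin n)} (hSN : N ≤ S.card) (hTN : N ≤ T.card)
    (hST : N ≤ (S \ T).card ∨ N ≤ (T \ S).card)
    (hS : (Measure.pi (fun _ : Fin n => D)).real {x | f S x ≠ Φ (centredSum μ S x)} ≤ τ)
    (hT : (Measure.pi (fun _ : Fin n => D)).real {x | f T x ≠ Φ (centredSum μ T x)} ≤ τ) :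
    2 * (ρ * γ ^ 2 / p) - w ^ 2 * (4 * e + 2 * τ)
      ≤ ∫ x, ((f S x : ℝ) - f T x) ^ 2 ∂(Measure.pi (fun _ : Fin n => D)) := by
  set π := Measure.pi (fun _ : Fin n => D) with hπ
  have hYne : Y.Nonempty := ⟨_, (Φ 0).2⟩
  set α := Y.min' hYne with hα
  have hYα : ∀ y ∈ Y, y ∈ Set.Icc α (α + w) := fun y hy =>
    ⟨Finset.min'_le _ _ hy, by linarith [(abs_le.mp (hw y hy α (Finset.min'_mem _ _))).2]⟩
  have hΦm : Measurable (fun x => (Φ x : ℝ)) := measurable_subtype_coe.comp hΦ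
  have hfm : ∀ S, Measurable (fun x => (f S x : ℝ)) := fun S => measurable_subtype_coe.comp (hf S)
  set c := periodMean p (fun x => (Φ x : ℝ)) with hc
  have hg : IsMeanZeroPeriodic p w (fun x => (Φ x : ℝ) - c) :=
    isMeanZeroPeriodic_sub_periodMean (α := α) hp hΦm (fun x => by simp only [hper x])
      (fun x => hYα _ (Φ x).2)
  set g : ℝ → ℝ := fun x => (Φ x : ℝ) - c with hgdef
  have hV := periodMean_sq_ge hg hp hρ hρp hγ (fun x hx => by
    have := hgap x hx
    simp only [hgdef]; linarith)
  have hg2 : ∀ x, g x ^ 2 ∈ Set.Icc (0 : ℝ) (0 + w ^ 2) := fun x => by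
    have := pow_le_pow_left₀ (abs_nonneg _) (hg.abs_le x) 2
    rw [sq_abs] at this
    exact ⟨sq_nonneg _, by linarith⟩
  have hsq : ∀ R : Finset (Fin n), N ≤ R.card →
      ρ * γ ^ 2 / p - e * w ^ 2 ≤ ∫ x, g (centredSum μ R x) ^ 2 ∂π := by
    intro R hR
    have h1 := abs_integral_comp_centredSum_sub_le (μ := μ) h hp (hg.measurable.pow_const 2)
      (fun x => by simp only [hg.periodic x]) hg2 hR
    linarith [(abs_le.mp h1).1]
  have hprod := abs_integral_mul_centredSum_le (μ := μ) h hg hST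
  have hgm : ∀ R : Finset (Fin n), Measurable (fun x => g (centredSum μ R x)) := fun R =>
    hg.measurable.comp (measurable_centredSum μ R)
  have hw0 : 0 ≤ w := (abs_nonneg _).trans (hg.abs_le 0)
  have hi2 : ∀ R : Finset (Fin n), Integrable (fun x => g (centredSum μ R x) ^ 2) π := fun R =>
    Integrable.of_bound ((hgm R).pow_const 2).aestronglyMeasurable (w ^ 2) (ae_of_all _ (fun x => by
      rw [Real.norm_eq_abs, abs_pow]; exact pow_le_pow_left₀ (abs_nonneg _) (hg.abs_le _) 2))
  have hi3 : Integrable (fun x => g (centredSum μ S x) * g (centredSum μ T x)) π :=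
    Integrable.of_bound ((hgm S).mul (hgm T)).aestronglyMeasurable (w * w) (ae_of_all _ (fun x => by
      rw [Real.norm_eq_abs, abs_mul]
      exact mul_le_mul (hg.abs_le _) (hg.abs_le _) (abs_nonneg _) hw0))
  have hexp : ∫ x, ((Φ (centredSum μ S x) : ℝ) - Φ (centredSum μ T x)) ^ 2 ∂π
      = ∫ x, g (centredSum μ S x) ^ 2 ∂π + ∫ x, g (centredSum μ T x) ^ 2 ∂π
        - 2 * ∫ x, g (centredSum μ S x) * g (centredSum μ T x) ∂π := by
    have hadd : Integrable
        (fun x => g (centredSum μ S x) ^ 2 + g (centredSum μ T x) ^ 2) π := (hi2 S).add (hi2 T)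
    rw [← integral_const_mul, ← integral_add (hi2 S) (hi2 T),
      ← integral_sub hadd (hi3.const_mul 2)]
    refine integral_congr_ae (ae_of_all _ (fun x => ?_))
    simp only [hgdef]
    ring
  have hmS := hΦ.comp (measurable_centredSum (n := n) μ S)
  have hmT := hΦ.comp (measurable_centredSum (n := n) μ T)
  have hY2 : ∀ y y' : Y, ((y : ℝ) - y') ^ 2 ≤ w ^ 2 := fun y y' => by
    rw [← sq_abs]; exact pow_le_pow_left₀ (abs_nonneg _) (hw _ y.2 _ y'.2) 2
  have h2 := abs_integral_sub_integral_le (π := π) (C := w ^ 2) (C' := w ^ 2) (τ := τ + τ)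
    (((hfm S).sub (hfm T)).pow_const 2)
    (((measurable_subtype_coe.comp hmS).sub (measurable_subtype_coe.comp hmT)).pow_const 2)
    (sq_nonneg w)
    (fun x => by rw [abs_of_nonneg (sq_nonneg _)]; exact hY2 _ _)
    (fun x => by rw [abs_of_nonneg (sq_nonneg _)]; exact hY2 _ _)
    (fun x => by
      have h3 := hY2 (f S x) (f T x)
      have h4 := hY2 ((Φ ∘ centredSum μ S) x) ((Φ ∘ centredSum μ T) x)
      have h5 := sq_nonneg ((f S x : ℝ) - f T x)
      have h6 := sq_nonneg (((Φ ∘ centredSum μ S) x : ℝ) - (Φ ∘ centredSum μ T) x)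
      simp only [Function.comp_apply, Pi.sub_apply] at *
      rw [abs_le]; constructor <;> linarith)
    ((measurableSet_ne (hf S) hmS).union (measurableSet_ne (hf T) hmT))
    ((measureReal_union_le _ _).trans (add_le_add hS hT)) (fun x hx => by
      simp only [Set.mem_union, Set.mem_ofPred_eq, not_or, not_not] at hx
      simp only [Pi.sub_apply, Function.comp_apply, hx.1, hx.2])
  simp only [Function.comp_apply, Pi.sub_apply] at h2
  have h3 := (abs_le.mp h2).1
  rw [hexp] at h3
  have h4 := hsq S hSN
  have h5 := hsq T hTN
  have h6 := (abs_le.mp hprod).2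
  linarith

end Separation

/-- From `(u - v)² ≤ 2 (g - u)² + 2 (g - v)²`: one hypothesis cannot fit two distant concepts. -/
lemma lt_of_regressionError_lt {X : Type} [MeasurableSpace X] {π : Measure X}
    [IsProbabilityMeasure π] {g u v : X → ℝ} (hg : Measurable g) (hu : Measurable u)
    (hv : Measurable v) {ε : ℝ} (h1 : regressionError π g u < ENNReal.ofReal ε)
    (h2 : regressionError π g v < ENNReal.ofReal ε) :
    ∫ x, (u x - v x) ^ 2 ∂π < 4 * ε := by
  have hε : 0 < ε := by
    by_contra hcon
    rw [ENNReal.ofReal_of_nonpos (not_lt.mp hcon)] at h1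
    exact not_lt_zero h1
  have hmu : Measurable (fun x => ENNReal.ofReal ((g x - u x) ^ 2)) :=
    ((hg.sub hu).pow_const 2).ennreal_ofReal
  have hmv : Measurable (fun x => ENNReal.ofReal ((g x - v x) ^ 2)) :=
    ((hg.sub hv).pow_const 2).ennreal_ofReal
  have h3 : ∫⁻ x, ENNReal.ofReal ((u x - v x) ^ 2) ∂π
      ≤ 2 * regressionError π g u + 2 * regressionError π g v := by
    unfold regressionError
    rw [← lintegral_const_mul _ hmu, ← lintegral_const_mul _ hmv,
      ← lintegral_add_left (hmu.const_mul _)]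
    refine lintegral_mono (fun x => ?_)
    rw [← ENNReal.ofReal_ofNat, ← ENNReal.ofReal_mul (by norm_num),
      ← ENNReal.ofReal_mul (by norm_num), ← ENNReal.ofReal_add (by positivity) (by positivity)]
    refine ENNReal.ofReal_le_ofReal ?_
    nlinarith [sq_nonneg ((g x - u x) + (g x - v x))]
  have h4 : 2 * regressionError π g u + 2 * regressionError π g v < ENNReal.ofReal (4 * ε) := by
    have e : ENNReal.ofReal (4 * ε) = 2 * ENNReal.ofReal ε + 2 * ENNReal.ofReal ε := by
      rw [← ENNReal.ofReal_ofNat, ← ENNReal.ofReal_mul (by norm_num),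
        ← ENNReal.ofReal_add (by positivity) (by positivity)]
      congr 1; ring
    rw [e]
    have h20 : (2 : ENNReal) ≠ 0 := by norm_num
    have h2t : (2 : ENNReal) ≠ ⊤ := by norm_num
    exact ENNReal.add_lt_add ((ENNReal.mul_lt_mul_iff_right h20 h2t).mpr h1)
      ((ENNReal.mul_lt_mul_iff_right h20 h2t).mpr h2)
  have hm : Measurable (fun x => (u x - v x) ^ 2) := (hu.sub hv).pow_const 2
  rw [integral_eq_lintegral_of_nonneg_ae (ae_of_all _ (fun x => sq_nonneg _))
    hm.aestronglyMeasurable]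
  exact (ENNReal.toReal_lt_of_lt_ofReal (h3.trans_lt h4))

/-! ### The cost of replacing the wave by its periodization. -/

section Disagreement

variable {n N : ℕ} {D : Measure ℝ} [IsProbabilityMeasure D] {s e a b : ℝ} {m : ℕ}
  {Y : Finset ℝ} {r : ℝ → Y}

/-- The wave and its periodization are rarely rounded to different labels. -/
lemma measureReal_ne_le (h : EquidistributesWithin D (4 / s) N e) (hs : 0 < s)
    (hlc : HasLogConcaveDensity D) (hv : variance (fun x : ℝ => x) D = 1) (hn : 0 < n)
    (hr : IsRounding r) (ha : 0 ≤ a) {ω : ℝ} (hω : 0 ≤ ω)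
    (hW : volume (Set.Ico 0 (4 / s) ∩ {x | ∃ q ∈ Y ×ˢ Y,
      |a * periodicWave m (s * x) + b - (q.1 + q.2) / 2| ≤ a * ((m + 1) * Real.exp (1 - 2 * m))})
      ≤ ENNReal.ofReal (4 / s * ω)) {S : Finset (Fin n)} (hS : N ≤ S.card) {R : ℝ}
    (hR : s * (R * Real.sqrt n) ≤ 2 * m) :
    (Measure.pi (fun _ : Fin n => D)).real {x | r (sWaveOn s m a b (∫ u, u ∂D) S x)
      ≠ r (a * periodicWave m (s * centredSum (∫ u, u ∂D) S x) + b)}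
      ≤ 2 * Real.exp (2 * 64512 - R / 256) + (ω + e) := by
  set μ := ∫ u, u ∂D with hμ
  have hp : 0 < 4 / s := by positivity
  set δ := a * ((m + 1) * Real.exp (1 - 2 * m)) with hδ
  set W : Set ℝ := {x | ∃ q ∈ Y ×ˢ Y, |a * periodicWave m (s * x) + b - (q.1 + q.2) / 2| ≤ δ}
    with hWdef
  have hpw : Measurable (fun x => a * periodicWave m (s * x) + b) :=
    (((measurable_periodicWave m).comp (measurable_const_mul s)).const_mul a).add_const b
  have hWm : MeasurableSet W := by
    have : W = ⋃ q ∈ Y ×ˢ Y, {x | |a * periodicWave m (s * x) + b - (q.1 + q.2) / 2| ≤ δ} := by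
      ext x; simp [hWdef]
    rw [this]
    refine Finset.measurableSet_biUnion _ (fun q _ => ?_)
    exact measurableSet_le (measurable_abs.comp (hpw.sub_const _)) measurable_const
  have hWper : ∀ x, x + 4 / s ∈ W ↔ x ∈ W := by
    intro x
    have e1 : s * (x + 4 / s) = s * x + 4 := by field_simp
    simp only [hWdef, Set.mem_ofPred_eq, e1, periodicWave_add_four]
  -- Two different labels are separated by a midpoint. Unless the sum is too large, the two values
  -- differ by at most `δ`, so the periodic one lies within `δ` of that midpoint.
  have hsub : {x : Fin n → ℝ | r (sWaveOn s m a b μ S x)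
      ≠ r (a * periodicWave m (s * centredSum μ S x) + b)}
      ⊆ {x | R * Real.sqrt n ≤ |∑ i ∈ S, (x i - μ)|} ∪ (centredSum μ S) ⁻¹' W := by
    intro x hx
    by_cases hx1 : R * Real.sqrt n ≤ |∑ i ∈ S, (x i - μ)|
    · exact Or.inl hx1
    right
    have hx1 := not_le.mp hx1
    obtain ⟨q, hq, hq'⟩ := hr.exists_midpoint_of_ne (Ne.symm hx)
    refine ⟨q, hq, hq'.trans ?_⟩
    unfold sWaveOn
    rw [sWave_eq_wave hs]
    change |a * periodicWave m (s * centredSum μ S x) + b - (a * wave m (s * centredSum μ S x) + b)|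
      ≤ δ
    have e1 : a * periodicWave m (s * centredSum μ S x) + b - (a * wave m (s * centredSum μ S x) + b)
        = -(a * (wave m (s * centredSum μ S x) - periodicWave m (s * centredSum μ S x))) := by ring
    rw [e1, abs_neg, abs_mul, abs_of_nonneg ha]
    refine mul_le_mul_of_nonneg_left (abs_wave_sub_periodicWave_le ?_) ha
    rw [abs_mul, abs_of_pos hs]
    refine le_trans ?_ hR
    exact mul_le_mul_of_nonneg_left hx1.le hs.le
  -- Closeness to a midpoint is itself a periodic event, so equidistribution reduces its probability
  -- to its share `ω` of one period, up to `e`.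
  have h1 := abs_integral_comp_centredSum_sub_le (n := n) (μ := μ) (α := 0) (d := 1) h hp
    (G := W.indicator 1) (measurable_one.indicator hWm)
    (fun x => by
      by_cases hx : x ∈ W
      · rw [Set.indicator_of_mem hx, Set.indicator_of_mem ((hWper x).mpr hx)]; rfl
      · rw [Set.indicator_of_notMem hx, Set.indicator_of_notMem (fun hx' => hx ((hWper x).mp hx'))])
    (fun x => by by_cases hx : x ∈ W <;> simp [hx]) hS
  have h2 : ∫ x, W.indicator (1 : ℝ → ℝ) (centredSum μ S x) ∂(Measure.pi (fun _ : Fin n => D))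
      = (Measure.pi (fun _ : Fin n => D)).real ((centredSum μ S) ⁻¹' W) := by
    rw [← integral_indicator_one (hWm.preimage (measurable_centredSum μ S))]
    rfl
  have h3 : periodMean (4 / s) (W.indicator 1) ≤ ω := by
    unfold periodMean
    rw [div_le_iff₀ hp, intervalIntegral.integral_of_le hp.le, ← integral_Ico_eq_integral_Ioc,
      integral_indicator_one hWm, measureReal_def, Measure.restrict_apply hWm, Set.inter_comm]
    refine ENNReal.toReal_le_of_le_ofReal (by positivity) (hW.trans (le_of_eq ?_))
    rw [mul_comm]
  have h4 := (abs_le.mp h1).2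
  rw [h2, mul_one] at h4
  have h5 := measureReal_sum_sub_mean_ge_le hlc hv hn S R
  calc _ ≤ _ := measureReal_mono hsub
    _ ≤ _ := measureReal_union_le _ _
    _ ≤ _ := add_le_add h5 (by linarith)

end Disagreement

/-! ### Choice of the length, the gate and the exponent. -/

/-- The constant in the bound for the truncation error of the wave. -/
noncomputable def truncConst : ℝ := 2 * Real.exp 129025 + 800

lemma truncConst_pos : 0 < truncConst := by unfold truncConst; positivity

/-- A wave with `O(s √n log Q)` units is long enough to make all truncation errors polynomially
small in `Q`. -/
lemma exists_wave_length {s : ℝ} (hs : 1 ≤ s) {n : ℕ} (hn : 2 ≤ n) {N : ℕ} (hN : 2 ≤ N) :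
    ∃ m : ℕ, 1 ≤ m ∧
      2 * (2 * (m : ℝ) + 1) ≤ 5122 * (s * Real.sqrt n * Real.log (N * s * n)) ∧
      2 * Real.exp (2 * 64512 - (2 * m / (s * Real.sqrt n)) / 256)
        + 100 * (N : ℝ) ^ 2 * ((m + 1) * Real.exp (1 - 2 * m))
        ≤ truncConst * ((N * s * n) ^ 8)⁻¹ := by
  have hnR : (2 : ℝ) ≤ n := by exact_mod_cast hn
  have hNR : (2 : ℝ) ≤ N := by exact_mod_cast hN
  set Q : ℝ := N * s * n with hQ
  have hNs : (2 : ℝ) ≤ N * s := by nlinarith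
  have hQ4 : 4 ≤ Q := by nlinarith
  have hQ0 : 0 < Q := by linarith
  have hNQ : (N : ℝ) ≤ Q := by
    have h1 : (N : ℝ) * 1 ≤ N * s := by gcongr
    have h2 : (N * s) * 1 ≤ N * s * (n : ℝ) := by gcongr; linarith
    linarith
  set L := Real.log Q with hL
  have hL1 : 1 ≤ L := by
    rw [hL, Real.le_log_iff_exp_le hQ0]
    have := Real.exp_one_lt_d9
    linarith
  have hsq : 1 ≤ Real.sqrt n := Real.one_le_sqrt.mpr (by linarith)
  have hssq : 1 ≤ s * Real.sqrt n := by nlinarith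
  set X := s * Real.sqrt n * L with hX
  have hXL : L ≤ X := by nlinarith
  set m := ⌊1280 * X⌋₊ with hm
  have hm1 : (m : ℝ) ≤ 1280 * X := Nat.floor_le (by positivity)
  have hm2 : 1280 * X < m + 1 := Nat.lt_floor_add_one _
  have hexpL : ∀ j : ℕ, Real.exp (-(j * L)) = (Q ^ j)⁻¹ := by
    intro j
    rw [Real.exp_neg, Real.exp_nat_mul, hL, Real.exp_log hQ0]
  have h8 := hexpL 8
  have h2' : Real.exp (2 * L) = Q ^ 2 := by
    have := Real.exp_nat_mul L 2
    rw [hL, Real.exp_log hQ0] at this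
    rw [← this, hL]; norm_num
  push_cast at h8
  refine ⟨m, ?_, by linarith, ?_⟩
  · rw [hm]; exact Nat.le_floor (by push_cast; linarith)
  rw [← h8]
  have hR : 10 * L - 1 ≤ (2 * m / (s * Real.sqrt n)) / 256 := by
    rw [div_div, le_div_iff₀ (by positivity)]
    have h1 : (10 * L - 1) * (s * Real.sqrt n * 256) = 2560 * X - 256 * (s * Real.sqrt n) := by
      rw [hX]; ring
    rw [h1]
    linarith
  have hA : Real.exp (2 * 64512 - (2 * m / (s * Real.sqrt n)) / 256)
      ≤ Real.exp 129025 * Real.exp (-(8 * L)) := by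
    rw [← Real.exp_add]
    refine Real.exp_le_exp.mpr ?_
    linarith
  have hB : (N : ℝ) ^ 2 * ((m + 1) * Real.exp (1 - 2 * m)) ≤ 8 * Real.exp (-(8 * L)) := by
    have h1 : (m + 1 : ℝ) ≤ Real.exp m := Real.add_one_le_exp _
    have h3 : (m + 1) * Real.exp (1 - 2 * m) ≤ Real.exp (2 + -(10 * L)) := by
      calc (m + 1) * Real.exp (1 - 2 * m) ≤ Real.exp m * Real.exp (1 - 2 * m) := by gcongr
        _ = Real.exp (1 - m) := by rw [← Real.exp_add]; congr 1; ring
        _ ≤ _ := Real.exp_le_exp.mpr (by linarith)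
    have h4 : Real.exp 2 ≤ 8 := by
      have h5 : Real.exp 2 = Real.exp 1 ^ 2 := by rw [← Real.exp_nat_mul]; norm_num
      have h6 : Real.exp 1 ^ 2 ≤ 2.7182818286 ^ 2 := by
        have := Real.exp_one_lt_d9
        gcongr
      rw [h5]; norm_num at h6 ⊢; linarith
    calc (N : ℝ) ^ 2 * ((m + 1) * Real.exp (1 - 2 * m))
        ≤ Q ^ 2 * Real.exp (2 + -(10 * L)) := by gcongr
      _ = Real.exp 2 * Real.exp (-(8 * L)) := by
          rw [← h2', ← Real.exp_add, ← Real.exp_add]; congr 1; ring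
      _ ≤ _ := by gcongr
  unfold truncConst
  have := Real.exp_pos (-(8 * L))
  linarith

/-- The choice of the wave and of its output gate. -/
lemma exists_wave {s : ℝ} (hs : 1 ≤ s) {n : ℕ} (hn : 2 ≤ n) {Y : Finset ℝ}
    (hY : IsUniformlySpaced Y) (hY1 : ∀ y ∈ Y, y ∈ Set.Icc (-1 : ℝ) 1) {κ : ℝ} (hκ : 0 < κ)
    (hYκ : ∃ y ∈ Y, ∃ y' ∈ Y, κ ≤ y' - y) :
    2 ≤ Y.card ∧ ∃ (m : ℕ) (a b w ω : ℝ), 0 ≤ a ∧ 0 ≤ ω ∧ κ ≤ w ∧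
      2 * (2 * (m : ℝ) + 1) ≤ 5122 * (s * Real.sqrt n * Real.log (Y.card * s * n)) ∧
      (∀ u, a * sWave s m u + b ∈ Set.Icc (-1 : ℝ) 1) ∧
      (∀ y ∈ Y, ∀ y' ∈ Y, |y - y'| ≤ w) ∧
      2 * Real.exp (2 * 64512 - (2 * m / (s * Real.sqrt n)) / 256) + ω
        ≤ truncConst * ((Y.card * s * n) ^ 8)⁻¹ ∧
      volume (Set.Ico 0 (4 / s) ∩ {x | ∃ q ∈ Y ×ˢ Y,
        |a * periodicWave m (s * x) + b - (q.1 + q.2) / 2| ≤ a * ((m + 1) * Real.exp (1 - 2 * m))})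
        ≤ ENNReal.ofReal (4 / s * ω) ∧
      ∀ r : ℝ → Y, IsRounding r → ∀ x, |x| ≤ 1 / (1000 * s) →
        0.00375 * w ≤ (r (a * periodicWave m (s * x) + b) : ℝ)
          - r (a * periodicWave m (s * (x + 4 / s / 2)) + b) := by
  obtain ⟨hcard, w, θ, hκw, hw, hθ1, hθ2, hthr⟩ := hY.exists_threshold hY1 hκ hYκ
  obtain ⟨m, hm1, hmle, hmT⟩ := exists_wave_length hs hn hcard
  have hw0 : 0 < w := by linarith
  have hs0 : 0 < s := by linarith
  -- The gate sends the level one half of the wave to `θ + β`. As `β ≤ a / 50`, the levels 0.53 and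
  -- 0.47 still straddle `θ`, and all values stay within `2 * a = w / 4` of it. Half of the gap
  -- `0.06 * a` is `0.00375 * w`.
  set a := w / 8 with ha
  have ha0 : 0 < a := by positivity
  set δ := (m + 1) * Real.exp (1 - 2 * m) with hδ
  have hδ0 : 0 ≤ δ := by positivity
  have hψ : Measurable (fun x => a * periodicWave m (s * x) + (θ - a / 2)) :=
    (((measurable_periodicWave m).comp (measurable_const_mul s)).const_mul a).add_const _
  obtain ⟨β, hβ, hβv⟩ := exists_shift_volume_le Y hψ (p := 4 / s) (w := a / 50) (δ := a * δ)
    (by positivity) (by positivity)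
  refine ⟨hcard, m, a, θ - a / 2 + β, w, 100 * (Y.card : ℝ) ^ 2 * δ, ha0.le, by positivity, hκw,
    hmle, ?_, hw, hmT, ?_, ?_⟩
  · intro u
    rw [sWave_eq_wave hs0]
    have h1 := wave_nonneg m (s * u)
    have h2 := wave_le_one m (s * u)
    have h3 : a * wave m (s * u) ≤ a * 1 := by gcongr
    have h4 : 0 ≤ a * wave m (s * u) := by positivity
    obtain ⟨h5, h6⟩ := hβ
    constructor <;> linarith
  · have e1 : 4 / s * ((Y.card : ℝ) ^ 2 * (2 * (a * δ)) / (a / 50))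
        = 4 / s * (100 * (Y.card : ℝ) ^ 2 * δ) := by
      field_simp; ring
    rw [← e1]
    simpa only [add_assoc] using hβv
  · intro r hr x hx
    have hv : |s * x| ≤ 1 / 1000 := by
      rw [abs_mul, abs_of_pos hs0]
      calc s * |x| ≤ s * (1 / (1000 * s)) := by gcongr
        _ = 1 / 1000 := by field_simp
    have e1 : s * (x + 4 / s / 2) = s * x + 2 := by field_simp; ring
    rw [e1]
    have h1 := periodicWave_near_zero hm1 hv
    have h2 := periodicWave_near_two hm1 hv
    have h3 := periodicWave_le_one m (s * x)
    have h4 := periodicWave_nonneg m (s * x + 2)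
    have h5 : a * 0.53 ≤ a * periodicWave m (s * x) := by gcongr
    have h6 : a * periodicWave m (s * x + 2) ≤ a * 0.47 := by gcongr
    have h7 : a * periodicWave m (s * x) ≤ a * 1 := by gcongr
    have h8 : 0 ≤ a * periodicWave m (s * x + 2) := by positivity
    obtain ⟨h9, h10⟩ := hβ
    norm_num at h5 h6
    have h11 := hthr r hr (a * periodicWave m (s * x + 2) + (θ - a / 2 + β))
      (a * periodicWave m (s * x) + (θ - a / 2 + β)) (by linarith) (by linarith) (by linarith)
      (by linarith)
    norm_num
    linarith

lemma pow_div_le {θ : ℝ} (hθ0 : 0 < θ) (hθ1 : θ < 1) {M : ℕ} (hM : 0 < M) (n : ℕ) :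
    θ ^ (n / M) ≤ θ⁻¹ * (θ ^ (1 / (M : ℝ))) ^ n := by
  set ϑ := θ ^ (1 / (M : ℝ)) with hϑ
  have h0 : 0 < ϑ := Real.rpow_pos_of_pos hθ0 _
  have h1 : ϑ ≤ 1 := Real.rpow_le_one hθ0.le hθ1.le (by positivity)
  have h2 : ϑ ^ M = θ := by
    rw [hϑ, ← Real.rpow_natCast, ← Real.rpow_mul hθ0.le]
    have : (M : ℝ) ≠ 0 := by positivity
    field_simp
    simp
  have h3 : n ≤ M * (n / M + 1) := by
    have := Nat.div_add_mod n M
    have := Nat.mod_lt n hM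
    linarith
  have h4 : θ ^ (n / M + 1) ≤ ϑ ^ n := by
    calc θ ^ (n / M + 1) = ϑ ^ (M * (n / M + 1)) := by rw [pow_mul, h2]
      _ ≤ ϑ ^ n := pow_le_pow_of_le_one h0.le h1 h3
  rw [pow_succ] at h4
  rw [inv_mul_eq_div, le_div_iff₀ hθ0]
  exact h4

/-- `2 ^ c` is so close to one that its square does not outgrow the equidistribution rate, as the
covariance bound needs, and that it stays below the growth rate 3/2 of the family. The factor 288
and the summand 3 are those of the final count. -/
lemma exists_exponent {θ : ℝ} (hθ0 : 0 < θ) (hθ1 : θ < 1) {k : ℕ} (hk : 0 < k) :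
    ∃ c : ℝ, 0 < c ∧ c ≤ 1 / 4 ∧ ∀ᶠ n : ℕ in Filter.atTop,
      720 * (n : ℝ) ^ 2 * ((2 : ℝ) ^ (c * n)) ^ 2 * θ ^ (n / 32 / k) ≤ 1 / 10 ^ 9 ∧
      288 * (n : ℝ) * (2 : ℝ) ^ (c * n) + 3 ≤ (3 / 2) ^ n := by
  set M := 32 * k with hM
  have hM0 : 0 < M := by positivity
  set ϑ := θ ^ (1 / (M : ℝ)) with hϑ
  have h0 : 0 < ϑ := Real.rpow_pos_of_pos hθ0 _
  have h1 : ϑ < 1 := Real.rpow_lt_one hθ0.le hθ1 (by positivity)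
  have hlog : Real.log ϑ < 0 := Real.log_neg h0 h1
  have hlog2 : 0 < Real.log 2 := Real.log_pos (by norm_num)
  set c := min (1 / 4) (-Real.log ϑ / (4 * Real.log 2)) with hc
  have hc0 : 0 < c := lt_min (by norm_num) (div_pos (by linarith) (by positivity))
  have hc1 : c ≤ 1 / 4 := min_le_left _ _
  have hc2 : c * (4 * Real.log 2) ≤ -Real.log ϑ := by
    rw [← le_div_iff₀ (by positivity)]; exact min_le_right _ _
  refine ⟨c, hc0, hc1, ?_⟩
  have hpow : ∀ n : ℕ, (2 : ℝ) ^ (c * n) = ((2 : ℝ) ^ c) ^ n := fun n => by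
    rw [Real.rpow_mul (by norm_num), Real.rpow_natCast]
  set z := (2 : ℝ) ^ c with hz
  have hz0 : 0 < z := by positivity
  have hz1 : z ≤ 5 / 4 := by
    have h2 : z ≤ (2 : ℝ) ^ (1 / 4 : ℝ) := Real.rpow_le_rpow_of_exponent_le (by norm_num) hc1
    have h3 : (2 : ℝ) ^ (1 / 4 : ℝ) ≤ 5 / 4 := by
      have h4 : ((2 : ℝ) ^ (1 / 4 : ℝ)) ^ 4 = 2 := by
        rw [← Real.rpow_natCast, ← Real.rpow_mul (by norm_num)]
        norm_num
      refine le_of_pow_le_pow_left₀ (n := 4) (by norm_num) (by norm_num) ?_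
      rw [h4]; norm_num
    exact h2.trans h3
  have hq : z ^ 2 * ϑ < 1 := by
    rw [hz, Real.rpow_def_of_pos (by norm_num), ← Real.exp_log h0, ← Real.exp_nat_mul,
      ← Real.exp_add, Real.exp_lt_one_iff]
    push_cast
    linarith
  have hq0 : 0 < z ^ 2 * ϑ := by positivity
  have t1 : Filter.Tendsto (fun n : ℕ => 720 * θ⁻¹ * ((n : ℝ) ^ 2 * (z ^ 2 * ϑ) ^ n))
      Filter.atTop (nhds (720 * θ⁻¹ * 0)) :=
    (tendsto_pow_const_mul_const_pow_of_abs_lt_one 2 (by rwa [abs_of_pos hq0])).const_mul _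
  have t2 : Filter.Tendsto (fun n : ℕ => 288 * ((n : ℝ) ^ 1 * (5 / 6 : ℝ) ^ n)
      + 3 * ((n : ℝ) ^ 0 * (2 / 3 : ℝ) ^ n)) Filter.atTop (nhds (288 * 0 + 3 * 0)) :=
    ((tendsto_pow_const_mul_const_pow_of_abs_lt_one 1
      (by rw [abs_of_pos] <;> norm_num)).const_mul _).add
    ((tendsto_pow_const_mul_const_pow_of_abs_lt_one 0
      (by rw [abs_of_pos] <;> norm_num)).const_mul _)
  rw [mul_zero] at t1
  rw [mul_zero, mul_zero, add_zero] at t2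
  filter_upwards [t1.eventually_le_const (show (0 : ℝ) < 1 / 10 ^ 9 by norm_num),
    t2.eventually_le_const (show (0 : ℝ) < 1 by norm_num)] with n hn1 hn2
  rw [hpow]
  constructor
  · refine le_trans ?_ hn1
    rw [Nat.div_div_eq_div_mul]
    calc 720 * (n : ℝ) ^ 2 * (z ^ n) ^ 2 * θ ^ (n / (32 * k))
        ≤ 720 * (n : ℝ) ^ 2 * (z ^ n) ^ 2 * (θ⁻¹ * ϑ ^ n) := by
          gcongr
          exact pow_div_le hθ0 hθ1 hM0 n
      _ = _ := by rw [mul_pow, ← pow_mul, ← pow_mul, mul_comm n 2]; ring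
  · have h5 : z ^ n ≤ (5 / 4) ^ n := by gcongr
    have e1 : (5 / 4 : ℝ) ^ n = (5 / 6) ^ n * (3 / 2) ^ n := by rw [← mul_pow]; norm_num
    have e2 : (2 / 3 : ℝ) ^ n * (3 / 2) ^ n = 1 := by rw [← mul_pow]; norm_num
    have h6 : (0 : ℝ) < (3 / 2) ^ n := by positivity
    rw [pow_one, pow_zero, one_mul] at hn2
    have h7 := mul_le_mul_of_nonneg_right hn2 h6.le
    have h8 : 288 * (n : ℝ) * z ^ n ≤ 288 * n * ((5 / 6) ^ n * (3 / 2) ^ n) := by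
      rw [← e1]; gcongr
    have h9 : (288 * ((n : ℝ) * (5 / 6) ^ n) + 3 * (2 / 3) ^ n) * (3 / 2) ^ n
        = 288 * n * ((5 / 6) ^ n * (3 / 2) ^ n) + 3 * ((2 / 3) ^ n * (3 / 2) ^ n) := by ring
    rw [h9, e2] at h7
    linarith

lemma measurable_sWaveOn {n : ℕ} {s : ℝ} (hs : 0 < s) (m : ℕ) (a b μ : ℝ) (S : Finset (Fin n)) :
    Measurable (sWaveOn s m a b μ S) := by
  unfold sWaveOn
  simp_rw [sWave_eq_wave hs]
  exact (((measurable_wave m).comp ((measurable_centredSum μ S).const_mul s)).const_mul a).add_const b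

/-! ### Assembly of the lower bound. -/

set_option maxHeartbeats 2000000 in
theorem mainTheorem5 :
    ∃ c C : ℝ, 0 < c ∧ 0 < C ∧ ∃ n₀ : ℕ, ∀ κ : ℝ, 0 < κ → ∃ ε₀ : ℝ, 0 < ε₀ ∧
      ∀ n : ℕ, n₀ ≤ n → ∀ s : ℝ, 1 ≤ s →
      ∀ Y : Finset ℝ, IsUniformlySpaced Y → (∀ y ∈ Y, y ∈ Set.Icc (-1 : ℝ) 1) →
        (∃ y ∈ Y, ∃ y' ∈ Y, κ ≤ y' - y) →
      ∃ (m t : ℕ) (a b : ℝ),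
        2 * (2 * (m : ℝ) + 1)
          ≤ C * (s * Real.sqrt (n : ℝ) * Real.log ((Y.card : ℝ) * s * (n : ℝ))) ∧
        c * (s ^ 2 * (n : ℝ)) ≤ (t : ℝ) ∧
        (∀ u : ℝ, a * sWave s m u + b ∈ Set.Icc (-1 : ℝ) 1) ∧
        ∀ r : ℝ → Y, IsRounding r →
        ∀ (D : Measure ℝ) [IsProbabilityMeasure D], HasLogConcaveDensity D →
          variance (fun x : ℝ => x) D = 1 →
        ∀ (Ω : Type) [MeasurableSpace Ω] (P : Measure Ω) [IsProbabilityMeasure P]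
          (A : Ω → SQAlg (Fin n → ℝ) Y) (q : ℕ),
          (∀ S : Finset (Fin n),
            LearnsWithin P A (Measure.pi (fun _ : Fin n => D))
              (fun x => r (sWaveOn s m a b (∫ u, u ∂D) S x)) t q
              (ε₀ - Real.sqrt (1 / (t : ℝ)))) →
          (2 : ℝ) ^ (c * (n : ℝ)) / ((Y.card : ℝ) * s ^ 2) ≤ (q : ℝ) := by
  classical
  obtain ⟨k, θ, hk, hθ0, hθ1, hequi⟩ := exists_equidistribution_rate
  obtain ⟨c, hc0, hc1, hev⟩ := exists_exponent hθ0 hθ1 hk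
  obtain ⟨n₁, hn₁⟩ := Filter.eventually_atTop.mp hev
  refine ⟨c, 5122, hc0, by norm_num, max (max 2 n₁) (⌈576 * 10 ^ 9 * truncConst⌉₊),
    fun κ hκ => ⟨κ ^ 2 / 10 ^ 9, by positivity, ?_⟩⟩
  intro n hn s hs Y hY hY1 hYκ
  rw [max_le_iff, max_le_iff] at hn
  obtain ⟨⟨hn2, hn1⟩, hnK⟩ := hn
  obtain ⟨hb1, hb2⟩ := hn₁ n hn1
  have hnR : (2 : ℝ) ≤ n := by exact_mod_cast hn2
  have hKn : 576 * 10 ^ 9 * truncConst ≤ n := (Nat.le_ceil _).trans (by exact_mod_cast hnK)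
  obtain ⟨hcard, m, a, b, w, ω, ha, hω, hκw, hm, hrange, hw, htail, hvol, hgap⟩ :=
    exists_wave hs hn2 hY hY1 hκ hYκ
  have hNR : (2 : ℝ) ≤ Y.card := by exact_mod_cast hcard
  have hs0 : 0 < s := by linarith
  have hs2 : 1 ≤ s ^ 2 := one_le_pow₀ hs
  have hs2n : 2 ≤ s ^ 2 * n := by nlinarith
  refine ⟨m, ⌈s ^ 2 * n⌉₊, a, b, hm, ?_, hrange, ?_⟩
  · calc c * (s ^ 2 * n) ≤ 1 * (s ^ 2 * n) := by gcongr; linarith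
      _ = s ^ 2 * n := one_mul _
      _ ≤ _ := Nat.le_ceil _
  intro r hr D _ hlc hv Ω _ P _ A q hL
  set t := ⌈s ^ 2 * n⌉₊ with ht
  have ht0 : 0 < t := Nat.ceil_pos.mpr (by linarith)
  have htR : (t : ℝ) ≤ 2 * (s ^ 2 * n) := by
    have := Nat.ceil_lt_add_one (by positivity : 0 ≤ s ^ 2 * n)
    linarith
  set μ := ∫ u, u ∂D with hμ
  set e := θ ^ (n / 32 / k) with he
  have he0 : 0 < e := by positivity
  have hp : 0 < 4 / s := by positivity
  have hp4 : 4 / s ≤ 4 := div_le_self (by norm_num) hs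
  have hED : EquidistributesWithin D (4 / s) (n / 32) e := by
    intro d G hG j hj z
    refine (hequi D hlc hv _ d G hp hp4 hG j z).trans ?_
    have hd : 0 ≤ d := (abs_nonneg _).trans (hG.abs_le 0)
    refine mul_le_mul_of_nonneg_right ?_ hd
    exact pow_le_pow_of_le_one hθ0.le hθ1.le (Nat.div_le_div_right hj)
  set Φ : ℝ → Y := fun x => r (a * periodicWave m (s * x) + b) with hΦdef
  have hΦ : Measurable Φ := hr.measurable.comp
    ((((measurable_periodicWave m).comp (measurable_const_mul s)).const_mul a).add_const b)
  have hper : Function.Periodic Φ (4 / s) := by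
    intro x
    have e1 : s * (x + 4 / s) = s * x + 4 := by field_simp
    simp only [hΦdef, e1, periodicWave_add_four]
  set f : Finset (Fin n) → (Fin n → ℝ) → Y := fun S x => r (sWaveOn s m a b μ S x) with hfdef
  have hf : ∀ S, Measurable (f S) := fun S =>
    hr.measurable.comp (measurable_sWaveOn hs0 m a b μ S)
  set Q : ℝ := Y.card * s * n with hQ
  set T := truncConst * (Q ^ 8)⁻¹ with hT
  have hdis : ∀ S : Finset (Fin n), n / 32 ≤ S.card →
      (Measure.pi (fun _ : Fin n => D)).real {x | f S x ≠ Φ (centredSum μ S x)} ≤ T + e := by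
    intro S hS
    have hR : s * (2 * m / (s * Real.sqrt n) * Real.sqrt n) ≤ 2 * m := by
      have : 0 < Real.sqrt n := Real.sqrt_pos.mpr (by linarith)
      refine le_of_eq ?_
      field_simp
    refine (measureReal_ne_le hED hs0 hlc hv (by omega) hr ha hω hvol hS hR).trans ?_
    linarith
  -- the polynomial and exponential error terms are small
  have hNn : (1 : ℝ) ≤ Y.card := by linarith
  have hnQ : (n : ℝ) ≤ Q := by
    have h1 : (1 : ℝ) ≤ Y.card * s := by nlinarith
    have : 1 * (n : ℝ) ≤ Y.card * s * n := by gcongr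
    linarith
  have hQ1 : 1 ≤ Q := by linarith
  have hT0 : 0 < T := mul_pos truncConst_pos (by positivity)
  -- The truncation error decays like `Q ^ (-8)`, while the second moment argument loses only `(t
  -- |Y|) ^ 2`, of order at most `Q ^ 4`; the threshold on `n` absorbs `truncConst`.
  have hTQ : 576 * (Q ^ 4 * T) ≤ 1 / 10 ^ 9 := by
    have h1 : Q ^ 4 * T = truncConst / Q ^ 4 := by rw [hT]; field_simp
    have h2 : (n : ℝ) ≤ Q ^ 4 := hnQ.trans (le_self_pow₀ hQ1 (by norm_num))
    rw [h1, ← mul_div_assoc, div_le_iff₀ (by positivity)]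
    linarith
  have hTle : 576 * T ≤ 1 / 10 ^ 9 := by
    have h1 : 1 * T ≤ Q ^ 4 * T := by gcongr; exact one_le_pow₀ hQ1
    linarith
  set z := (2 : ℝ) ^ (c * n) with hz
  have hz0 : 0 < z := by positivity
  have hz1 : 1 ≤ z := Real.one_le_rpow (by norm_num) (by positivity)
  have hele : 720 * e ≤ 1 / 10 ^ 9 := by
    have h1 : (1 : ℝ) ≤ n ^ 2 * z ^ 2 := by
      have h2 : (1 : ℝ) ≤ n ^ 2 := one_le_pow₀ (by linarith)
      have h3 : 1 ≤ z ^ 2 := one_le_pow₀ hz1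
      nlinarith
    have h4 : 1 * e ≤ (n ^ 2 * z ^ 2) * e := by gcongr
    linarith
  -- the hard family
  obtain ⟨𝓕, hF1, hF2, hF3⟩ := exists_separated_family_of_large n
  -- The distance is at least `w ^ 2 * (2 * 0.00375 ^ 2 / 4000 - 1 / 10 ^ 9)`, about `6 * w ^ 2 / 10
  -- ^ 9`, above the `4 * κ ^ 2 / 10 ^ 9` allowed by a common hypothesis. The term `√(1 / t)` only
  -- strengthens the assumption on the learner and is dropped.
  have hsep : ∀ i j : {S // S ∈ 𝓕}, ∀ g : (Fin n → ℝ) → ℝ, Measurable g →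
      regressionError (Measure.pi (fun _ : Fin n => D)) g (fun x => (f i.1 x : ℝ))
        < ENNReal.ofReal (κ ^ 2 / 10 ^ 9 - Real.sqrt (1 / (t : ℝ))) →
      regressionError (Measure.pi (fun _ : Fin n => D)) g (fun x => (f j.1 x : ℝ))
        < ENNReal.ofReal (κ ^ 2 / 10 ^ 9 - Real.sqrt (1 / (t : ℝ))) → i = j := by
    intro i j g hg h1 h2
    by_contra hij
    have hle : ENNReal.ofReal (κ ^ 2 / 10 ^ 9 - Real.sqrt (1 / (t : ℝ)))
        ≤ ENNReal.ofReal (κ ^ 2 / 10 ^ 9) :=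
      ENNReal.ofReal_le_ofReal (by linarith [Real.sqrt_nonneg (1 / (t : ℝ))])
    have h3 := lt_of_regressionError_lt hg (measurable_subtype_coe.comp (hf i.1))
      (measurable_subtype_coe.comp (hf j.1)) (h1.trans_le hle) (h2.trans_le hle)
    have hij' : i.1 ≠ j.1 := fun h => hij (Subtype.ext h)
    have hρ : 1 / (1000 * s) ≤ 4 / s / 4 := by
      rw [div_div, div_le_div_iff₀ (by positivity) (by positivity)]
      linarith
    have hw0 : 0 < w := by linarith
    have h4 := le_integral_sq_sub (μ := μ) hED hp hΦ hper hf hw (ρ := 1 / (1000 * s))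
      (γ := 0.00375 * w) (by positivity) hρ (by positivity) (hgap r hr) (hF1 _ i.2) (hF1 _ j.2)
      (hF2 _ i.2 _ j.2 hij') (hdis _ (hF1 _ i.2)) (hdis _ (hF1 _ j.2))
    have e1 : 1 / (1000 * s) * (0.00375 * w) ^ 2 / (4 / s) = w ^ 2 * (0.00375 ^ 2 / 4000) := by
      have hs' : s ≠ 0 := hs0.ne'
      field_simp
      norm_num
    rw [e1] at h4
    have h5 : κ ^ 2 ≤ w ^ 2 := pow_le_pow_left₀ hκ.le hκw 2
    have h6 : 4 * e + 2 * (T + e) ≤ 1 / 10 ^ 9 := by linarith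
    have h7 : w ^ 2 * (4 * e + 2 * (T + e)) ≤ w ^ 2 * (1 / 10 ^ 9) := by gcongr
    simp only [Function.comp_apply] at h3
    norm_num at h3 h4 h7
    have h8 : 0 < w ^ 2 := by positivity
    linarith
  have hcardF : Fintype.card {S // S ∈ 𝓕} = 𝓕.card := Fintype.card_coe 𝓕
  -- With no queries, at most two concepts could be learned, whatever the bad sets are.
  have hq1 : 1 ≤ q := by
    by_contra hq
    have hq0 : q = 0 := by omega
    subst hq0
    have h1 := card_le_of_learnsWithin P A (Measure.pi (fun _ : Fin n => D))
      (fun i : {S // S ∈ 𝓕} => f i.1) t 0 (Fintype.card {S // S ∈ 𝓕}) _ (fun _ => 0)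
      (fun h => Finset.card_le_univ _) hsep (fun i => hL i.1)
    rw [hcardF] at h1
    have h2 : (𝓕.card : ℝ) ≤ 2 := by exact_mod_cast (by omega : 𝓕.card ≤ 2)
    have h3 : 288 * (n : ℝ) * 1 ≤ 288 * n * z := by gcongr
    linarith
  have hq1R : (1 : ℝ) ≤ q := by exact_mod_cast hq1
  -- If `|Y| s ^ 2` already exceeds `2 ^ (c n)`, the claim is only `1 ≤ q`. Otherwise `t * |Y|` is
  -- at most `2 * n * 2 ^ (c n)`, which the error `e` overcomes.
  rcases le_or_gt z (Y.card * s ^ 2) with hcase | hcase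
  · refine le_trans ?_ hq1R
    rwa [div_le_one (by positivity)]
  have : Nonempty Y := ⟨r 0⟩
  have hcardY : Fintype.card Y = Y.card := Fintype.card_coe Y
  have hδ : 36 * (t : ℝ) ^ 2 * (Fintype.card Y : ℝ) ^ 2 * (e + 4 * (T + e)) ≤ 1 := by
    rw [hcardY]
    have h1 : (t : ℝ) * Y.card ≤ 2 * (s ^ 2 * n) * Y.card := by gcongr
    have h2 : ((t : ℝ) * Y.card) ^ 2 ≤ (2 * (s ^ 2 * n) * Y.card) ^ 2 :=
      pow_le_pow_left₀ (by positivity) h1 2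
    have h3 : (Y.card * s ^ 2) ^ 2 ≤ z ^ 2 := pow_le_pow_left₀ (by positivity) hcase.le 2
    have h4 : (s ^ 2 * n * Y.card) ^ 2 ≤ Q ^ 4 := by
      have h5 : s ^ 2 * n * Y.card ≤ Q ^ 2 := by
        have h6 : (1 : ℝ) ≤ Y.card * n := by nlinarith
        have h7 : s ^ 2 * n * Y.card * 1 ≤ s ^ 2 * n * Y.card * (Y.card * n) := by gcongr
        have h8 : s ^ 2 * n * Y.card * (Y.card * n) = Q ^ 2 := by rw [hQ]; ring
        linarith
      calc (s ^ 2 * n * Y.card) ^ 2 ≤ (Q ^ 2) ^ 2 := pow_le_pow_left₀ (by positivity) h5 2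
        _ = Q ^ 4 := by ring
    have h9 : (n : ℝ) ^ 2 * (Y.card * s ^ 2) ^ 2 * e ≤ n ^ 2 * z ^ 2 * e := by gcongr
    have h10 : (s ^ 2 * n * Y.card) ^ 2 * T ≤ Q ^ 4 * T := by gcongr
    calc 36 * (t : ℝ) ^ 2 * (Y.card : ℝ) ^ 2 * (e + 4 * (T + e))
        = 36 * ((t : ℝ) * Y.card) ^ 2 * (e + 4 * (T + e)) := by ring
      _ ≤ 36 * (2 * (s ^ 2 * n) * Y.card) ^ 2 * (e + 4 * (T + e)) := by gcongr
      _ = 720 * (n ^ 2 * (Y.card * s ^ 2) ^ 2 * e) + 576 * ((s ^ 2 * n * Y.card) ^ 2 * T) := by ring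
      _ ≤ 1 := by
          have e2 : 720 * (n : ℝ) ^ 2 * z ^ 2 * e = 720 * (n ^ 2 * z ^ 2 * e) := by ring
          rw [e2] at hb1
          norm_num at hb1 hTQ
          linarith
  have htN : (1 : ℝ) ≤ t * Fintype.card Y := by
    have h1 : 1 ≤ t * Fintype.card Y := Nat.mul_pos ht0 (hcardY ▸ by omega)
    exact_mod_cast h1
  have hdiag : ∀ (i : {S // S ∈ 𝓕}) (y : Y), ∫ x, (if f i.1 x = y then (1 : ℝ) else 0)
      ∂(Measure.pi (fun _ : Fin n => D)) ≤ labelMass (4 / s) Φ y + 1 / (t * Fintype.card Y) := by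
    intro i y
    refine (integral_ite_le hED hp hΦ hper hf (hF1 _ i.2) (hdis _ (hF1 _ i.2)) y).trans ?_
    have h1 : e + (T + e) ≤ 1 / (t * Fintype.card Y) := by
      rw [le_div_iff₀ (by linarith)]
      set u : ℝ := t * Fintype.card Y with hu
      have h2 : 36 * u ^ 2 * (e + 4 * (T + e)) ≤ 1 := by
        rw [hu, mul_pow, ← mul_assoc]; exact hδ
      have h3 : u ≤ u ^ 2 := le_self_pow₀ htN (by norm_num)
      have h4 : (e + (T + e)) * u ≤ (36 * (e + 4 * (T + e))) * u ^ 2 := by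
        gcongr
        linarith
      linarith
    linarith
  have hB : ∀ h : SQQuery (Fin n → ℝ) Y, (Finset.univ.filter (fun i : {S // S ∈ 𝓕} =>
      ¬ IsVSTATAnswer t (Measure.pi (fun _ : Fin n => D)) (f i.1) h
        (∑ y, labelMass (4 / s) Φ y * ∫ x, h.toFun (x, y) ∂(Measure.pi (fun _ : Fin n => D))))).card
      ≤ 72 * t * Y.card := by
    intro h
    rw [← hcardY]
    exact card_not_isVSTATAnswer_le (Measure.pi (fun _ : Fin n => D))
      (fun i : {S // S ∈ 𝓕} => f i.1) (fun i => hf i.1) (labelMass (4 / s) Φ)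
      (fun y => (labelMass_mem_Icc hp hΦ y).1) (sum_labelMass hp hΦ) t ht0 (e + 4 * (T + e))
      (by positivity) hδ (fun i j hij y => by
        convert abs_integral_ite_mul_ite_le hED hp hΦ hper hf
          (hF2 _ i.2 _ j.2 (fun h => hij (Subtype.ext h))) (hdis _ (hF1 _ i.2))
          (hdis _ (hF1 _ j.2)) y)
      (fun i y => by convert hdiag i y) h
  -- The count reads `(3/2) ^ n - 1 ≤ 288 * q * n * s ^ 2 * |Y| + 2`, and the choice of `c` bounds
  -- the left side below by `288 * n * 2 ^ (c n) + 2`.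
  have h1 := card_le_of_learnsWithin P A (Measure.pi (fun _ : Fin n => D))
      (fun i : {S // S ∈ 𝓕} => f i.1) t q (72 * t * Y.card) _
      (fun h => ∑ y, labelMass (4 / s) Φ y * ∫ x, h.toFun (x, y) ∂(Measure.pi (fun _ : Fin n => D)))
      (fun h => by convert hB h) hsep (fun i => hL i.1)
  rw [hcardF] at h1
  have h2 : (𝓕.card : ℝ) ≤ 2 * (q * (72 * t * Y.card) + 1) := by exact_mod_cast h1
  have h3 : (q : ℝ) * (72 * t * Y.card) ≤ q * (72 * (2 * (s ^ 2 * n)) * Y.card) := by gcongr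
  rw [div_le_iff₀ (by positivity)]
  have h4 : 288 * (n : ℝ) * z ≤ 288 * n * (q * (Y.card * s ^ 2)) := by linarith
  exact le_of_mul_le_mul_left h4 (by positivity)
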